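/- **Setting.** Let $\mathbb K\in\{\mathbb R,\mathbb C\}$, let $d\ge 1$ be an integer, and let $E\neq\{0\}$ be a sequentially complete locally convex Hausdorff space over $\mathbb K$, whose topology is given by a directed system of seminorms $(p_\alpha)_{\alpha\in\mathfrak A}$. Write $|\cdot|$ for the Euclidean norm on $\mathbb R^d$. * $\mathcal S(\mathbb R^d,E)$ is the space of infinitely continuously partially differentiable $f:\mathbb R^d\to E$ with $$|f|_{l,\alpha}:=\sup_{x\in\mathbb R^d,\ \beta\in\mathbb N_0^d,\ |\beta|_1\le l}p_\alpha(\partial^\beta f(x))\,(1+|x|^2)^{l/2}<\infty$$ for all $l\in\mathbb N$, $\alpha\in\mathfrak A$, where $|\beta|_1=\sum_i\beta_i$. Further, $s(\mathbb N_0^d,E)$ is the space of all families $x=(x_n)_{n\in\mathbb N_0^d}$ in $E$ with $|x|_{j,\alpha}:=\sup_{n}p_\alpha(x_n)(1+|n|^2)^{j/2}<\infty$ for all $j\in\mathbb N$, $\alpha\in\mathfrak A$. Both spaces carry the topology given by these seminorms; $\mathcal S(\mathbb R^d):=\mathcal S(\mathbb R^d,\mathbb K)$ and $s(\mathbb N_0^d):=s(\mathbb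 N_0^d,\mathbb K)$. * For $n\in\mathbb N_0^d$ let $h_n(x)=\prod_{k=1}^d h_{n_k}(x_k)$ be the Hermite functions, where for $m\in\mathbb N_0$ and $t\in\mathbb R$, $h_m(t)=(2^m m!\sqrt\pi)^{-1/2}H_m(t)e^{-t^2/2}$ with $H_0=1$, $H_{m+1}(t)=2tH_m(t)-H_m'(t)$. * A function $g:\mathbb R^d\to E$ is Pettis-integrable if $e'\circ g$ is Lebesgue-integrable for every $e'\in E'$ and there is $e\in E$ with $e'(e)=\int_{\mathbb R^d}e'(g(x))\,dx$ for all $e'\in E'$; then $\int_{\mathbb R^d}g(x)\,dx:=e$. * For a locally convex Hausdorff space $F$, let $F'_\kappa$ be its dual with the topology of uniform convergence on the absolutely convex compact subsets of $F$, and let $F\varepsilon E$ be the space of continuous linear maps $F'_\kappa\to E$ with the topology of uniform convergence on the equicontinuous subsets of $F'$. For a continuous linear map $T:F_1\to F_2$, let $(T\,\varepsilon\,\mathrm{id}_E)(u):=u\circ T^t$ for $u\in F_1\varepsilon E$, where $T^t(y)=y\circ T$. * A Schauder decomposition of a locally convex space $V$ is a sequence $(P_k)$ of continuous linear projections on $V$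 with $P_kP_j=P_{\min(j,k)}$ for all $j,k$, $P_k\ne P_j$ for $k\neq j$, and $P_kf\to f$ for every $f\in V$. **Theorem.** For all $f\in\mathcal S(\mathbb R^d,E)$ and $n\in\mathbb N_0^d$ the function $f h_n$ is Pettis-integrable on $\mathbb R^d$, and with $\widehat f(n):=\int_{\mathbb R^d}f(x)h_n(x)\,dx$ the following holds (the same definition with $E=\mathbb K$ gives $\mathscr F^{\mathbb K}$). a) The map $\mathscr F^E:\mathcal S(\mathbb R^d,E)\to s(\mathbb N_0^d,E)$, $\mathscr F^E(f)=(\widehat f(n))_{n\in\mathbb N_0^d}$, is well defined and an isomorphism of topological vector spaces, and so is $\mathscr F^{\mathbb K}:\mathcal S(\mathbb R^d)\to s(\mathbb N_0^d)$. The maps $$S_{\mathcal S(\mathbb R^d)}:\mathcal S(\mathbb R^d)\varepsilon E\to\mathcal S(\mathbb R^d,E),\quad u\mapsto[x\mapsto u(\delta_x)],\qquad S_{s(\mathbb N_0^d)}:s(\mathbb N_0^d)\varepsilon E\to s(\mathbb N_0^d,E),\quad u\mapsto(u(\delta_n))_{n},$$ where $\delta_x$, $\delta_n$ are the point evaluations,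 are well defined and isomorphisms of topological vector spaces; in particular $\mathcal S(\mathbb R^d,E)\cong\mathcal S(\mathbb R^d)\varepsilon E$. Moreover $$\mathscr F^E=S_{s(\mathbb N_0^d)}\circ(\mathscr F^{\mathbb K}\,\varepsilon\,\mathrm{id}_E)\circ S_{\mathcal S(\mathbb R^d)}^{-1}.$$ b) For each $n$ the map $f\mapsto\widehat f(n)h_n$ is a continuous linear operator on $\mathcal S(\mathbb R^d,E)$. The operators $P_k f=\sum_{n\in\mathbb N_0^d,\ |n|\le k}\widehat f(n)h_n$, $k\in\mathbb N_0$, form a Schauder decomposition of $\mathcal S(\mathbb R^d,E)$, and $$f=\sum_{n\in\mathbb N_0^d}\widehat f(n)h_n\qquad\text{for all } f\in\mathcal S(\mathbb R^d,E),$$ where the series converges unconditionally in $\mathcal S(\mathbb R^d,E)$. -/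

import Mathlib

open Filter Topology MeasureTheory

set_option linter.unusedSectionVars false

noncomputable section

/-! ### Partial derivatives of functions on `ℝ^d` with values in a topological vector space -/

section Smooth

variable (𝕜 : Type*) [RCLike 𝕜] {d : ℕ} {E : Type*} [AddCommGroup E] [Module 𝕜 E]
  [TopologicalSpace E]

/-- `v` is the limit of the difference quotients `(f (x + h e_i) - f x) / h` for real `h → 0`,
`h ≠ 0`. -/
def HasPartialDerivAt (i : Fin d) (f : EuclideanSpace ℝ (Fin d) → E)
    (x : EuclideanSpace ℝ (Fin d)) (v : E) : Prop :=
  Tendsto (fun h : ℝ => ((h : 𝕜))⁻¹ • (f (x + h • EuclideanSpace.single i (1 : ℝ)) - f x))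
    (𝓝[≠] 0) (𝓝 v)

/-- The `i`-th partial derivative (meaningful where the limit exists). -/
def partialDeriv (i : Fin d) (f : EuclideanSpace ℝ (Fin d) → E) :
    EuclideanSpace ℝ (Fin d) → E := fun x =>
  limUnder (𝓝[≠] (0 : ℝ))
    (fun h : ℝ => ((h : 𝕜))⁻¹ • (f (x + h • EuclideanSpace.single i (1 : ℝ)) - f x))

/-- `f` is continuously partially differentiable: all first partial derivatives exist everywhere
and are continuous. -/
def IsC1 (f : EuclideanSpace ℝ (Fin d) → E) : Prop :=
  ∀ i : Fin d, (∀ x, ∃ v, HasPartialDerivAt 𝕜 i f x v) ∧ Continuous (partialDeriv 𝕜 i f)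

/-- `f` is `k`-times continuously partially differentiable. -/
def IsCk : ℕ → (EuclideanSpace ℝ (Fin d) → E) → Prop
  | 0, f => Continuous f
  | k + 1, f => IsC1 𝕜 f ∧ ∀ i : Fin d, IsCk k (partialDeriv 𝕜 i f)

/-- `f` is infinitely continuously partially differentiable. -/
def IsCinf (f : EuclideanSpace ℝ (Fin d) → E) : Prop := ∀ k : ℕ, IsCk 𝕜 k f

/-- `∂^β f = ∂_1^{β_1} ⋯ ∂_d^{β_d} f` for a multi-index `β`. -/
def iterPartialDeriv (β : Fin d → ℕ) (f : EuclideanSpace ℝ (Fin d) → E) :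
    EuclideanSpace ℝ (Fin d) → E :=
  (List.finRange d).foldr (fun i g => (partialDeriv 𝕜 i)^[β i] g) f

variable {𝕜}

theorem IsCinf.continuous {f : EuclideanSpace ℝ (Fin d) → E} (hf : IsCinf 𝕜 f) :
    Continuous f := hf 0

theorem IsCinf.isC1 {f : EuclideanSpace ℝ (Fin d) → E} (hf : IsCinf 𝕜 f) : IsC1 𝕜 f := (hf 1).1

theorem IsCinf.partialDeriv {f : EuclideanSpace ℝ (Fin d) → E} (hf : IsCinf 𝕜 f) (i : Fin d) :
    IsCinf 𝕜 (partialDeriv 𝕜 i f) := fun k => (hf (k + 1)).2 i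

theorem HasPartialDerivAt.partialDeriv_eq [T2Space E] {i : Fin d}
    {f : EuclideanSpace ℝ (Fin d) → E} {x : EuclideanSpace ℝ (Fin d)} {v : E}
    (h : HasPartialDerivAt 𝕜 i f x v) : partialDeriv 𝕜 i f x = v :=
  h.limUnder_eq

theorem IsC1.hasPartialDerivAt [T2Space E] {f : EuclideanSpace ℝ (Fin d) → E} (hf : IsC1 𝕜 f)
    (i : Fin d) (x : EuclideanSpace ℝ (Fin d)) :
    HasPartialDerivAt 𝕜 i f x (partialDeriv 𝕜 i f x) := by
  obtain ⟨v, hv⟩ := (hf i).1 x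
  rwa [hv.partialDeriv_eq]

variable [IsTopologicalAddGroup E] [ContinuousSMul 𝕜 E]

theorem HasPartialDerivAt.add {i : Fin d} {f g : EuclideanSpace ℝ (Fin d) → E}
    {x : EuclideanSpace ℝ (Fin d)} {v w : E} (hf : HasPartialDerivAt 𝕜 i f x v)
    (hg : HasPartialDerivAt 𝕜 i g x w) : HasPartialDerivAt 𝕜 i (f + g) x (v + w) := by
  refine (Tendsto.add hf hg).congr fun h => ?_
  rw [← smul_add, Pi.add_apply, Pi.add_apply]
  congr 1
  abel

theorem HasPartialDerivAt.const_smul {i : Fin d} {f : EuclideanSpace ℝ (Fin d) → E}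
    {x : EuclideanSpace ℝ (Fin d)} {v : E} (c : 𝕜) (hf : HasPartialDerivAt 𝕜 i f x v) :
    HasPartialDerivAt 𝕜 i (c • f) x (c • v) := by
  refine (Tendsto.const_smul hf c).congr fun h => ?_
  rw [Pi.smul_apply, Pi.smul_apply, ← smul_sub, smul_comm]

variable [T2Space E]

theorem IsC1.partialDeriv_add {f g : EuclideanSpace ℝ (Fin d) → E} (hf : IsC1 𝕜 f)
    (hg : IsC1 𝕜 g) (i : Fin d) :
    partialDeriv 𝕜 i (f + g) = partialDeriv 𝕜 i f + partialDeriv 𝕜 i g := by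
  ext x
  exact ((hf.hasPartialDerivAt i x).add (hg.hasPartialDerivAt i x)).partialDeriv_eq

theorem IsC1.partialDeriv_smul {f : EuclideanSpace ℝ (Fin d) → E} (hf : IsC1 𝕜 f) (c : 𝕜)
    (i : Fin d) : partialDeriv 𝕜 i (c • f) = c • partialDeriv 𝕜 i f := by
  ext x
  exact ((hf.hasPartialDerivAt i x).const_smul c).partialDeriv_eq

theorem IsC1.add {f g : EuclideanSpace ℝ (Fin d) → E} (hf : IsC1 𝕜 f)
    (hg : IsC1 𝕜 g) : IsC1 𝕜 (f + g) := fun i =>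
  ⟨fun x => ⟨_, (hf.hasPartialDerivAt i x).add (hg.hasPartialDerivAt i x)⟩, by
    rw [hf.partialDeriv_add hg]; exact (hf i).2.add (hg i).2⟩

theorem IsC1.const_smul {f : EuclideanSpace ℝ (Fin d) → E} (hf : IsC1 𝕜 f) (c : 𝕜) :
    IsC1 𝕜 (c • f) := fun i =>
  ⟨fun x => ⟨_, (hf.hasPartialDerivAt i x).const_smul c⟩, by
    rw [hf.partialDeriv_smul]; exact (hf i).2.const_smul c⟩

theorem IsCk.add {k : ℕ} : ∀ {f g : EuclideanSpace ℝ (Fin d) → E}, IsCk 𝕜 k f →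
    IsCk 𝕜 k g → IsCk 𝕜 k (f + g) := by
  induction k with
  | zero => exact fun hf hg => Continuous.add hf hg
  | succ k ih =>
    exact fun hf hg => ⟨hf.1.add hg.1, fun i => by
      rw [hf.1.partialDeriv_add hg.1]; exact ih (hf.2 i) (hg.2 i)⟩

theorem IsCk.const_smul {k : ℕ} (c : 𝕜) : ∀ {f : EuclideanSpace ℝ (Fin d) → E}, IsCk 𝕜 k f →
    IsCk 𝕜 k (c • f) := by
  induction k with
  | zero => exact fun hf => Continuous.const_smul hf c
  | succ k ih =>
    exact fun hf => ⟨hf.1.const_smul c, fun i => by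
      rw [hf.1.partialDeriv_smul]; exact ih (hf.2 i)⟩

theorem IsCk.zero (k : ℕ) : IsCk 𝕜 k (0 : EuclideanSpace ℝ (Fin d) → E) := by
  have h0 : ∀ i x, HasPartialDerivAt 𝕜 i (0 : EuclideanSpace ℝ (Fin d) → E) x 0 := by
    intro i x
    simp [HasPartialDerivAt]
  have h1 : ∀ i, _root_.partialDeriv 𝕜 i (0 : EuclideanSpace ℝ (Fin d) → E) = 0 := fun i => by
    ext x; exact (h0 i x).partialDeriv_eq
  induction k with
  | zero => exact continuous_zero
  | succ k ih =>
    exact ⟨fun i => ⟨fun x => ⟨0, h0 i x⟩, by rw [h1]; exact continuous_zero⟩,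
      fun i => by rw [h1]; exact ih⟩

theorem iterate_partialDeriv_props (i : Fin d) (m : ℕ) :
    (∀ f : EuclideanSpace ℝ (Fin d) → E, IsCinf 𝕜 f → IsCinf 𝕜 ((partialDeriv 𝕜 i)^[m] f)) ∧
    (∀ f g : EuclideanSpace ℝ (Fin d) → E, IsCinf 𝕜 f → IsCinf 𝕜 g →
      (partialDeriv 𝕜 i)^[m] (f + g) = (partialDeriv 𝕜 i)^[m] f + (partialDeriv 𝕜 i)^[m] g) ∧
    (∀ (c : 𝕜) (f : EuclideanSpace ℝ (Fin d) → E), IsCinf 𝕜 f →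
      (partialDeriv 𝕜 i)^[m] (c • f) = c • (partialDeriv 𝕜 i)^[m] f) := by
  induction m with
  | zero => simp
  | succ m ih =>
    obtain ⟨h1, h2, h3⟩ := ih
    refine ⟨fun f hf => ?_, fun f g hf hg => ?_, fun c f hf => ?_⟩
    · exact h1 _ (hf.partialDeriv i)
    · simp only [Function.iterate_succ_apply]
      rw [hf.isC1.partialDeriv_add hg.isC1, h2 _ _ (hf.partialDeriv i) (hg.partialDeriv i)]
    · simp only [Function.iterate_succ_apply]
      rw [hf.isC1.partialDeriv_smul, h3 _ _ (hf.partialDeriv i)]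

theorem foldr_partialDeriv_props (β : Fin d → ℕ) (l : List (Fin d)) :
    (∀ f : EuclideanSpace ℝ (Fin d) → E, IsCinf 𝕜 f →
      IsCinf 𝕜 (l.foldr (fun i g => (partialDeriv 𝕜 i)^[β i] g) f)) ∧
    (∀ f g : EuclideanSpace ℝ (Fin d) → E, IsCinf 𝕜 f → IsCinf 𝕜 g →
      l.foldr (fun i g => (partialDeriv 𝕜 i)^[β i] g) (f + g) =
        l.foldr (fun i g => (partialDeriv 𝕜 i)^[β i] g) f +
          l.foldr (fun i g => (partialDeriv 𝕜 i)^[β i] g) g) ∧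
    (∀ (c : 𝕜) (f : EuclideanSpace ℝ (Fin d) → E), IsCinf 𝕜 f →
      l.foldr (fun i g => (partialDeriv 𝕜 i)^[β i] g) (c • f) =
        c • l.foldr (fun i g => (partialDeriv 𝕜 i)^[β i] g) f) := by
  induction l with
  | nil => simp
  | cons i l ih =>
    obtain ⟨h1, h2, h3⟩ := ih
    obtain ⟨k1, k2, k3⟩ := iterate_partialDeriv_props (𝕜 := 𝕜) (E := E) i (β i)
    refine ⟨fun f hf => ?_, fun f g hf hg => ?_, fun c f hf => ?_⟩
    · exact k1 _ (h1 f hf)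
    · rw [List.foldr_cons, h2 f g hf hg, k2 _ _ (h1 f hf) (h1 g hg)]; rfl
    · rw [List.foldr_cons, h3 c f hf, k3 _ _ (h1 f hf)]; rfl

theorem IsCinf.iterPartialDeriv {f : EuclideanSpace ℝ (Fin d) → E} (hf : IsCinf 𝕜 f)
    (β : Fin d → ℕ) : IsCinf 𝕜 (iterPartialDeriv 𝕜 β f) :=
  (foldr_partialDeriv_props β _).1 f hf

theorem iterPartialDeriv_add {f g : EuclideanSpace ℝ (Fin d) → E} (hf : IsCinf 𝕜 f)
    (hg : IsCinf 𝕜 g) (β : Fin d → ℕ) :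
    iterPartialDeriv 𝕜 β (f + g) = iterPartialDeriv 𝕜 β f + iterPartialDeriv 𝕜 β g :=
  (foldr_partialDeriv_props β _).2.1 f g hf hg

theorem iterPartialDeriv_smul {f : EuclideanSpace ℝ (Fin d) → E} (c : 𝕜) (hf : IsCinf 𝕜 f)
    (β : Fin d → ℕ) : iterPartialDeriv 𝕜 β (c • f) = c • iterPartialDeriv 𝕜 β f :=
  (foldr_partialDeriv_props β _).2.2 c f hf

theorem iterPartialDeriv_zero_fun (β : Fin d → ℕ) :
    iterPartialDeriv 𝕜 β (0 : EuclideanSpace ℝ (Fin d) → E) = 0 := by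
  have h := iterPartialDeriv_smul (0 : 𝕜)
    (f := (0 : EuclideanSpace ℝ (Fin d) → E)) IsCk.zero β
  rwa [zero_smul, zero_smul] at h

theorem iterPartialDeriv_zero (f : EuclideanSpace ℝ (Fin d) → E) :
    iterPartialDeriv 𝕜 (0 : Fin d → ℕ) f = f := by
  have : ∀ l : List (Fin d), l.foldr
      (fun i g => (partialDeriv 𝕜 i)^[(0 : Fin d → ℕ) i] g) f = f := by
    intro l
    induction l with
    | nil => rfl
    | cons i l ih => rw [List.foldr_cons, ih]; rfl
  exact this _

end Smooth

/-! ### Weighted supremum seminorms -/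

section SupSeminorm

variable {𝕜 : Type*} [RCLike 𝕜] {E V J : Type*} [AddCommGroup E] [Module 𝕜 E]

/-- Finite weighted suprema are stable under the vector space operations. -/
theorem bddAbove_add (p : Seminorm 𝕜 E) {w : J → ℝ} (hw : ∀ j, 0 ≤ w j) {a b : J → E}
    (ha : BddAbove (Set.range fun j => p (a j) * w j))
    (hb : BddAbove (Set.range fun j => p (b j) * w j)) :
    BddAbove (Set.range fun j => p (a j + b j) * w j) := by
  obtain ⟨A, hA⟩ := ha
  obtain ⟨B, hB⟩ := hb
  refine ⟨A + B, ?_⟩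
  rintro _ ⟨j, rfl⟩
  have h1 := hA ⟨j, rfl⟩
  have h2 := hB ⟨j, rfl⟩
  have h3 := mul_le_mul_of_nonneg_right (map_add_le_add p (a j) (b j)) (hw j)
  simp only at h1 h2 ⊢
  linarith

theorem bddAbove_smul (p : Seminorm 𝕜 E) {w : J → ℝ} (c : 𝕜) {a : J → E}
    (ha : BddAbove (Set.range fun j => p (a j) * w j)) :
    BddAbove (Set.range fun j => p (c • a j) * w j) := by
  obtain ⟨A, hA⟩ := ha
  refine ⟨‖c‖ * A, ?_⟩
  rintro _ ⟨j, rfl⟩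
  have h1 := hA ⟨j, rfl⟩
  simp only at h1 ⊢
  rw [map_smul_eq_mul, mul_assoc]
  exact mul_le_mul_of_nonneg_left h1 (norm_nonneg c)

variable [AddCommGroup V] [Module 𝕜 V]

/-- The seminorm `f ↦ sup_j p (T_j f) w_j` on a space on which all these suprema are finite. -/
def supSeminorm [Nonempty J] (p : Seminorm 𝕜 E) (T : J → V →ₗ[𝕜] E) (w : J → ℝ)
    (hw : ∀ j, 0 ≤ w j) (hb : ∀ f, BddAbove (Set.range fun j => p (T j f) * w j)) :
    Seminorm 𝕜 V :=
  Seminorm.of (fun f => ⨆ j, p (T j f) * w j)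
    (fun f g => by
      refine ciSup_le fun j => ?_
      have h1 := le_ciSup (hb f) j
      have h2 := le_ciSup (hb g) j
      have h3 := mul_le_mul_of_nonneg_right (map_add_le_add p (T j f) (T j g)) (hw j)
      rw [map_add]
      linarith)
    (fun c f => by
      simp only [map_smul, map_smul_eq_mul, mul_assoc]
      exact (Real.mul_iSup_of_nonneg (norm_nonneg c) _).symm)

theorem supSeminorm_apply [Nonempty J] (p : Seminorm 𝕜 E) (T : J → V →ₗ[𝕜] E) (w : J → ℝ)
    (hw : ∀ j, 0 ≤ w j) (hb : ∀ f, BddAbove (Set.range fun j => p (T j f) * w j)) (f : V) :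
    supSeminorm p T w hw hb f = ⨆ j, p (T j f) * w j := rfl

end SupSeminorm

/-! ### The Schwartz space `S(ℝ^d, E)`

The seminorms defining the topology of `E` are all the continuous seminorms on `E`. -/

section Schwartz

variable (𝕜 : Type*) [RCLike 𝕜] (d : ℕ) (E : Type*) [AddCommGroup E] [Module 𝕜 E]
  [TopologicalSpace E]

/-- The pairs `(x, β)` with `x ∈ ℝ^d` and `β` a multi-index of order `|β| = ∑ β_i ≤ l`. -/
abbrev SchwartzIndex (l : ℕ) : Type :=
  EuclideanSpace ℝ (Fin d) × {β : Fin d → ℕ // ∑ i, β i ≤ l}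

instance (l : ℕ) : Nonempty (SchwartzIndex d l) := ⟨(0, ⟨0, by simp⟩)⟩

variable {d} in
/-- The weight `(1 + |x|²)^{l/2}`. -/
def schwartzWeight (l : ℕ) (x : EuclideanSpace ℝ (Fin d)) : ℝ :=
  (1 + ‖x‖ ^ 2) ^ ((l : ℝ) / 2)

variable {d} in
theorem schwartzWeight_nonneg (l : ℕ) (x : EuclideanSpace ℝ (Fin d)) :
    0 ≤ schwartzWeight l x := by
  unfold schwartzWeight; positivity

variable [IsTopologicalAddGroup E] [ContinuousSMul 𝕜 E] [T2Space E]

variable {d E} in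
/-- `f` is smooth and `sup_{x, |β| ≤ l} p (∂^β f x) (1 + |x|²)^{l/2} < ∞` for all `l` and all
continuous seminorms `p` on `E`. -/
def IsSchwartz (f : EuclideanSpace ℝ (Fin d) → E) : Prop :=
  IsCinf 𝕜 f ∧ ∀ (p : Seminorm 𝕜 E), Continuous p → ∀ l : ℕ,
    BddAbove (Set.range fun j : SchwartzIndex d l =>
      p (iterPartialDeriv 𝕜 j.2 f j.1) * schwartzWeight l j.1)

variable {𝕜 d E} in
theorem IsSchwartz.add {f g : EuclideanSpace ℝ (Fin d) → E} (hf : IsSchwartz 𝕜 f)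
    (hg : IsSchwartz 𝕜 g) : IsSchwartz 𝕜 (f + g) := by
  refine ⟨fun k => (hf.1 k).add (hg.1 k), fun p hp l => ?_⟩
  simp only [iterPartialDeriv_add hf.1 hg.1, Pi.add_apply]
  exact bddAbove_add p (w := fun j : SchwartzIndex d l => schwartzWeight l j.1)
    (a := fun j => iterPartialDeriv 𝕜 j.2 f j.1) (b := fun j => iterPartialDeriv 𝕜 j.2 g j.1)
    (fun j => schwartzWeight_nonneg l j.1) (hf.2 p hp l) (hg.2 p hp l)

variable {𝕜 d E} in
theorem IsSchwartz.const_smul (c : 𝕜) {f : EuclideanSpace ℝ (Fin d) → E}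
    (hf : IsSchwartz 𝕜 f) : IsSchwartz 𝕜 (c • f) := by
  refine ⟨fun k => (hf.1 k).const_smul c, fun p hp l => ?_⟩
  simp only [iterPartialDeriv_smul c hf.1, Pi.smul_apply]
  exact bddAbove_smul p c (hf.2 p hp l)

theorem IsSchwartz.zero : IsSchwartz 𝕜 (0 : EuclideanSpace ℝ (Fin d) → E) := by
  refine ⟨fun k => IsCk.zero k, fun p hp l => ⟨0, ?_⟩⟩
  rintro _ ⟨j, rfl⟩
  have h : p (iterPartialDeriv 𝕜 j.2.1 (0 : EuclideanSpace ℝ (Fin d) → E) j.1) = 0 := by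
    rw [iterPartialDeriv_zero_fun, Pi.zero_apply, map_zero]
  simp only [h, zero_mul, le_refl]

/-- `S(ℝ^d, E)` as a linear subspace of the space of all functions. -/
def schwartzSubmodule : Submodule 𝕜 (EuclideanSpace ℝ (Fin d) → E) where
  carrier := {f | IsSchwartz 𝕜 f}
  add_mem' hf hg := IsSchwartz.add hf hg
  zero_mem' := IsSchwartz.zero 𝕜 d E
  smul_mem' c _ hf := IsSchwartz.const_smul c hf

/-- The Schwartz space `S(ℝ^d, E)`. (A type of its own, so that it does not carry the topology of
pointwise convergence.) -/
def SchwartzFun : Type _ := ↥(schwartzSubmodule 𝕜 d E)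

instance : AddCommGroup (SchwartzFun 𝕜 d E) := inferInstanceAs (AddCommGroup (schwartzSubmodule 𝕜 d E))

instance : Module 𝕜 (SchwartzFun 𝕜 d E) := inferInstanceAs (Module 𝕜 (schwartzSubmodule 𝕜 d E))

instance : FunLike (SchwartzFun 𝕜 d E) (EuclideanSpace ℝ (Fin d)) E where
  coe f := f.1
  coe_injective _ _ h := Subtype.ext h

variable {𝕜 d E} in
theorem SchwartzFun.isCinf (f : SchwartzFun 𝕜 d E) : IsCinf 𝕜 f := f.2.1

variable {𝕜 d E} in
theorem SchwartzFun.bddAbove (f : SchwartzFun 𝕜 d E) (p : Seminorm 𝕜 E) (hp : Continuous p)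
    (l : ℕ) : BddAbove (Set.range fun j : SchwartzIndex d l =>
      p (iterPartialDeriv 𝕜 j.2 f j.1) * schwartzWeight l j.1) := f.2.2 p hp l

/-- The linear map `f ↦ ∂^β f (x)` on `S(ℝ^d, E)`. -/
def SchwartzFun.iterDerivAt (β : Fin d → ℕ) (x : EuclideanSpace ℝ (Fin d)) :
    SchwartzFun 𝕜 d E →ₗ[𝕜] E where
  toFun f := iterPartialDeriv 𝕜 β f x
  map_add' f g := congrFun (iterPartialDeriv_add f.isCinf g.isCinf β) x
  map_smul' c f := congrFun (iterPartialDeriv_smul c f.isCinf β) x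

/-- The seminorms `|f|_{l,p} = sup_{x, |β| ≤ l} p (∂^β f x) (1 + |x|²)^{l/2}`. -/
def schwartzSeminorms : SeminormFamily 𝕜 (SchwartzFun 𝕜 d E)
    (ℕ × {p : Seminorm 𝕜 E // Continuous p}) := fun a =>
  supSeminorm (J := SchwartzIndex d a.1) a.2.1
    (fun j => SchwartzFun.iterDerivAt 𝕜 d E j.2 j.1) (fun j => schwartzWeight a.1 j.1)
    (fun j => schwartzWeight_nonneg a.1 j.1) (fun f => f.bddAbove a.2.1 a.2.2 a.1)

instance : Nonempty (ℕ × {p : Seminorm 𝕜 E // Continuous p}) :=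
  ⟨(0, ⟨0, continuous_zero⟩)⟩

/-- The topology of `S(ℝ^d, E)` is generated by the seminorms `|·|_{l,p}`. -/
instance : TopologicalSpace (SchwartzFun 𝕜 d E) :=
  (schwartzSeminorms 𝕜 d E).moduleFilterBasis.topology

theorem schwartzFun_withSeminorms : WithSeminorms (schwartzSeminorms 𝕜 d E) := ⟨rfl⟩

instance : IsTopologicalAddGroup (SchwartzFun 𝕜 d E) :=
  (schwartzFun_withSeminorms 𝕜 d E).topologicalAddGroup

instance : ContinuousSMul 𝕜 (SchwartzFun 𝕜 d E) :=
  (schwartzFun_withSeminorms 𝕜 d E).continuousSMul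

end Schwartz

/-! ### The space `s(ℕ_0^d, E)` of rapidly decreasing sequences -/

section RapidSeq

variable (𝕜 : Type*) [RCLike 𝕜] (d : ℕ) (E : Type*) [AddCommGroup E] [Module 𝕜 E]
  [TopologicalSpace E]

variable {d} in
/-- The square `|n|² = ∑ n_i²` of the Euclidean norm of `n ∈ ℕ_0^d`. -/
def idxNormSq (n : Fin d → ℕ) : ℕ := ∑ i, n i ^ 2

variable {d} in
/-- The weight `(1 + |n|²)^{j/2}`. -/
def seqWeight (j : ℕ) (n : Fin d → ℕ) : ℝ := (1 + (idxNormSq n : ℝ)) ^ ((j : ℝ) / 2)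

variable {d} in
theorem seqWeight_nonneg (j : ℕ) (n : Fin d → ℕ) : 0 ≤ seqWeight j n := by
  unfold seqWeight; positivity

/-- The families `x : ℕ_0^d → E` with `sup_n p (x_n) (1 + |n|²)^{j/2} < ∞` for all `j` and all
continuous seminorms `p` on `E`. -/
def rapidSubmodule : Submodule 𝕜 ((Fin d → ℕ) → E) where
  carrier := {x | ∀ (p : Seminorm 𝕜 E), Continuous p → ∀ j : ℕ,
    BddAbove (Set.range fun n : Fin d → ℕ => p (x n) * seqWeight j n)}
  add_mem' hx hy p hp j := bddAbove_add p (seqWeight_nonneg j) (hx p hp j) (hy p hp j)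
  zero_mem' p _ j := ⟨0, by rintro _ ⟨n, rfl⟩; simp⟩
  smul_mem' c _ hx p hp j := bddAbove_smul p c (hx p hp j)

/-- The space `s(ℕ_0^d, E)`. (A type of its own, so that it does not carry the topology of
pointwise convergence.) -/
def RapidSeq : Type _ := ↥(rapidSubmodule 𝕜 d E)

instance : AddCommGroup (RapidSeq 𝕜 d E) := inferInstanceAs (AddCommGroup (rapidSubmodule 𝕜 d E))

instance : Module 𝕜 (RapidSeq 𝕜 d E) := inferInstanceAs (Module 𝕜 (rapidSubmodule 𝕜 d E))

instance : FunLike (RapidSeq 𝕜 d E) (Fin d → ℕ) E where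
  coe x := x.1
  coe_injective _ _ h := Subtype.ext h

variable {𝕜 d E} in
theorem RapidSeq.bddAbove (x : RapidSeq 𝕜 d E) (p : Seminorm 𝕜 E) (hp : Continuous p) (j : ℕ) :
    BddAbove (Set.range fun n : Fin d → ℕ => p (x n) * seqWeight j n) := x.2 p hp j

/-- The linear map `x ↦ x_n` on `s(ℕ_0^d, E)`. -/
def RapidSeq.coord (n : Fin d → ℕ) : RapidSeq 𝕜 d E →ₗ[𝕜] E where
  toFun x := x n
  map_add' _ _ := rfl
  map_smul' _ _ := rfl

/-- The seminorms `|x|_{j,p} = sup_n p (x_n) (1 + |n|²)^{j/2}`. -/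
def rapidSeminorms : SeminormFamily 𝕜 (RapidSeq 𝕜 d E)
    (ℕ × {p : Seminorm 𝕜 E // Continuous p}) := fun a =>
  supSeminorm a.2.1 (fun n => RapidSeq.coord 𝕜 d E n) (seqWeight a.1) (seqWeight_nonneg a.1)
    (fun x => x.bddAbove a.2.1 a.2.2 a.1)

/-- The topology of `s(ℕ_0^d, E)` is generated by the seminorms `|·|_{j,p}`. -/
instance : TopologicalSpace (RapidSeq 𝕜 d E) :=
  (rapidSeminorms 𝕜 d E).moduleFilterBasis.topology

theorem rapidSeq_withSeminorms : WithSeminorms (rapidSeminorms 𝕜 d E) := ⟨rfl⟩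

instance : IsTopologicalAddGroup (RapidSeq 𝕜 d E) :=
  (rapidSeq_withSeminorms 𝕜 d E).topologicalAddGroup

instance : ContinuousSMul 𝕜 (RapidSeq 𝕜 d E) :=
  (rapidSeq_withSeminorms 𝕜 d E).continuousSMul

end RapidSeq

/-! ### Point evaluations on the scalar-valued spaces -/

section Eval

variable (𝕜 : Type*) [RCLike 𝕜] {d : ℕ}

/-- The norm of the scalar field as a continuous seminorm. -/
def absSeminorm : {p : Seminorm 𝕜 𝕜 // Continuous p} := ⟨normSeminorm 𝕜 𝕜, continuous_norm⟩

theorem le_schwartzSeminorms (f : SchwartzFun 𝕜 d 𝕜) (x : EuclideanSpace ℝ (Fin d)) :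
    ‖f x‖ ≤ schwartzSeminorms 𝕜 d 𝕜 (0, absSeminorm 𝕜) f := by
  have h := le_ciSup (f.bddAbove (absSeminorm 𝕜).1 (absSeminorm 𝕜).2 0) (x, ⟨0, by simp⟩)
  have hw : schwartzWeight 0 x = 1 := by simp [schwartzWeight]
  refine le_trans (le_of_eq ?_) h
  change ‖f x‖ = ‖iterPartialDeriv 𝕜 (0 : Fin d → ℕ) f x‖ * schwartzWeight 0 x
  rw [hw, mul_one, iterPartialDeriv_zero]

theorem le_rapidSeminorms (f : RapidSeq 𝕜 d 𝕜) (n : Fin d → ℕ) :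
    ‖f n‖ ≤ rapidSeminorms 𝕜 d 𝕜 (0, absSeminorm 𝕜) f := by
  have h := le_ciSup (f.bddAbove (absSeminorm 𝕜).1 (absSeminorm 𝕜).2 0) n
  have hw : seqWeight 0 n = 1 := by simp [seqWeight]
  refine le_trans (le_of_eq ?_) h
  rw [hw, mul_one]
  rfl

/-- The point evaluation `δ_x ∈ S(ℝ^d)'`. -/
def schwartzDelta (x : EuclideanSpace ℝ (Fin d)) : SchwartzFun 𝕜 d 𝕜 →L[𝕜] 𝕜 where
  toFun f := f x
  map_add' _ _ := rfl
  map_smul' _ _ := rfl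
  cont := by
    let L : SchwartzFun 𝕜 d 𝕜 →ₗ[𝕜] 𝕜 := ⟨⟨fun f => f x, fun _ _ => rfl⟩, fun _ _ => rfl⟩
    exact (schwartzFun_withSeminorms 𝕜 d 𝕜).continuous_normedSpace_rng 𝕜 L
      ⟨{(0, absSeminorm 𝕜)}, 1, fun f => by
        simp only [Finset.sup_singleton, one_smul]
        exact le_schwartzSeminorms 𝕜 f x⟩

/-- The point evaluation `δ_n ∈ s(ℕ_0^d)'`. -/
def rapidDelta (n : Fin d → ℕ) : RapidSeq 𝕜 d 𝕜 →L[𝕜] 𝕜 where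
  toFun f := f n
  map_add' _ _ := rfl
  map_smul' _ _ := rfl
  cont := by
    let L : RapidSeq 𝕜 d 𝕜 →ₗ[𝕜] 𝕜 := ⟨⟨fun f => f n, fun _ _ => rfl⟩, fun _ _ => rfl⟩
    exact (rapidSeq_withSeminorms 𝕜 d 𝕜).continuous_normedSpace_rng 𝕜 L
      ⟨{(0, absSeminorm 𝕜)}, 1, fun f => by
        simp only [Finset.sup_singleton, one_smul]
        exact le_rapidSeminorms 𝕜 f n⟩

end Eval

/-! ### The ε-product -/

section EpsProduct

open scoped ComplexOrder

variable (𝕜 : Type*) [RCLike 𝕜]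
  (F : Type*) [AddCommGroup F] [Module 𝕜 F] [TopologicalSpace F]
  (F' : Type*) [AddCommGroup F'] [Module 𝕜 F'] [TopologicalSpace F']
  (E : Type*) [AddCommGroup E] [Module 𝕜 E] [TopologicalSpace E]
  [IsTopologicalAddGroup E] [ContinuousSMul 𝕜 E]
  (E' : Type*) [AddCommGroup E'] [Module 𝕜 E'] [TopologicalSpace E']
  [IsTopologicalAddGroup E'] [ContinuousSMul 𝕜 E']

/-- The absolutely convex compact subsets of `F`. -/
def absConvexCompacts : Set (Set F) := {K | IsCompact K ∧ AbsConvex 𝕜 K}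

/-- The dual of `F` with the topology of uniform convergence on the absolutely convex compact
subsets of `F`. -/
abbrev DualKappa : Type _ :=
  UniformConvergenceCLM (RingHom.id 𝕜) (E := F) 𝕜 (absConvexCompacts 𝕜 F)

/-- The equicontinuous subsets of the dual of `F`. -/
def equicontinuousSets : Set (Set (DualKappa 𝕜 F)) :=
  {B | Equicontinuous (fun (y : B) (x : F) => (y : DualKappa 𝕜 F) x)}

/-- The ε-product `F ε E`: the continuous linear maps from `DualKappa 𝕜 F` to `E`, with the
topology of uniform convergence on the equicontinuous subsets of the dual of `F`. -/
abbrev EpsProd : Type _ :=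
  UniformConvergenceCLM (RingHom.id 𝕜) (E := DualKappa 𝕜 F) E (equicontinuousSets 𝕜 F)

variable {𝕜 F F' E E'}

theorem mapsTo_absConvexCompacts (T : F →L[𝕜] F') :
    Set.MapsTo (T '' ·) (absConvexCompacts 𝕜 F) (absConvexCompacts 𝕜 F') := by
  rintro K ⟨hK, hb, hc⟩
  refine ⟨hK.image T.continuous, ?_, hc.linear_image T.toLinearMap⟩
  rintro a ha _ ⟨_, ⟨x, hx, rfl⟩, rfl⟩
  exact ⟨a • x, hb a ha ⟨x, hx, rfl⟩, map_smul T a x⟩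

/-- The transpose `T^t : y ↦ y ∘ T`. -/
def dualTranspose (T : F →L[𝕜] F') : DualKappa 𝕜 F' →L[𝕜] DualKappa 𝕜 F :=
  T.precompUniformConvergenceCLM 𝕜 _ _ (mapsTo_absConvexCompacts T)

theorem mapsTo_equicontinuousSets (T : F →L[𝕜] F') :
    Set.MapsTo (dualTranspose T '' ·) (equicontinuousSets 𝕜 F') (equicontinuousSets 𝕜 F) := by
  intro B hB x U hU
  filter_upwards [T.continuous.continuousAt.eventually (hB (T x) U hU)] with z hz
  rintro ⟨_, y, hy, rfl⟩
  exact hz ⟨y, hy⟩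

/-- The ε-product of operators, `(T₁ ε T₂)(u) = T₂ ∘ u ∘ T₁^t`. -/
def epsMap (T₁ : F →L[𝕜] F') (T₂ : E →L[𝕜] E') : EpsProd 𝕜 F E →L[𝕜] EpsProd 𝕜 F' E' :=
  (T₂.postcompUniformConvergenceCLM (equicontinuousSets 𝕜 F')).comp
    ((dualTranspose T₁).precompUniformConvergenceCLM E _ _ (mapsTo_equicontinuousSets T₁))

theorem epsMap_apply (T₁ : F →L[𝕜] F') (T₂ : E →L[𝕜] E') (u : EpsProd 𝕜 F E)
    (y : DualKappa 𝕜 F') : epsMap T₁ T₂ u y = T₂ (u (dualTranspose T₁ y)) := rfl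

/-- An element of the dual, regarded as an element of `DualKappa`. -/
def toDualKappa (y : F →L[𝕜] 𝕜) : DualKappa 𝕜 F :=
  ContinuousLinearMap.toUniformConvergenceCLM (RingHom.id 𝕜) 𝕜 (absConvexCompacts 𝕜 F) y

theorem dualTranspose_apply (T : F →L[𝕜] F') (y : DualKappa 𝕜 F') (x : F) :
    dualTranspose T y x = y (T x) := rfl

end EpsProduct

/-! ### Pettis integrals -/

section Pettis

variable (𝕜 : Type*) [RCLike 𝕜] {X : Type*} [MeasurableSpace X] {E : Type*} [AddCommGroup E]
  [Module 𝕜 E] [TopologicalSpace E]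

/-- `e` is the Pettis integral of `f`: every `e' ∘ f`, `e' ∈ E'`, is integrable, and its integral
is `e' e`. -/
def HasPettisIntegral (μ : Measure X) (f : X → E) (e : E) : Prop :=
  ∀ e' : E →L[𝕜] 𝕜, Integrable (fun x => e' (f x)) μ ∧ e' e = ∫ x, e' (f x) ∂μ

/-- `f` is Pettis-integrable. -/
def PettisIntegrable (μ : Measure X) (f : X → E) : Prop := ∃ e, HasPettisIntegral 𝕜 μ f e

open Classical in
/-- The Pettis integral (with the value `0` if `f` is not Pettis-integrable). -/
def pettisIntegral (μ : Measure X) (f : X → E) : E :=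
  if h : PettisIntegrable 𝕜 μ f then h.choose else 0

end Pettis

/-! ### Hermite functions and Fourier coefficients -/

section Hermite

/-- The Hermite polynomials `H_0 = 1`, `H_{n+1} = 2 x H_n - H_n'`. -/
def hermitePoly : ℕ → Polynomial ℝ
  | 0 => 1
  | n + 1 => 2 * Polynomial.X * hermitePoly n - Polynomial.derivative (hermitePoly n)

/-- The Hermite functions on `ℝ`. -/
def hermiteFun1 (n : ℕ) (x : ℝ) : ℝ :=
  (2 ^ n * (n.factorial : ℝ) * √Real.pi) ^ (-(1 / 2) : ℝ) * (hermitePoly n).eval x *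
    Real.exp (-x ^ 2 / 2)

/-- The Hermite functions on `ℝ^d`. -/
def hermiteFun {d : ℕ} (n : Fin d → ℕ) (x : EuclideanSpace ℝ (Fin d)) : ℝ :=
  ∏ k, hermiteFun1 (n k) (x k)

variable {𝕜 : Type*} [RCLike 𝕜] {d : ℕ} {E : Type*} [AddCommGroup E] [Module 𝕜 E]
  [TopologicalSpace E] [IsTopologicalAddGroup E] [ContinuousSMul 𝕜 E] [T2Space E]

/-- The `n`-th Fourier coefficient of `f ∈ S(ℝ^d, E)`, the Pettis integral of `f h_n` over
`ℝ^d`. -/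
def hermiteCoeff (f : SchwartzFun 𝕜 d E) (n : Fin d → ℕ) : E :=
  pettisIntegral 𝕜 volume (fun x => (hermiteFun n x : 𝕜) • f x)

/-- The multi-indices `n ∈ ℕ_0^d` with `|n| ≤ k` (Euclidean norm). -/
def idxBall (d k : ℕ) : Finset (Fin d → ℕ) :=
  (Fintype.piFinset fun _ => Finset.range (k + 1)).filter fun n => idxNormSq n ≤ k ^ 2

theorem mem_idxBall {d k : ℕ} {n : Fin d → ℕ} :
    n ∈ idxBall d k ↔ √(∑ i, (n i : ℝ) ^ 2) ≤ (k : ℝ) := by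
  have h1 : √(∑ i, (n i : ℝ) ^ 2) ≤ (k : ℝ) ↔ idxNormSq n ≤ k ^ 2 := by
    rw [Real.sqrt_le_left (by positivity), idxNormSq]
    norm_cast
  rw [h1, idxBall, Finset.mem_filter, and_iff_right_iff_imp]
  intro h
  rw [Fintype.mem_piFinset]
  intro i
  have h2 : n i ^ 2 ≤ k ^ 2 :=
    (Finset.single_le_sum (f := fun i => n i ^ 2) (fun _ _ => Nat.zero_le _)
      (Finset.mem_univ i)).trans h
  exact Finset.mem_range.2 (Nat.lt_succ_of_le ((Nat.pow_le_pow_iff_left two_ne_zero).1 h2))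

end Hermite

/-! ### Schauder decompositions -/

/-- A sequence of continuous projections `P_k` on `V` with `P_k P_j = P_{min(j,k)}`, `P_k ≠ P_j`
for `k ≠ j`, and `P_k f → f` for all `f`. -/
structure IsSchauderDecomposition {𝕜 V : Type*} [RCLike 𝕜] [AddCommGroup V] [Module 𝕜 V]
    [TopologicalSpace V] (P : ℕ → V →L[𝕜] V) : Prop where
  proj : ∀ k, (P k).comp (P k) = P k
  comp : ∀ k j, (P k).comp (P j) = P (min j k)
  ne : ∀ k j, k ≠ j → P k ≠ P j
  tendsto : ∀ f, Tendsto (fun k => P k f) atTop (𝓝 f)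

end

/-! The Hermite expansion identifies S(ℝ^d, E) with s(ℕ_0^d, E). On the sequence side the ε-product
and the Schauder decomposition are elementary, and both are carried back along this identification.

The engine is the pair of ladder relations `mul_hermiteFun1` and `hasDerivAt_hermiteFun1`:
multiplication by x_i and differentiation along e_i act on the h_n as index shifts with weights of
size √n_i. They give orthonormality (`integral_hermiteFun_mul`) and a bound on h_n that is uniform
in x and polynomial in n (`abs_hermiteFun_le`).

Synthesis, x ↦ ∑ h_n x_n, maps s into S. The shifts `RapidSeq.lower` and `RapidSeq.raise` are
continuous on s, so derivatives and polynomial weights can be moved onto the coefficients, and each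
Schwartz seminorm reduces to an unweighted supremum estimate (`exists_seminorm_hermiteSeries_le`).

Analysis, f ↦ (∫ f h_n), maps S into s. The Pettis integral is a limit of integrals of simple
approximations, which form a Cauchy sequence because f is Lipschitz for every seminorm; sequential
completeness is therefore enough (`pettisIntegrable_hermiteFun_smul`). Decay in n comes from the
oscillator identity: the n-th coefficient of (x_i - ∂_i)(x_i + ∂_i)f is 2 n_i times that of f
(`DirectionalBounds.two_mul_smul_eq`, `norm_monomialCoeff_le`). Scalar estimates, uniform over the
functionals dominated by a seminorm p, become estimates for p by Hahn–Banach
(`seminorm_le_of_dual_le`).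

Analysis after synthesis is the identity by orthonormality (`hasPettisIntegral_hermiteSeries`).
Synthesis after analysis is the identity because a rapidly decaying function orthogonal to all h_n
vanishes: its product with the Gaussian h_0 has zero Fourier transform
(`eq_zero_of_hermite_coeff_eq_zero`).

For s the inverse of u ↦ (u(δ_n)) is x ↦ (y ↦ ∑ y(e_n) x_n). This operator is continuous on the dual
with the κ-topology because the boxes {z : |z_n| ≤ p(x_n)} are compact (`RapidSeq.isCompact_box`),
and it recovers u because y = ∑ y(e_n) δ_n uniformly on compact sets (`RapidSeq.hasSum_epsProd`).
The isomorphism for S is defined by transport, so the formula relating the two coefficient maps is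
built in and only its values u(δ_x) have to be computed. The projections P_k are transported
truncations of families, and unconditional convergence is that of x = ∑ x_n e_n in s. -/

noncomputable section

/-! ### Locally convex spaces -/

section LocallyConvex

variable {𝕜 : Type*} [RCLike 𝕜] {E : Type*} [AddCommGroup E] [Module 𝕜 E]

/-- Norming functionals for a continuous seminorm. -/
theorem exists_dual_apply_eq_seminorm [TopologicalSpace E] [PolynormableSpace 𝕜 E]
    {p : Seminorm 𝕜 E} (hp : Continuous p) (x : E) :
    ∃ φ : E →L[𝕜] 𝕜, φ x = ((p x : ℝ) : 𝕜) ∧ ∀ y, ‖φ y‖ ≤ p y := by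
  by_cases hx : x = 0
  · exact ⟨0, by simp [hx], fun y => by simp⟩
  let f : Module.Dual 𝕜 (Submodule.span 𝕜 {x}) :=
    ((p x : ℝ) : 𝕜) • (LinearEquiv.coord 𝕜 E x hx : Submodule.span 𝕜 {x} →ₗ[𝕜] 𝕜)
  have hf : ∀ (c : 𝕜) (hc : c • x ∈ Submodule.span 𝕜 {x}), f ⟨c • x, hc⟩ = (p x : ℝ) * c := by
    intro c hc
    have h := LinearEquiv.coord_apply_smul 𝕜 E x hx ⟨c • x, hc⟩
    have h2 : LinearEquiv.coord 𝕜 E x hx ⟨c • x, hc⟩ = c :=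
      smul_left_injective 𝕜 hx h
    simp [f, h2, RCLike.real_smul_eq_coe_mul]
  obtain ⟨g, hg, hle⟩ := Module.Dual.exists_continuous_extension_of_le_seminorm
    (Submodule.span 𝕜 {x}) f hp (by
      rintro ⟨y, hy⟩
      obtain ⟨c, rfl⟩ := Submodule.mem_span_singleton.1 hy
      rw [hf, map_smul_eq_mul, norm_mul, RCLike.norm_ofReal, abs_of_nonneg (apply_nonneg p x),
        mul_comm])
  refine ⟨g, ?_, hle⟩
  have h1 := hg ⟨x, Submodule.mem_span_singleton_self x⟩
  have h2 := hf 1 (by simp)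
  simp only [one_smul, mul_one] at h2
  rw [h2] at h1
  exact h1

/-- By Hahn–Banach a continuous seminorm is the supremum of the functionals it dominates. This is
the route from scalar integral estimates to estimates in E. -/
theorem seminorm_le_of_dual_le [TopologicalSpace E] [PolynormableSpace 𝕜 E]
    {p : Seminorm 𝕜 E} (hp : Continuous p) (x : E) {C : ℝ}
    (h : ∀ φ : E →L[𝕜] 𝕜, (∀ y, ‖φ y‖ ≤ p y) → ‖φ x‖ ≤ C) : p x ≤ C := by
  obtain ⟨φ, h1, h2⟩ := exists_dual_apply_eq_seminorm hp x
  have h3 := h φ h2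
  rwa [h1, RCLike.norm_ofReal, abs_of_nonneg (apply_nonneg p x)] at h3

theorem eq_of_forall_seminorm_sub_eq_zero [TopologicalSpace E] [PolynormableSpace 𝕜 E]
    [T2Space E] {x y : E} (h : ∀ p : Seminorm 𝕜 E, Continuous p → p (x - y) = 0) : x = y := by
  by_contra hxy
  obtain ⟨p, hp⟩ := (PolynormableSpace.withSeminorms 𝕜 E).separating_of_T1 (x - y)
    (sub_ne_zero.2 hxy)
  exact hp (h p.1 p.2)

theorem eq_of_forall_dual_eq [TopologicalSpace E] [PolynormableSpace 𝕜 E] [T2Space E] {x y : E}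
    (h : ∀ φ : E →L[𝕜] 𝕜, φ x = φ y) : x = y :=
  eq_of_forall_seminorm_sub_eq_zero (𝕜 := 𝕜) fun p hp => le_antisymm
    (seminorm_le_of_dual_le hp _ fun φ _ => by rw [map_sub, h, sub_self, norm_zero])
    (apply_nonneg p _)

theorem tendsto_iff_seminorm [TopologicalSpace E] [PolynormableSpace 𝕜 E] {α : Type*}
    {l : Filter α} {u : α → E} {x : E} :
    Tendsto u l (𝓝 x) ↔
      ∀ p : Seminorm 𝕜 E, Continuous p → Tendsto (fun a => p (u a - x)) l (𝓝 0) := by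
  rw [(PolynormableSpace.withSeminorms 𝕜 E).tendsto_nhds]
  constructor
  · intro h p hp
    rw [Metric.tendsto_nhds]
    intro ε hε
    filter_upwards [h ⟨p, hp⟩ ε hε] with a ha
    rwa [Real.dist_eq, sub_zero, abs_of_nonneg (apply_nonneg p _)]
  · rintro h ⟨p, hp⟩ ε hε
    exact (h p hp).eventually_lt_const hε

/-- The bound ε m + ε n suits sequences compared with a limit not yet known to exist in E: tails of
series here, scalar integrals for the Pettis integral. -/
theorem cauchySeq_of_seminorm_le [UniformSpace E] [IsUniformAddGroup E] [PolynormableSpace 𝕜 E]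
    {u : ℕ → E}
    (h : ∀ p : Seminorm 𝕜 E, Continuous p →
      ∃ ε : ℕ → ℝ, Tendsto ε atTop (𝓝 0) ∧ ∀ m n, p (u m - u n) ≤ ε m + ε n) :
    CauchySeq u := by
  rw [cauchySeq_iff_tendsto, uniformity_eq_comap_nhds_zero E, tendsto_comap_iff,
    tendsto_iff_seminorm (𝕜 := 𝕜)]
  intro p hp
  obtain ⟨ε, hε, hle⟩ := h p hp
  have h2 : Tendsto (fun a : ℕ × ℕ => ε a.1 + ε a.2) atTop (𝓝 0) := by
    rw [← prod_atTop_atTop_eq]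
    simpa using (hε.comp tendsto_fst).add (hε.comp tendsto_snd)
  refine squeeze_zero (fun _ => apply_nonneg p _) (fun a => ?_) h2
  simp only [Function.comp_apply, Prod.map, sub_zero]
  rw [map_sub_rev]
  linarith [hle a.1 a.2]

theorem seminorm_sum_le_sum (p : Seminorm 𝕜 E) {ι : Type*} (s : Finset ι) (x : ι → E) :
    p (∑ i ∈ s, x i) ≤ ∑ i ∈ s, p (x i) :=
  Finset.le_sum_of_subadditive p (map_zero p).le (fun a b => map_add_le_add p a b) s x

/-- Only sequences are known to converge, while summability concerns the net of finite subsets.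
Countability supplies a cofinal sequence of finite sets; the limit along it is then shown to be the
limit of the whole net. -/
theorem summable_of_seminorm [UniformSpace E] [IsUniformAddGroup E] [PolynormableSpace 𝕜 E]
    (hE : ∀ u : ℕ → E, CauchySeq u → ∃ x, Tendsto u atTop (𝓝 x)) {ι : Type*} [Countable ι]
    {x : ι → E} (h : ∀ p : Seminorm 𝕜 E, Continuous p → Summable fun i => p (x i)) :
    Summable x := by
  obtain ⟨s, hs⟩ := exists_seq_tendsto (atTop : Filter (Finset ι))
  have key : ∀ (p : Seminorm 𝕜 E) (A B : Finset ι) [DecidableEq ι],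
      p (∑ i ∈ A, x i - ∑ i ∈ B, x i) ≤ (∑' i, p (x i) - ∑ i ∈ A, p (x i)) +
        (∑' i, p (x i) - ∑ i ∈ B, p (x i)) ∨ ¬ Continuous p := by
    intro p A B _
    by_cases hp : Continuous p
    swap
    · exact Or.inr hp
    left
    have hsum := h p hp
    -- The common part cancels, and what remains of each set lies outside the other, hence in the
    -- tail of the other.
    have e1 : ∑ i ∈ A, x i - ∑ i ∈ B, x i = ∑ i ∈ A \ B, x i - ∑ i ∈ B \ A, x i :=
      (Finset.sum_sdiff_sub_sum_sdiff).symm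
    have e2 : p (∑ i ∈ A \ B, x i - ∑ i ∈ B \ A, x i) ≤
        ∑ i ∈ A \ B, p (x i) + ∑ i ∈ B \ A, p (x i) :=
      (map_sub_le_add p _ _).trans
        (add_le_add (seminorm_sum_le_sum p _ _) (seminorm_sum_le_sum p _ _))
    have e3 : ∀ A B : Finset ι, ∑ i ∈ A \ B, p (x i) + ∑ i ∈ B, p (x i) ≤ ∑' i, p (x i) := by
      intro A B
      rw [← Finset.sum_union Finset.sdiff_disjoint]
      exact hsum.sum_le_tsum _ fun _ _ => apply_nonneg p _
    have := e3 A B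
    have := e3 B A
    rw [e1]
    linarith
  classical
  have htail : ∀ p : Seminorm 𝕜 E, Continuous p →
      Tendsto (fun A : Finset ι => ∑' i, p (x i) - ∑ i ∈ A, p (x i)) atTop (𝓝 0) := by
    intro p hp
    have h1 := (tendsto_const_nhds (x := ∑' i, p (x i))).sub (h p hp).hasSum
    rwa [sub_self] at h1
  obtain ⟨e, he⟩ := hE (fun k => ∑ i ∈ s k, x i) (cauchySeq_of_seminorm_le (𝕜 := 𝕜) fun p hp =>
    ⟨fun k => ∑' i, p (x i) - ∑ i ∈ s k, p (x i), (htail p hp).comp hs,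
      fun m n => (key p (s m) (s n)).resolve_right (not_not.2 hp)⟩)
  refine ⟨e, ?_⟩
  rw [HasSum, SummationFilter.unconditional_filter, tendsto_iff_seminorm (𝕜 := 𝕜)]
  intro p hp
  refine squeeze_zero (fun _ => apply_nonneg p _) (fun A => ?_) (htail p hp)
  have h1 : Tendsto (fun k => p (∑ i ∈ A, x i - ∑ i ∈ s k, x i)) atTop
      (𝓝 (p (∑ i ∈ A, x i - e))) :=
    (hp.tendsto _).comp (tendsto_const_nhds.sub he)
  have h2 := (tendsto_const_nhds (x := ∑' i, p (x i) - ∑ i ∈ A, p (x i))).add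
    ((htail p hp).comp hs)
  rw [add_zero] at h2
  exact le_of_tendsto_of_tendsto' h1 h2 fun k =>
    (key p A (s k)).resolve_right (not_not.2 hp)

theorem HasSum.seminorm_le [TopologicalSpace E] {p : Seminorm 𝕜 E} (hp : Continuous p)
    {ι : Type*} {x : ι → E} {e : E} (hx : HasSum x e) (h : Summable fun i => p (x i)) :
    p e ≤ ∑' i, p (x i) :=
  le_of_tendsto_of_tendsto' ((hp.tendsto _).comp hx) h.hasSum fun A => seminorm_sum_le_sum p A x

/-- Dominated convergence for series `∑ g_i x_i`. -/
theorem tendsto_tsum_smul [UniformSpace E] [IsUniformAddGroup E] [ContinuousSMul 𝕜 E]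
    [PolynormableSpace 𝕜 E] [T2Space E]
    (hE : ∀ u : ℕ → E, CauchySeq u → ∃ x, Tendsto u atTop (𝓝 x)) {ι : Type*} [Countable ι]
    {x : ι → E} {b : ι → ℝ}
    (h : ∀ p : Seminorm 𝕜 E, Continuous p → Summable fun i => b i * p (x i)) {α : Type*}
    {l : Filter α} {g : α → ι → 𝕜} {c : ι → 𝕜} (hg : ∀ i, Tendsto (fun a => g a i) l (𝓝 (c i)))
    (hgb : ∀ a i, ‖g a i‖ ≤ b i) (hcb : ∀ i, ‖c i‖ ≤ b i) :
    Tendsto (fun a => ∑' i, g a i • x i) l (𝓝 (∑' i, c i • x i)) := by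
  have hs : ∀ c : ι → 𝕜, (∀ i, ‖c i‖ ≤ b i) → ∀ p : Seminorm 𝕜 E, Continuous p →
      Summable fun i => p (c i • x i) := fun c hc p hp =>
    (h p hp).of_nonneg_of_le (fun _ => apply_nonneg p _) fun i => by
      rw [map_smul_eq_mul]; exact mul_le_mul_of_nonneg_right (hc i) (apply_nonneg p _)
  rw [tendsto_iff_seminorm (𝕜 := 𝕜)]
  intro p hp
  have hbd : ∀ a i, p ((g a i - c i) • x i) ≤ 2 * (b i * p (x i)) := by
    intro a i
    rw [map_smul_eq_mul, ← mul_assoc]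
    refine mul_le_mul_of_nonneg_right ((norm_sub_le _ _).trans ?_) (apply_nonneg p _)
    linarith [hgb a i, hcb i]
  have hd : Tendsto (fun a => ∑' i, p ((g a i - c i) • x i)) l (𝓝 (∑' _ : ι, (0 : ℝ))) := by
    refine tendsto_tsum_of_dominated_convergence ((h p hp).mul_left 2) (fun i => ?_)
      (Eventually.of_forall fun a i => ?_)
    · simp only [map_smul_eq_mul]
      simpa using ((hg i).sub_const (c i)).norm.mul_const (p (x i))
    · rw [Real.norm_eq_abs, abs_of_nonneg (apply_nonneg p _)]
      exact hbd a i
  rw [tsum_zero] at hd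
  refine squeeze_zero (fun _ => apply_nonneg p _) (fun a => ?_) hd
  have e1 : HasSum (fun i => (g a i - c i) • x i) (∑' i, g a i • x i - ∑' i, c i • x i) := by
    simp only [sub_smul]
    exact (summable_of_seminorm hE (hs _ (hgb a))).hasSum.sub
      (summable_of_seminorm hE (hs _ hcb)).hasSum
  exact e1.seminorm_le hp (((h p hp).mul_left 2).of_nonneg_of_le (fun _ => apply_nonneg p _)
    (hbd a))

end LocallyConvex

/-! ### Weights -/

section Weights

variable {d : ℕ}

theorem rpow_half_eq_sqrt_pow {a : ℝ} (ha : 0 ≤ a) (j : ℕ) : a ^ ((j : ℝ) / 2) = √a ^ j := by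
  rw [Real.sqrt_eq_rpow, ← Real.rpow_mul_natCast ha]
  congr 1
  ring

theorem seqWeight_eq (j : ℕ) (n : Fin d → ℕ) :
    seqWeight j n = √(1 + (idxNormSq n : ℝ)) ^ j :=
  rpow_half_eq_sqrt_pow (by positivity) j

theorem schwartzWeight_eq (j : ℕ) (x : EuclideanSpace ℝ (Fin d)) :
    schwartzWeight j x = √(1 + ‖x‖ ^ 2) ^ j :=
  rpow_half_eq_sqrt_pow (by positivity) j

theorem seqWeight_add (j k : ℕ) (n : Fin d → ℕ) :
    seqWeight (j + k) n = seqWeight j n * seqWeight k n := by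
  simp only [seqWeight_eq, pow_add]

theorem seqWeight_pow (j k : ℕ) (n : Fin d → ℕ) : seqWeight j n ^ k = seqWeight (j * k) n := by
  simp only [seqWeight_eq, pow_mul]

theorem seqWeight_two (n : Fin d → ℕ) : seqWeight 2 n = 1 + (idxNormSq n : ℝ) := by
  rw [seqWeight_eq, Real.sq_sqrt (by positivity)]

theorem one_le_seqWeight (j : ℕ) (n : Fin d → ℕ) : 1 ≤ seqWeight j n := by
  rw [seqWeight_eq]
  refine one_le_pow₀ (Real.one_le_sqrt.2 ?_)
  linarith [(idxNormSq n).cast_nonneg (α := ℝ)]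

theorem seqWeight_pos (j : ℕ) (n : Fin d → ℕ) : 0 < seqWeight j n :=
  one_pos.trans_le (one_le_seqWeight j n)

theorem seqWeight_mono {j k : ℕ} (h : j ≤ k) (n : Fin d → ℕ) : seqWeight j n ≤ seqWeight k n := by
  obtain ⟨m, rfl⟩ := Nat.exists_eq_add_of_le h
  rw [seqWeight_add]
  exact le_mul_of_one_le_right (seqWeight_nonneg j n) (one_le_seqWeight m n)

theorem sq_le_idxNormSq (n : Fin d → ℕ) (i : Fin d) : n i ^ 2 ≤ idxNormSq n :=
  Finset.single_le_sum (f := fun i => n i ^ 2) (fun _ _ => Nat.zero_le _) (Finset.mem_univ i)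

theorem one_add_sq_le_seqWeight_two (n : Fin d → ℕ) (i : Fin d) :
    1 + (n i : ℝ) ^ 2 ≤ seqWeight 2 n := by
  rw [seqWeight_two]
  have := sq_le_idxNormSq n i
  have h : ((n i ^ 2 : ℕ) : ℝ) ≤ idxNormSq n := by exact_mod_cast this
  push_cast at h
  linarith

theorem idxNormSq_add_single (n : Fin d → ℕ) (i : Fin d) :
    idxNormSq (n + Pi.single i 1) = idxNormSq n + (2 * n i + 1) := by
  unfold idxNormSq
  rw [← Finset.add_sum_erase _ _ (Finset.mem_univ i),
    ← Finset.add_sum_erase _ (fun i => n i ^ 2) (Finset.mem_univ i)]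
  have : ∑ x ∈ Finset.univ.erase i, (n + Pi.single i 1 : Fin d → ℕ) x ^ 2 =
      ∑ x ∈ Finset.univ.erase i, n x ^ 2 := by
    refine Finset.sum_congr rfl fun x hx => ?_
    simp [Finset.ne_of_mem_erase hx]
  rw [this]
  simp
  ring

theorem seqWeight_le_add_single (j : ℕ) (n : Fin d → ℕ) (i : Fin d) :
    seqWeight j n ≤ seqWeight j (n + Pi.single i 1) := by
  simp only [seqWeight_eq, idxNormSq_add_single]
  gcongr
  omega

theorem seqWeight_add_single_le (j : ℕ) (n : Fin d → ℕ) (i : Fin d) :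
    seqWeight j (n + Pi.single i 1) ≤ 2 ^ j * seqWeight j n := by
  simp only [seqWeight_eq, idxNormSq_add_single, ← mul_pow]
  gcongr
  rw [show (2 : ℝ) = √4 by rw [show (4 : ℝ) = 2 ^ 2 by norm_num]; simp,
    ← Real.sqrt_mul (by norm_num)]
  refine Real.sqrt_le_sqrt ?_
  have h := one_add_sq_le_seqWeight_two n i
  rw [seqWeight_two] at h
  push_cast
  nlinarith [sq_nonneg ((n i : ℝ) - 1)]

theorem sqrt_le_seqWeight_one (n : Fin d → ℕ) (i : Fin d) :
    √(((n i : ℝ) + 1) / 2) ≤ seqWeight 1 n := by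
  have h := one_add_sq_le_seqWeight_two n i
  rw [seqWeight_two] at h
  rw [seqWeight_eq, pow_one]
  refine Real.sqrt_le_sqrt ?_
  nlinarith [sq_nonneg ((n i : ℝ) - 1)]

theorem prod_one_add_sq_le_seqWeight (n : Fin d → ℕ) :
    ∏ i, (1 + (n i : ℝ) ^ 2) ≤ seqWeight (2 * d) n := by
  rw [← seqWeight_pow]
  calc ∏ i, (1 + (n i : ℝ) ^ 2) ≤ ∏ _i : Fin d, seqWeight 2 n :=
        Finset.prod_le_prod (fun i _ => by positivity)
          (fun i _ => one_add_sq_le_seqWeight_two n i)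
    _ = seqWeight 2 n ^ d := by simp

/-- Every finite set of multi-indices lies in a cube, over which the sum factorises into d partial
sums. -/
theorem summable_pi_prod {f : ℕ → ℝ} (hf : Summable f) (h0 : ∀ m, 0 ≤ f m) :
    Summable fun n : Fin d → ℕ => ∏ i, f (n i) := by
  refine summable_of_sum_le (c := (∑' m, f m) ^ d)
    (fun n => Finset.prod_nonneg fun i _ => h0 _) fun s => ?_
  let N := s.sup fun n => Finset.univ.sup n
  have hs : s ⊆ Fintype.piFinset fun _ : Fin d => Finset.range (N + 1) := by
    intro n hn
    rw [Fintype.mem_piFinset]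
    intro i
    have h1 : n i ≤ Finset.univ.sup n := Finset.le_sup (Finset.mem_univ i)
    have h2 : Finset.univ.sup n ≤ N := Finset.le_sup (f := fun n => Finset.univ.sup n) hn
    exact Finset.mem_range.2 (by omega)
  calc ∑ n ∈ s, ∏ i, f (n i)
      ≤ ∑ n ∈ Fintype.piFinset fun _ : Fin d => Finset.range (N + 1), ∏ i, f (n i) :=
        Finset.sum_le_sum_of_subset_of_nonneg hs
          fun n _ _ => Finset.prod_nonneg fun i _ => h0 _
    _ = ∏ _i : Fin d, ∑ m ∈ Finset.range (N + 1), f m :=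
        (Finset.prod_univ_sum (fun _ : Fin d => Finset.range (N + 1)) fun _ m => f m).symm
    _ ≤ ∏ _i : Fin d, ∑' m, f m :=
        Finset.prod_le_prod (fun i _ => Finset.sum_nonneg fun m _ => h0 m)
          fun i _ => hf.sum_le_tsum _ fun m _ => h0 m
    _ = (∑' m, f m) ^ d := by simp

/-- Since ∏ (1 + n_i²) ≤ (1 + |n|²)^d, the exponent 2d permits comparison with a product of d
convergent series. This is the price, in powers of the weight, of passing from suprema to sums. -/
theorem summable_inv_seqWeight (d : ℕ) :
    Summable fun n : Fin d → ℕ => (seqWeight (2 * d) n)⁻¹ := by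
  have h1 : Summable fun m : ℕ => (1 + (m : ℝ) ^ 2)⁻¹ := by
    refine (summable_nat_add_iff 1).1 ?_
    refine ((summable_nat_add_iff 1).2
      (Real.summable_nat_pow_inv.2 (one_lt_two))).of_nonneg_of_le
      (fun _ => by positivity) fun m => ?_
    gcongr
    linarith
  refine (summable_pi_prod h1 fun _ => by positivity).of_nonneg_of_le
    (fun n => inv_nonneg.2 (seqWeight_nonneg _ n)) fun n => ?_
  rw [Finset.prod_inv_distrib]
  exact inv_anti₀ (Finset.prod_pos fun i _ => by positivity) (prod_one_add_sq_le_seqWeight n)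

theorem tendsto_inv_seqWeight (d : ℕ) :
    Tendsto (fun n : Fin d → ℕ => (seqWeight (2 * d) n)⁻¹) cofinite (𝓝 0) :=
  (summable_inv_seqWeight d).tendsto_cofinite_zero

/-- With M the larger of 1 and max n_i², one has 1 + |n|² ≤ (d + 1) M, and M^r already occurs among
the terms on the right. Decay in each n_i separately thus yields decay in |n|. -/
theorem seqWeight_le_sum (r : ℕ) (n : Fin d → ℕ) :
    seqWeight (2 * r) n ≤ (d + 1) ^ r * (1 + ∑ i, (n i : ℝ) ^ (2 * r)) := by
  obtain ⟨M, hM, hle⟩ : ∃ M : ℝ, 1 + ∑ i, (n i : ℝ) ^ 2 ≤ (d + 1) * M ∧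
      M ^ r ≤ 1 + ∑ i, (n i : ℝ) ^ (2 * r) ∧ 0 ≤ M := by
    have hnn : ∀ k : ℕ, 0 ≤ ∑ i, (n i : ℝ) ^ k := fun k =>
      Finset.sum_nonneg fun i _ => by positivity
    by_cases h : ∃ i, ∀ k, n k ≤ n i ∧ 1 ≤ n i
    · obtain ⟨i, hi⟩ := h
      refine ⟨(n i : ℝ) ^ 2, ?_, ?_, by positivity⟩
      · have h1 : ∑ k, (n k : ℝ) ^ 2 ≤ ∑ _k : Fin d, (n i : ℝ) ^ 2 :=
          Finset.sum_le_sum fun k _ => by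
            have := (hi k).1
            gcongr
        have h2 : (1 : ℝ) ≤ n i := by exact_mod_cast (hi i).2
        simp only [Finset.sum_const, Finset.card_univ, Fintype.card_fin, nsmul_eq_mul] at h1
        nlinarith
      · rw [← pow_mul]
        have := Finset.single_le_sum (f := fun i => (n i : ℝ) ^ (2 * r))
          (fun _ _ => by positivity) (Finset.mem_univ i)
        linarith
    · have h0 : ∀ k, n k = 0 := by
        by_contra! hk
        obtain ⟨k, hk⟩ := hk
        obtain ⟨i, -, hi⟩ := Finset.exists_max_image Finset.univ n ⟨k, Finset.mem_univ k⟩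
        exact h ⟨i, fun l => ⟨hi l (Finset.mem_univ l),
          (Nat.one_le_iff_ne_zero.2 hk).trans (hi k (Finset.mem_univ k))⟩⟩
      refine ⟨1, by simp [h0], ?_, by norm_num⟩
      rw [one_pow]
      linarith [hnn (2 * r)]
  rw [← seqWeight_pow, seqWeight_two]
  have : (idxNormSq n : ℝ) = ∑ i, (n i : ℝ) ^ 2 := by simp [idxNormSq]
  rw [this]
  calc (1 + ∑ i, (n i : ℝ) ^ 2) ^ r ≤ ((d + 1) * M) ^ r := by
        gcongr
    _ = (d + 1) ^ r * M ^ r := mul_pow _ _ _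
    _ ≤ _ := mul_le_mul_of_nonneg_left hle.1 (by positivity)

end Weights

/-! ### Hermite functions on `ℝ` -/

section HermiteOne

open Polynomial

/-- The defining recursion only raises the degree. Differentiating it gives the lowering relation by
induction. -/
theorem derivative_hermitePoly_succ (m : ℕ) :
    derivative (hermitePoly (m + 1)) = C (2 * ((m : ℝ) + 1)) * hermitePoly m := by
  induction m with
  | zero => simp [hermitePoly, show (2 : ℝ[X]) = C 2 from rfl]
  | succ m ih =>
    rw [hermitePoly, derivative_sub, ih, derivative_C_mul, mul_assoc, derivative_mul,
      derivative_mul, derivative_X, ih, derivative_ofNat]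
    have h2 : (2 : ℝ[X]) = C 2 := rfl
    conv_rhs => rw [hermitePoly]
    simp only [h2, map_add, map_mul, Nat.cast_succ, map_one, map_natCast, zero_mul, zero_add, one_mul]
    conv_lhs => rw [hermitePoly]
    simp only [h2]
    ring_nf

def hermiteNorm (m : ℕ) : ℝ := (2 ^ m * (m.factorial : ℝ) * √Real.pi) ^ (-(1 / 2) : ℝ)

theorem hermiteNorm_eq (m : ℕ) : hermiteNorm m = (√(2 ^ m * (m.factorial : ℝ) * √Real.pi))⁻¹ := by
  rw [hermiteNorm, Real.rpow_neg (by positivity), Real.sqrt_eq_rpow (2 ^ m * _ * _)]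

theorem hermiteNorm_succ (m : ℕ) :
    hermiteNorm m = 2 * √(((m : ℝ) + 1) / 2) * hermiteNorm (m + 1) := by
  have h2 : (2 : ℝ) * √(((m : ℝ) + 1) / 2) = √(2 * (m + 1)) := by
    rw [show (2 : ℝ) * (m + 1) = 2 ^ 2 * ((m + 1) / 2) by ring, Real.sqrt_mul (by positivity),
      Real.sqrt_sq (by norm_num)]
  rw [hermiteNorm_eq, hermiteNorm_eq, h2,
    show (2 : ℝ) ^ (m + 1) * ((m + 1).factorial : ℝ) * √Real.pi =
      2 * (m + 1) * (2 ^ m * (m.factorial : ℝ) * √Real.pi) by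
      rw [Nat.factorial_succ]; push_cast; ring,
    Real.sqrt_mul (show (0 : ℝ) ≤ 2 * (m + 1) by positivity), mul_inv,
    ← mul_assoc, mul_inv_cancel₀ (by positivity), one_mul]

theorem hermiteFun1_eq (m : ℕ) (t : ℝ) :
    hermiteFun1 m t = hermiteNorm m * (hermitePoly m).eval t * Real.exp (-t ^ 2 / 2) := rfl

theorem hermiteNorm_mul_hermitePoly_succ (m : ℕ) (t : ℝ) :
    hermiteNorm m * (hermitePoly (m + 1)).eval t * Real.exp (-t ^ 2 / 2) =
      2 * √(((m : ℝ) + 1) / 2) * hermiteFun1 (m + 1) t := by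
  rw [hermiteFun1_eq, hermiteNorm_succ]
  ring

/-- For m = 0 the truncated index m - 1 = 0 does no harm, since its coefficient √(m/2) vanishes. All
later ladder formulas rely on this convention. -/
theorem hermiteNorm_mul_derivative (m : ℕ) (t : ℝ) :
    hermiteNorm m * (derivative (hermitePoly m)).eval t * Real.exp (-t ^ 2 / 2) =
      2 * √((m : ℝ) / 2) * hermiteFun1 (m - 1) t := by
  cases m with
  | zero => simp [hermitePoly]
  | succ m =>
    rw [derivative_hermitePoly_succ, eval_mul, eval_C, hermiteFun1_eq, Nat.add_sub_cancel,
      hermiteNorm_succ m]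
    have h := Real.mul_self_sqrt (show (0 : ℝ) ≤ ((m : ℝ) + 1) / 2 by positivity)
    push_cast
    linear_combination (-4 * hermiteNorm (m + 1) * eval t (hermitePoly m) *
      Real.exp (-t ^ 2 / 2)) * h

theorem mul_hermiteFun1 (m : ℕ) (t : ℝ) :
    t * hermiteFun1 m t = √((m : ℝ) / 2) * hermiteFun1 (m - 1) t +
      √(((m : ℝ) + 1) / 2) * hermiteFun1 (m + 1) t := by
  have h1 := hermiteNorm_mul_hermitePoly_succ m t
  have h2 := hermiteNorm_mul_derivative m t
  have h3 : (hermitePoly (m + 1)).eval t =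
      2 * t * (hermitePoly m).eval t - (derivative (hermitePoly m)).eval t := by
    rw [hermitePoly]; simp
  rw [h3] at h1
  have h4 := hermiteFun1_eq m t
  linear_combination t * h4 + h1 / 2 + h2 / 2

/-- The product rule gives 2√(m/2) h_{m-1} from the polynomial and -t h_m from the Gaussian; the
multiplication relation rewrites the latter. -/
theorem hasDerivAt_hermiteFun1 (m : ℕ) (t : ℝ) :
    HasDerivAt (hermiteFun1 m) (√((m : ℝ) / 2) * hermiteFun1 (m - 1) t -
      √(((m : ℝ) + 1) / 2) * hermiteFun1 (m + 1) t) t := by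
  have h1 : HasDerivAt (fun t : ℝ => Real.exp (-t ^ 2 / 2)) (Real.exp (-t ^ 2 / 2) * (-t)) t := by
    convert! (((hasDerivAt_pow 2 t).neg).div_const 2).exp using 1
    simp
    ring_nf
  have h2 := (((hermitePoly m).hasDerivAt t).const_mul (hermiteNorm m)).mul h1
  refine (h2.congr_deriv ?_)
  have h3 := hermiteNorm_mul_derivative m t
  have h4 := mul_hermiteFun1 m t
  have h5 := hermiteFun1_eq m t
  linear_combination h3 - h4 + t * h5

theorem continuous_hermiteFun1 (m : ℕ) : Continuous (hermiteFun1 m) :=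
  continuous_iff_continuousAt.2 fun t => (hasDerivAt_hermiteFun1 m t).continuousAt

theorem integrable_polynomial_mul_exp_neg_sq (p : ℝ[X]) :
    Integrable fun t : ℝ => p.eval t * Real.exp (-t ^ 2) := by
  induction p using Polynomial.induction_on' with
  | add p q hp hq =>
    refine (hp.add hq).congr (Eventually.of_forall fun t => ?_)
    simp only [Pi.add_apply, eval_add, add_mul]
  | monomial k a =>
    have h := (integrable_rpow_mul_exp_neg_mul_sq (b := 1) one_pos (s := k)
      (by linarith [k.cast_nonneg (α := ℝ)])).const_mul a
    simpa only [eval_monomial, Real.rpow_natCast, neg_mul, one_mul, mul_assoc] using h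

theorem integrable_hermiteFun1_mul (m k : ℕ) :
    Integrable fun t => hermiteFun1 m t * hermiteFun1 k t := by
  have h := (integrable_polynomial_mul_exp_neg_sq (hermitePoly m * hermitePoly k)).const_mul
    (hermiteNorm m * hermiteNorm k)
  refine h.congr (Eventually.of_forall fun t => ?_)
  simp only [hermiteFun1_eq, eval_mul]
  rw [show -t ^ 2 = -t ^ 2 / 2 + -t ^ 2 / 2 by ring, Real.exp_add]
  ring_nf

theorem integral_hermiteFun1_zero : ∫ t, hermiteFun1 0 t * hermiteFun1 0 t = 1 := by
  have h : ∀ t, hermiteFun1 0 t * hermiteFun1 0 t = (√Real.pi)⁻¹ * Real.exp (-1 * t ^ 2) := by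
    intro t
    simp only [hermiteFun1_eq, hermiteNorm_eq, hermitePoly]
    rw [show -1 * t ^ 2 = -t ^ 2 / 2 + -t ^ 2 / 2 by ring, Real.exp_add]
    have : (√√Real.pi)⁻¹ * (√√Real.pi)⁻¹ = (√Real.pi)⁻¹ := by
      rw [← mul_inv, Real.mul_self_sqrt (by positivity)]
    simp only [pow_zero, Nat.factorial_zero, Nat.cast_one, one_mul, eval_one, mul_one]
    linear_combination Real.exp (-t ^ 2 / 2) * Real.exp (-t ^ 2 / 2) * this
  simp_rw [h]
  rw [integral_const_mul, integral_gaussian, div_one, inv_mul_cancel₀ (by positivity)]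

theorem integral_hermiteFun1_comm (m k : ℕ) :
    ∫ t, hermiteFun1 m t * hermiteFun1 k t = ∫ t, hermiteFun1 k t * hermiteFun1 m t := by
  simp_rw [mul_comm]

/-- The operators t - d/dt and t + d/dt are adjoint in L²; the first sends h_m to 2√((m+1)/2)
h_{m+1}, the second sends h_k to 2√(k/2) h_{k-1}. Concretely, integration by parts is combined with
the symmetry of multiplication by t. -/
theorem integral_raise_hermiteFun1 (m k : ℕ) :
    √(((m : ℝ) + 1) / 2) * ∫ t, hermiteFun1 (m + 1) t * hermiteFun1 k t =
      √((k : ℝ) / 2) * ∫ t, hermiteFun1 m t * hermiteFun1 (k - 1) t := by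
  have hi := integrable_hermiteFun1_mul
  have e1 : ∀ a b : ℝ, ∀ u v w : ℕ, Integrable fun t => hermiteFun1 u t *
      (a * hermiteFun1 v t + b * hermiteFun1 w t) := by
    intro a b u v w
    refine (((hi u v).const_mul a).add ((hi u w).const_mul b)).congr
      (Eventually.of_forall fun t => ?_)
    simp only [Pi.add_apply]
    ring
  have ibp := integral_mul_deriv_eq_deriv_mul_of_integrable (u := hermiteFun1 m)
    (v := hermiteFun1 k) (fun t _ => hasDerivAt_hermiteFun1 m t)
    (fun t _ => hasDerivAt_hermiteFun1 k t) ?_ ?_ (hi m k)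
  · have h1 : ∫ t, hermiteFun1 m t * (t * hermiteFun1 k t) =
        ∫ t, (t * hermiteFun1 m t) * hermiteFun1 k t := by
      congr 1; ext t; ring
    simp_rw [mul_hermiteFun1] at h1
    have e2 : ∀ a b : ℝ, ∀ u v w : ℕ, ∫ t, hermiteFun1 u t *
        (a * hermiteFun1 v t + b * hermiteFun1 w t) =
        a * (∫ t, hermiteFun1 u t * hermiteFun1 v t) +
          b * ∫ t, hermiteFun1 u t * hermiteFun1 w t := by
      intro a b u v w
      rw [← integral_const_mul, ← integral_const_mul, ← integral_add ((hi u v).const_mul a)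
        ((hi u w).const_mul b)]
      congr 1; ext t; ring
    have e3 : ∀ a b : ℝ, ∀ u v w : ℕ, ∫ t,
        (a * hermiteFun1 v t + b * hermiteFun1 w t) * hermiteFun1 u t =
        a * (∫ t, hermiteFun1 v t * hermiteFun1 u t) +
          b * ∫ t, hermiteFun1 w t * hermiteFun1 u t := by
      intro a b u v w
      simp_rw [mul_comm _ (hermiteFun1 u _)]
      rw [e2]
    simp only [sub_eq_add_neg, ← neg_mul] at ibp
    rw [e2, e3] at ibp h1
    linarith
  · simp only [sub_eq_add_neg, ← neg_mul]
    exact e1 _ _ _ _ _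
  · simp only [sub_eq_add_neg, ← neg_mul]
    refine (e1 (√((m : ℝ) / 2)) (-√(((m : ℝ) + 1) / 2)) k (m - 1) (m + 1)).congr
      (Eventually.of_forall fun t => ?_)
    simp only [Pi.mul_apply]
    ring

theorem integral_hermiteFun1_mul (m k : ℕ) :
    ∫ t, hermiteFun1 m t * hermiteFun1 k t = if m = k then 1 else 0 := by
  -- The adjoint relation lowers both indices at once, so the induction ends when one of them is 0;
  -- there the factor √(0/2) kills the right-hand side.
  have hz : ∀ m, ∫ t, hermiteFun1 (m + 1) t * hermiteFun1 0 t = 0 := by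
    intro m
    have h := integral_raise_hermiteFun1 m 0
    simp only [Nat.cast_zero, zero_div, Real.sqrt_zero, zero_mul] at h
    exact (mul_eq_zero.1 h).resolve_left (by positivity)
  induction m generalizing k with
  | zero =>
    cases k with
    | zero => simp [integral_hermiteFun1_zero]
    | succ k => rw [integral_hermiteFun1_comm, hz]; simp
  | succ m ih =>
    cases k with
    | zero => rw [hz]; simp
    | succ k =>
      have h := integral_raise_hermiteFun1 m (k + 1)
      rw [Nat.add_sub_cancel, ih] at h
      by_cases hmk : m = k
      · subst hmk
        push_cast at h
        have := mul_left_cancel₀ (by positivity) h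
        simpa using this
      · simp only [hmk, if_false, mul_zero] at h
        simpa [hmk] using (mul_eq_zero.1 h).resolve_left (by positivity)

/-- A Sobolev estimate: h(t)² is the integral of 2hh' over (-∞, t], hence at most ‖h‖² + ‖h'‖² in
L². Orthonormality and the ladder formula give 1 and m/2 + (m+1)/2 for the two terms. -/
theorem hermiteFun1_sq_le (m : ℕ) (t : ℝ) : hermiteFun1 m t ^ 2 ≤ m + 3 / 2 := by
  set a := √((m : ℝ) / 2)
  set b := √(((m : ℝ) + 1) / 2)
  have ha : a ^ 2 = m / 2 := Real.sq_sqrt (by positivity)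
  have hb : b ^ 2 = (m + 1) / 2 := Real.sq_sqrt (by positivity)
  let h := hermiteFun1 m
  let h' := fun t => a * hermiteFun1 (m - 1) t - b * hermiteFun1 (m + 1) t
  have hd : ∀ t, HasDerivAt h (h' t) t := hasDerivAt_hermiteFun1 m
  have hi := integrable_hermiteFun1_mul
  have i1 : Integrable fun t => h t ^ 2 := (hi m m).congr (Eventually.of_forall fun t =>
    (sq (h t)).symm)
  have i2 : Integrable fun t => h' t ^ 2 := by
    refine ((((hi (m - 1) (m - 1)).const_mul (a ^ 2)).add ((hi (m + 1) (m + 1)).const_mul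
      (b ^ 2))).sub ((hi (m - 1) (m + 1)).const_mul (2 * a * b))).congr
      (Eventually.of_forall fun t => ?_)
    simp only [h', Pi.add_apply, Pi.sub_apply]
    ring
  have i3 : Integrable fun t => 2 * h t * h' t := by
    refine (((hi m (m - 1)).const_mul (2 * a)).sub ((hi m (m + 1)).const_mul
      (2 * b))).congr (Eventually.of_forall fun t => ?_)
    simp only [h', h, Pi.sub_apply]
    ring
  have hv : ∫ t, h' t ^ 2 ≤ m + 1 / 2 := by
    have e : ∀ t, h' t ^ 2 = a ^ 2 * (hermiteFun1 (m - 1) t * hermiteFun1 (m - 1) t) +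
        b ^ 2 * (hermiteFun1 (m + 1) t * hermiteFun1 (m + 1) t) -
        2 * a * b * (hermiteFun1 (m - 1) t * hermiteFun1 (m + 1) t) := by
      intro t; simp only [h']; ring
    simp_rw [e]
    rw [integral_sub, integral_add, integral_const_mul, integral_const_mul, integral_const_mul,
      integral_hermiteFun1_mul, integral_hermiteFun1_mul, integral_hermiteFun1_mul,
      if_pos rfl, if_pos rfl, if_neg (by omega), ha, hb]
    · linarith
    · exact (hi _ _).const_mul _
    · exact (hi _ _).const_mul _
    · exact ((hi _ _).const_mul _).add ((hi _ _).const_mul _)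
    · exact (hi _ _).const_mul _
  have hd2 : ∀ t, HasDerivAt (fun t => h t ^ 2) (2 * h t * h' t) t := fun t => by
    convert! (hd t).pow 2 using 1
    simp
  have ftc := integral_Iic_of_hasDerivAt_of_tendsto' (a := t) (fun x _ => hd2 x)
    i3.integrableOn
    (tendsto_zero_of_hasDerivAt_of_integrableOn_Iic (a := t) (fun x _ => hd2 x) i3.integrableOn
      i1.integrableOn)
  rw [sub_zero] at ftc
  have hone : ∫ t, h t ^ 2 = 1 := by
    simp only [sq, h]
    rw [integral_hermiteFun1_mul, if_pos rfl]
  calc h t ^ 2 = ∫ x in Set.Iic t, 2 * h x * h' x := ftc.symm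
    _ ≤ ∫ x in Set.Iic t, (h x ^ 2 + h' x ^ 2) :=
        setIntegral_mono i3.integrableOn (i1.add i2).integrableOn
          fun x => by linarith [sq_nonneg (h x - h' x)]
    _ ≤ ∫ x, (h x ^ 2 + h' x ^ 2) :=
        setIntegral_le_integral (i1.add i2) (Eventually.of_forall fun x => by
          simp only [Pi.zero_apply]; positivity)
    _ = (∫ x, h x ^ 2) + ∫ x, h' x ^ 2 := integral_add i1 i2
    _ ≤ m + 3 / 2 := by rw [hone]; linarith

end HermiteOne

/-! ### Hermite functions on `ℝ^d` -/

section HermiteMulti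

variable {d : ℕ}

theorem hermiteFun_eq_mul (n : Fin d → ℕ) (i : Fin d) (x : EuclideanSpace ℝ (Fin d)) :
    hermiteFun n x = hermiteFun1 (n i) (x i) *
      ∏ k ∈ Finset.univ.erase i, hermiteFun1 (n k) (x k) :=
  (Finset.mul_prod_erase _ _ (Finset.mem_univ i)).symm

theorem hermiteFun_add_single (n : Fin d → ℕ) (i : Fin d) (x : EuclideanSpace ℝ (Fin d)) :
    hermiteFun (n + Pi.single i 1) x = hermiteFun1 (n i + 1) (x i) *
      ∏ k ∈ Finset.univ.erase i, hermiteFun1 (n k) (x k) := by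
  rw [hermiteFun_eq_mul _ i]
  congr 1
  · simp
  · refine Finset.prod_congr rfl fun k hk => ?_
    simp [Finset.ne_of_mem_erase hk]

theorem hermiteFun_sub_single (n : Fin d → ℕ) (i : Fin d) (x : EuclideanSpace ℝ (Fin d)) :
    hermiteFun (n - Pi.single i 1) x = hermiteFun1 (n i - 1) (x i) *
      ∏ k ∈ Finset.univ.erase i, hermiteFun1 (n k) (x k) := by
  rw [hermiteFun_eq_mul _ i]
  congr 1
  · simp
  · refine Finset.prod_congr rfl fun k hk => ?_
    simp [Finset.ne_of_mem_erase hk]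

theorem coord_mul_hermiteFun (n : Fin d → ℕ) (i : Fin d) (x : EuclideanSpace ℝ (Fin d)) :
    x i * hermiteFun n x = √((n i : ℝ) / 2) * hermiteFun (n - Pi.single i 1) x +
      √(((n i : ℝ) + 1) / 2) * hermiteFun (n + Pi.single i 1) x := by
  rw [hermiteFun_eq_mul _ i, hermiteFun_add_single, hermiteFun_sub_single, ← mul_assoc,
    mul_hermiteFun1]
  ring

theorem hasLineDerivAt_hermiteFun (n : Fin d → ℕ) (i : Fin d) (x : EuclideanSpace ℝ (Fin d)) :
    HasLineDerivAt ℝ (hermiteFun n) (√((n i : ℝ) / 2) * hermiteFun (n - Pi.single i 1) x -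
      √(((n i : ℝ) + 1) / 2) * hermiteFun (n + Pi.single i 1) x) x
      (EuclideanSpace.single i (1 : ℝ)) := by
  have h1 : ∀ t : ℝ, hermiteFun n (x + t • EuclideanSpace.single i (1 : ℝ)) =
      hermiteFun1 (n i) (x i + t) * ∏ k ∈ Finset.univ.erase i, hermiteFun1 (n k) (x k) := by
    intro t
    rw [hermiteFun_eq_mul _ i]
    congr 1
    · simp
    · refine Finset.prod_congr rfl fun k hk => ?_
      simp [Finset.ne_of_mem_erase hk]
  unfold HasLineDerivAt
  simp_rw [h1]
  have h2 : HasDerivAt (fun t => hermiteFun1 (n i) (x i + t))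
      (√((n i : ℝ) / 2) * hermiteFun1 (n i - 1) (x i) -
        √(((n i : ℝ) + 1) / 2) * hermiteFun1 (n i + 1) (x i)) 0 :=
    HasDerivAt.comp_const_add (x i) 0 (by simpa using hasDerivAt_hermiteFun1 (n i) (x i))
  refine (h2.mul_const _).congr_deriv ?_
  rw [hermiteFun_add_single, hermiteFun_sub_single]
  ring

theorem continuous_hermiteFun (n : Fin d → ℕ) : Continuous (hermiteFun n) := by
  unfold hermiteFun
  exact continuous_finsetProd _ fun k _ => (continuous_hermiteFun1 (n k)).comp (by fun_prop)

/-- Multiply the one-dimensional bounds, using m + 3/2 ≤ 2(1 + m²). The estimate is crude; what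
matters later is that it is uniform in x and polynomial in n. -/
theorem abs_hermiteFun_le (n : Fin d → ℕ) (x : EuclideanSpace ℝ (Fin d)) :
    |hermiteFun n x| ≤ 2 ^ d * seqWeight d n := by
  refine abs_le_of_sq_le_sq ?_ (mul_nonneg (by positivity) (seqWeight_nonneg _ _))
  rw [mul_pow, seqWeight_pow, hermiteFun, ← Finset.prod_pow]
  calc ∏ k, hermiteFun1 (n k) (x k) ^ 2 ≤ ∏ k, 2 * (1 + (n k : ℝ) ^ 2) := by
        refine Finset.prod_le_prod (fun k _ => sq_nonneg _) fun k _ =>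
          (hermiteFun1_sq_le _ _).trans ?_
        nlinarith [sq_nonneg ((n k : ℝ) - 1 / 2)]
    _ = 2 ^ d * ∏ k, (1 + (n k : ℝ) ^ 2) := by
        rw [Finset.prod_mul_distrib]
        simp
    _ ≤ (2 ^ d) ^ 2 * seqWeight (d * 2) n := by
        rw [mul_comm d 2]
        refine mul_le_mul ?_ (prod_one_add_sq_le_seqWeight n)
          (Finset.prod_nonneg fun k _ => by positivity) (by positivity)
        exact le_self_pow₀ (one_le_pow₀ one_le_two) two_ne_zero

theorem integral_hermiteFun_mul (m n : Fin d → ℕ) :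
    ∫ x : EuclideanSpace ℝ (Fin d), hermiteFun m x * hermiteFun n x = if m = n then 1 else 0 := by
  rw [← (PiLp.volume_preserving_toLp (Fin d)).integral_comp
    (MeasurableEquiv.toLp 2 _).measurableEmbedding]
  simp only [hermiteFun, ← Finset.prod_mul_distrib]
  rw [integral_fintype_prod_volume_eq_prod
    (f := fun k (t : ℝ) => hermiteFun1 (m k) t * hermiteFun1 (n k) t)]
  simp only [integral_hermiteFun1_mul]
  by_cases h : m = n
  · simp [h]
  · rw [if_neg h]
    obtain ⟨k, hk⟩ := Function.ne_iff.1 h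
    exact Finset.prod_eq_zero (Finset.mem_univ k) (if_neg hk)

theorem hermiteFun_zero (x : EuclideanSpace ℝ (Fin d)) :
    hermiteFun 0 x = hermiteNorm 0 ^ d * Real.exp (-‖x‖ ^ 2 / 2) := by
  simp only [hermiteFun, hermiteFun1_eq, hermitePoly, Pi.zero_apply, Polynomial.eval_one, mul_one,
    Finset.prod_mul_distrib]
  rw [← Real.exp_sum, EuclideanSpace.norm_sq_eq]
  simp [neg_div, Finset.sum_div]

end HermiteMulti

/-! ### Rapidly decaying continuous functions -/

section RapidDecay

variable {d : ℕ} {W : Type*} [NormedAddCommGroup W]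

/-- Continuous functions all of whose weighted suprema are finite. -/
def RapidDecay (φ : EuclideanSpace ℝ (Fin d) → W) : Prop :=
  Continuous φ ∧ ∀ k : ℕ, ∃ C, ∀ x, ‖φ x‖ * schwartzWeight k x ≤ C

theorem one_le_schwartzWeight (k : ℕ) (x : EuclideanSpace ℝ (Fin d)) :
    1 ≤ schwartzWeight k x := by
  rw [schwartzWeight_eq]
  exact one_le_pow₀ (Real.one_le_sqrt.2 (by nlinarith [sq_nonneg ‖x‖]))

theorem schwartzWeight_pos (k : ℕ) (x : EuclideanSpace ℝ (Fin d)) : 0 < schwartzWeight k x :=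
  one_pos.trans_le (one_le_schwartzWeight k x)

theorem schwartzWeight_add (j k : ℕ) (x : EuclideanSpace ℝ (Fin d)) :
    schwartzWeight (j + k) x = schwartzWeight j x * schwartzWeight k x := by
  simp only [schwartzWeight_eq, pow_add]

theorem schwartzWeight_two (x : EuclideanSpace ℝ (Fin d)) :
    schwartzWeight 2 x = 1 + ‖x‖ ^ 2 := by
  rw [schwartzWeight_eq, Real.sq_sqrt (by positivity)]

theorem schwartzWeight_mono {j k : ℕ} (h : j ≤ k) (x : EuclideanSpace ℝ (Fin d)) :
    schwartzWeight j x ≤ schwartzWeight k x := by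
  obtain ⟨m, rfl⟩ := Nat.exists_eq_add_of_le h
  rw [schwartzWeight_add]
  exact le_mul_of_one_le_right (schwartzWeight_nonneg j x) (one_le_schwartzWeight m x)

theorem norm_le_schwartzWeight (x : EuclideanSpace ℝ (Fin d)) : ‖x‖ ≤ schwartzWeight 1 x := by
  rw [schwartzWeight_eq, pow_one]
  exact Real.le_sqrt_of_sq_le (by linarith)

theorem abs_coord_le (x : EuclideanSpace ℝ (Fin d)) (i : Fin d) : |x i| ≤ ‖x‖ :=
  PiLp.norm_apply_le x i

theorem integrable_inv_schwartzWeight (d : ℕ) :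
    Integrable fun x : EuclideanSpace ℝ (Fin d) => (schwartzWeight (d + 1) x)⁻¹ := by
  have h := integrable_rpow_neg_one_add_norm_sq (E := EuclideanSpace ℝ (Fin d)) (μ := volume)
    (r := d + 1) (by simp)
  refine h.congr (Eventually.of_forall fun x => ?_)
  simp only [schwartzWeight]
  rw [← Real.rpow_neg (by positivity)]
  push_cast
  ring_nf

theorem RapidDecay.integrable {φ : EuclideanSpace ℝ (Fin d) → W} (h : RapidDecay φ) :
    Integrable φ := by
  obtain ⟨C, hC⟩ := h.2 (d + 1)
  refine ((integrable_inv_schwartzWeight d).const_mul C).mono' h.1.aestronglyMeasurable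
    (Eventually.of_forall fun x => ?_)
  rw [← div_eq_mul_inv, le_div_iff₀ (schwartzWeight_pos _ _)]
  exact hC x

variable {𝕜 : Type*} [RCLike 𝕜] [NormedSpace 𝕜 W]

theorem RapidDecay.smul {φ : EuclideanSpace ℝ (Fin d) → W} (h : RapidDecay φ)
    {g : EuclideanSpace ℝ (Fin d) → 𝕜} (hg : Continuous g) (m : ℕ) {B : ℝ}
    (hb : ∀ x, ‖g x‖ ≤ B * schwartzWeight m x) : RapidDecay fun x => g x • φ x := by
  refine ⟨hg.smul h.1, fun k => ?_⟩
  obtain ⟨C, hC⟩ := h.2 (m + k)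
  have hB : 0 ≤ B := nonneg_of_mul_nonneg_left ((norm_nonneg _).trans (hb 0))
    (schwartzWeight_pos _ _)
  refine ⟨B * C, fun x => ?_⟩
  have h2 := hC x
  rw [schwartzWeight_add] at h2
  rw [norm_smul]
  calc ‖g x‖ * ‖φ x‖ * schwartzWeight k x
      ≤ B * schwartzWeight m x * ‖φ x‖ * schwartzWeight k x := by
        have := schwartzWeight_nonneg k x
        gcongr
        exact hb x
    _ = B * (‖φ x‖ * (schwartzWeight m x * schwartzWeight k x)) := by ring
    _ ≤ B * C := mul_le_mul_of_nonneg_left h2 hB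

theorem RapidDecay.hermiteFun_smul {φ : EuclideanSpace ℝ (Fin d) → W} (h : RapidDecay φ)
    (n : Fin d → ℕ) : RapidDecay fun x => (hermiteFun n x : 𝕜) • φ x :=
  h.smul (RCLike.continuous_ofReal.comp (continuous_hermiteFun n)) 0
    (B := 2 ^ d * seqWeight d n) fun x => by
      rw [RCLike.norm_ofReal]
      exact (abs_hermiteFun_le n x).trans
        (le_mul_of_one_le_right (mul_nonneg (by positivity) (seqWeight_nonneg _ _))
          (one_le_schwartzWeight 0 x))

end RapidDecay

/-! ### Completeness of the Hermite functions -/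

section Completeness

variable {d : ℕ}

/-- Because x_i h_n is a combination of two Hermite functions, orthogonality to all h_n survives
multiplication by coordinates, and hence by powers of any linear form. -/
theorem integral_coord_mul_hermiteFun_eq_zero {φ : EuclideanSpace ℝ (Fin d) → ℂ}
    (hφ : RapidDecay φ) (h : ∀ n, ∫ x, (hermiteFun n x : ℂ) • φ x = 0) (i : Fin d)
    (n : Fin d → ℕ) : ∫ x, (hermiteFun n x : ℂ) • (((x i : ℝ) : ℂ) • φ x) = 0 := by
  have e : ∀ x : EuclideanSpace ℝ (Fin d), (hermiteFun n x : ℂ) • (((x i : ℝ) : ℂ) • φ x) =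
      (√((n i : ℝ) / 2) : ℂ) * ((hermiteFun (n - Pi.single i 1) x : ℂ) • φ x) +
      (√(((n i : ℝ) + 1) / 2) : ℂ) * ((hermiteFun (n + Pi.single i 1) x : ℂ) • φ x) := by
    intro x
    have h1 := congrArg (fun r : ℝ => (r : ℂ)) (coord_mul_hermiteFun n i x)
    push_cast at h1
    simp only [smul_eq_mul]
    linear_combination φ x * h1
  simp_rw [e]
  rw [integral_add, integral_const_mul, integral_const_mul, h, h, mul_zero, mul_zero, add_zero]
  · exact (hφ.hermiteFun_smul _).integrable.const_mul _
  · exact (hφ.hermiteFun_smul _).integrable.const_mul _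

theorem RapidDecay.coord_smul {φ : EuclideanSpace ℝ (Fin d) → ℂ} (hφ : RapidDecay φ)
    (i : Fin d) : RapidDecay fun x => ((x i : ℝ) : ℂ) • φ x :=
  hφ.smul (𝕜 := ℂ) (by fun_prop) 1 (B := 1) fun x => by
    rw [Complex.norm_real, one_mul]
    exact (abs_coord_le x i).trans (norm_le_schwartzWeight x)

theorem RapidDecay.inner_smul {φ : EuclideanSpace ℝ (Fin d) → ℂ} (hφ : RapidDecay φ)
    (ξ : EuclideanSpace ℝ (Fin d)) : RapidDecay fun x => ((inner ℝ x ξ : ℝ) : ℂ) • φ x :=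
  hφ.smul (𝕜 := ℂ) (by fun_prop) 1 (B := ‖ξ‖) fun x => by
    rw [Complex.norm_real, mul_comm]
    exact (abs_real_inner_le_norm x ξ).trans
      (mul_le_mul_of_nonneg_right (norm_le_schwartzWeight x) (norm_nonneg _))

theorem integral_inner_mul_hermiteFun_eq_zero {φ : EuclideanSpace ℝ (Fin d) → ℂ}
    (hφ : RapidDecay φ) (h : ∀ n, ∫ x, (hermiteFun n x : ℂ) • φ x = 0)
    (ξ : EuclideanSpace ℝ (Fin d)) (n : Fin d → ℕ) :
    ∫ x, (hermiteFun n x : ℂ) • (((inner ℝ x ξ : ℝ) : ℂ) • φ x) = 0 := by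
  have e : ∀ x : EuclideanSpace ℝ (Fin d),
      (hermiteFun n x : ℂ) • (((inner ℝ x ξ : ℝ) : ℂ) • φ x) =
      ∑ i, (ξ i : ℂ) * ((hermiteFun n x : ℂ) • (((x i : ℝ) : ℂ) • φ x)) := by
    intro x
    simp only [PiLp.inner_apply, RCLike.inner_apply, conj_trivial, smul_eq_mul]
    push_cast
    rw [Finset.sum_mul, Finset.mul_sum]
    exact Finset.sum_congr rfl fun i _ => by ring
  simp_rw [e]
  rw [integral_finsetSum (f := fun i x => (ξ i : ℂ) *
    ((hermiteFun n x : ℂ) • (((x i : ℝ) : ℂ) • φ x))) _ fun i _ =>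
    ((hφ.coord_smul i).hermiteFun_smul n).integrable.const_mul _]
  refine Finset.sum_eq_zero fun i _ => ?_
  rw [integral_const_mul, integral_coord_mul_hermiteFun_eq_zero hφ h, mul_zero]

theorem integral_inner_pow_mul_hermiteFun_eq_zero (ξ : EuclideanSpace ℝ (Fin d)) (k : ℕ) :
    ∀ {φ : EuclideanSpace ℝ (Fin d) → ℂ}, RapidDecay φ →
      (∀ n, ∫ x, (hermiteFun n x : ℂ) • φ x = 0) →
      ∀ n, ∫ x, (hermiteFun n x : ℂ) • (((inner ℝ x ξ : ℝ) : ℂ) ^ k • φ x) = 0 := by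
  induction k with
  | zero => intro φ _ h n; simpa using h n
  | succ k ih =>
    intro φ hφ h n
    have := ih (hφ.inner_smul ξ) (integral_inner_mul_hermiteFun_eq_zero hφ h ξ) n
    simpa only [smul_smul, pow_succ] using this

/-- Completing the square, c‖x‖ - ‖x‖²/2 ≤ c²/2: the Gaussian absorbs every exponential, which makes
the power series of the Fourier kernel integrable term by term. -/
theorem exp_mul_hermiteFun_zero_le (c : ℝ) (x : EuclideanSpace ℝ (Fin d)) :
    |hermiteFun 0 x| * Real.exp (c * ‖x‖) ≤ hermiteNorm 0 ^ d * Real.exp (c ^ 2 / 2) := by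
  have h0 : 0 ≤ hermiteNorm 0 := by rw [hermiteNorm]; positivity
  rw [hermiteFun_zero, abs_of_nonneg (by positivity), mul_assoc, ← Real.exp_add]
  gcongr
  nlinarith [sq_nonneg (‖x‖ - c)]

/-- Expanding the Fourier kernel into powers of ⟨x, w⟩, every term of the transform of h_0 φ is an
integral known to vanish. Fourier inversion gives h_0 φ = 0, and h_0 has no zeros. -/
theorem eq_zero_of_hermite_coeff_eq_zero_complex {φ : EuclideanSpace ℝ (Fin d) → ℂ}
    (hφ : RapidDecay φ) (h : ∀ n, ∫ x, (hermiteFun n x : ℂ) • φ x = 0) : φ = 0 := by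
  let ψ : EuclideanSpace ℝ (Fin d) → ℂ := fun x => (hermiteFun 0 x : ℂ) • φ x
  have hψ : RapidDecay ψ := hφ.hermiteFun_smul 0
  have hF : FourierTransform.fourier ψ = 0 := by
    ext w
    rw [Real.fourier_eq']
    let c : ℂ := ((-2 * Real.pi : ℝ) : ℂ) * Complex.I
    -- The k-th Taylor term of exp(c⟨x, w⟩), multiplied by h_0 φ.
    let F : ℕ → EuclideanSpace ℝ (Fin d) → ℂ := fun k x =>
      (c ^ k / (k.factorial : ℂ)) * ((hermiteFun 0 x : ℂ) • (((inner ℝ x w : ℝ) : ℂ) ^ k • φ x))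
    let a : ℝ := ‖c‖ * ‖w‖
    have hFc : ∀ k, Continuous (F k) := fun k => by
      have h1 := continuous_hermiteFun (0 : Fin d → ℕ)
      have h2 := hφ.1
      simp only [F, smul_eq_mul]
      fun_prop
    have hbs : ∀ x, HasSum (fun k : ℕ => (a * ‖x‖) ^ k / (k.factorial : ℝ) *
        (|hermiteFun 0 x| * ‖φ x‖)) (Real.exp (a * ‖x‖) * (|hermiteFun 0 x| * ‖φ x‖)) := by
      intro x
      have := NormedSpace.expSeries_div_hasSum_exp (a * ‖x‖)
      rw [← Real.exp_eq_exp_ℝ] at this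
      exact this.mul_right _
    have key := hasSum_integral_of_dominated_convergence (μ := volume) (F := F)
      (f := fun x => Complex.exp ((-2 * Real.pi * inner ℝ x w : ℝ) * Complex.I) • ψ x)
      (fun k x => (a * ‖x‖) ^ k / (k.factorial : ℝ) * (|hermiteFun 0 x| * ‖φ x‖))
      (fun k => (hFc k).aestronglyMeasurable) (fun k => Eventually.of_forall fun x => ?_)
      (Eventually.of_forall fun x => (hbs x).summable) ?_ (Eventually.of_forall fun x => ?_)
    · have hz : ∀ k, ∫ x, F k x = 0 := fun k => by
        simp only [F]
        rw [integral_const_mul, integral_inner_pow_mul_hermiteFun_eq_zero w k hφ h, mul_zero]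
      simp only [hz] at key
      exact key.unique hasSum_zero
    · simp only [F, norm_mul, norm_smul, norm_div, norm_pow, Complex.norm_real, Real.norm_eq_abs,
        Complex.norm_natCast]
      have h1 : |inner ℝ x w| ^ k ≤ (‖x‖ * ‖w‖) ^ k :=
        pow_le_pow_left₀ (abs_nonneg _) (abs_real_inner_le_norm x w) k
      calc ‖c‖ ^ k / (k.factorial : ℝ) * (|hermiteFun 0 x| * (|inner ℝ x w| ^ k * ‖φ x‖))
          ≤ ‖c‖ ^ k / (k.factorial : ℝ) * (|hermiteFun 0 x| * ((‖x‖ * ‖w‖) ^ k * ‖φ x‖)) := by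
            gcongr
        _ = _ := by simp only [a]; ring
    · simp only [fun x => (hbs x).tsum_eq]
      refine (hφ.integrable.norm.const_mul (hermiteNorm 0 ^ d * Real.exp (a ^ 2 / 2))).mono'
        ?_ (Eventually.of_forall fun x => ?_)
      · have h1 := continuous_hermiteFun (0 : Fin d → ℕ)
        have h2 := hφ.1
        exact Continuous.aestronglyMeasurable (by fun_prop)
      · rw [Real.norm_eq_abs, abs_of_nonneg (by positivity), ← mul_assoc,
          mul_comm (Real.exp _)]
        exact mul_le_mul_of_nonneg_right (exp_mul_hermiteFun_zero_le a x) (norm_nonneg _)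
    · have h1 := (NormedSpace.expSeries_div_hasSum_exp (c * ((inner ℝ x w : ℝ) : ℂ))).mul_right
        (ψ x)
      rw [← Complex.exp_eq_exp_ℂ] at h1
      convert! h1 using 1
      · ext k
        simp only [F, ψ, smul_eq_mul, mul_pow]
        ring
      · rw [smul_eq_mul]
        congr 2
        simp only [c]
        push_cast
        ring
  -- The transform is integrable simply because it is zero, so the inversion formula holds at every
  -- point of the continuous function ψ.
  have hinv := hψ.1.fourierInv_fourier_eq hψ.integrable (by rw [hF]; exact integrable_zero _ _ _)
  rw [hF] at hinv
  ext x
  have h1 : ψ x = 0 := by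
    rw [← hinv, Real.fourierInv_eq']
    simp
  have h2 : (hermiteFun 0 x : ℂ) ≠ 0 := by
    rw [hermiteFun_zero, hermiteNorm]
    exact_mod_cast (by positivity)
  exact (smul_eq_zero.1 h1).resolve_left h2

/-- The Hermite functions are real, so taking real or imaginary parts commutes with taking
coefficients; each part is treated as a complex-valued function. -/
theorem eq_zero_of_hermite_coeff_eq_zero {𝕜 : Type*} [RCLike 𝕜]
    {φ : EuclideanSpace ℝ (Fin d) → 𝕜} (hφ : RapidDecay φ)
    (h : ∀ n, ∫ x, (hermiteFun n x : 𝕜) • φ x = 0) : φ = 0 := by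
  have key : ∀ L : 𝕜 →L[ℝ] ℝ, (∀ z, ‖L z‖ ≤ ‖z‖) → (∀ (r : ℝ) (z : 𝕜), L ((r : 𝕜) • z) = r * L z) →
      ∀ x, L (φ x) = 0 := by
    intro L hL hLr x
    have h1 : RapidDecay fun x => ((L (φ x) : ℝ) : ℂ) := by
      refine ⟨Complex.continuous_ofReal.comp (L.continuous.comp hφ.1), fun k => ?_⟩
      obtain ⟨C, hC⟩ := hφ.2 k
      refine ⟨C, fun x => le_trans ?_ (hC x)⟩
      rw [Complex.norm_real]
      exact mul_le_mul_of_nonneg_right (hL _) (schwartzWeight_nonneg _ _)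
    have h2 := eq_zero_of_hermite_coeff_eq_zero_complex h1 fun n => by
      have e : ∀ x, (hermiteFun n x : ℂ) • ((L (φ x) : ℝ) : ℂ) =
          ((L ((hermiteFun n x : 𝕜) • φ x) : ℝ) : ℂ) := fun x => by
        rw [hLr, smul_eq_mul]
        push_cast
        rfl
      simp_rw [e]
      rw [integral_complex_ofReal, L.integral_comp_comm (hφ.hermiteFun_smul n).integrable, h, map_zero]
      rfl
    exact Complex.ofReal_eq_zero.1 (congrFun h2 x)
  ext x
  refine RCLike.ext ?_ ?_
  · simpa using key RCLike.reCLM RCLike.norm_re_le_norm (fun r z => by simp) x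
  · simpa using key RCLike.imCLM RCLike.norm_im_le_norm (fun r z => by simp) x

end Completeness

/-! ### The space `s(ℕ_0^d, E)` -/

section RapidSeqOps

variable {𝕜 : Type*} [RCLike 𝕜] {d : ℕ} {E : Type*} [AddCommGroup E] [Module 𝕜 E]
  [TopologicalSpace E]

namespace RapidSeq

@[ext]
theorem ext {x y : RapidSeq 𝕜 d E} (h : ∀ n, x n = y n) : x = y := DFunLike.ext _ _ h

@[simp] theorem add_apply (x y : RapidSeq 𝕜 d E) (n : Fin d → ℕ) : (x + y) n = x n + y n := rfl

@[simp] theorem sub_apply (x y : RapidSeq 𝕜 d E) (n : Fin d → ℕ) : (x - y) n = x n - y n := rfl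

@[simp] theorem smul_apply (c : 𝕜) (x : RapidSeq 𝕜 d E) (n : Fin d → ℕ) : (c • x) n = c • x n :=
  rfl

@[simp] theorem zero_apply (n : Fin d → ℕ) : (0 : RapidSeq 𝕜 d E) n = 0 := rfl

theorem sum_apply {ι : Type*} (s : Finset ι) (x : ι → RapidSeq 𝕜 d E) (n : Fin d → ℕ) :
    (∑ i ∈ s, x i) n = ∑ i ∈ s, x i n := map_sum (RapidSeq.coord 𝕜 d E n) x s

/-- The seminorm `sup_n p (x_n) (1 + |n|²)^{j/2}`. -/
abbrev seminorm (j : ℕ) (p : {p : Seminorm 𝕜 E // Continuous p}) : Seminorm 𝕜 (RapidSeq 𝕜 d E) :=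
  rapidSeminorms 𝕜 d E (j, p)

theorem continuous_seminorm (j : ℕ) (p : {p : Seminorm 𝕜 E // Continuous p}) :
    Continuous (seminorm (d := d) j p) :=
  (rapidSeq_withSeminorms 𝕜 d E).continuous_seminorm (j, p)

theorem le_seminorm (x : RapidSeq 𝕜 d E) (j : ℕ) (p : {p : Seminorm 𝕜 E // Continuous p})
    (n : Fin d → ℕ) : p.1 (x n) * seqWeight j n ≤ seminorm j p x :=
  le_ciSup (x.bddAbove p.1 p.2 j) n

theorem seminorm_le (x : RapidSeq 𝕜 d E) (j : ℕ) (p : {p : Seminorm 𝕜 E // Continuous p}) {C : ℝ}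
    (h : ∀ n, p.1 (x n) * seqWeight j n ≤ C) : seminorm j p x ≤ C :=
  ciSup_le h

theorem continuous_of_bound {V : Type*} [AddCommGroup V] [Module 𝕜 V] [TopologicalSpace V]
    [IsTopologicalAddGroup V] (L : V →ₗ[𝕜] RapidSeq 𝕜 d E)
    (h : ∀ (p : {p : Seminorm 𝕜 E // Continuous p}) (j : ℕ), ∃ q : Seminorm 𝕜 V, Continuous q ∧
      ∀ v n, p.1 (L v n) * seqWeight j n ≤ q v) : Continuous L := by
  refine (rapidSeq_withSeminorms 𝕜 d E).continuous_of_continuous_comp L ?_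
  rintro ⟨j, p⟩
  obtain ⟨q, hq, hle⟩ := h p j
  exact Seminorm.continuous_of_le hq fun v => seminorm_le _ _ _ (hle v)

/-- The operator `x ↦ (a_n x_{σ n})_n`. -/
def weightedShift (a : (Fin d → ℕ) → 𝕜) (σ : (Fin d → ℕ) → Fin d → ℕ)
    (h : ∀ j : ℕ, ∃ (C : ℝ) (k : ℕ), ∀ n, ‖a n‖ * seqWeight j n ≤ C * seqWeight k (σ n)) :
    RapidSeq 𝕜 d E →L[𝕜] RapidSeq 𝕜 d E :=
  have key : ∀ (x : RapidSeq 𝕜 d E) (p : {p : Seminorm 𝕜 E // Continuous p}) (j : ℕ) (C : ℝ)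
      (k : ℕ), (∀ n, ‖a n‖ * seqWeight j n ≤ C * seqWeight k (σ n)) → ∀ n,
      p.1 (a n • x (σ n)) * seqWeight j n ≤ C * seminorm k p x := by
    intro x p j C k hC n
    have hC0 : 0 ≤ C := nonneg_of_mul_nonneg_left
      ((mul_nonneg (norm_nonneg _) (seqWeight_nonneg _ _)).trans (hC 0)) (seqWeight_pos k (σ 0))
    calc p.1 (a n • x (σ n)) * seqWeight j n = p.1 (x (σ n)) * (‖a n‖ * seqWeight j n) := by
          rw [map_smul_eq_mul]; ring
      _ ≤ p.1 (x (σ n)) * (C * seqWeight k (σ n)) :=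
          mul_le_mul_of_nonneg_left (hC n) (apply_nonneg _ _)
      _ = C * (p.1 (x (σ n)) * seqWeight k (σ n)) := by ring
      _ ≤ C * seminorm k p x := mul_le_mul_of_nonneg_left (le_seminorm x k p _) hC0
  let L : RapidSeq 𝕜 d E →ₗ[𝕜] RapidSeq 𝕜 d E :=
    { toFun := fun x => ⟨fun n => a n • x (σ n), fun p hp j => by
        obtain ⟨C, k, hC⟩ := h j
        refine ⟨C * seminorm k ⟨p, hp⟩ x, ?_⟩
        rintro _ ⟨n, rfl⟩
        exact key x ⟨p, hp⟩ j C k hC n⟩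
      map_add' := fun x y => ext fun n => smul_add (a n) (x (σ n)) (y (σ n))
      map_smul' := fun c x => ext fun n => smul_comm (a n) c (x (σ n)) }
  ⟨L, continuous_of_bound L fun p j => by
    obtain ⟨C, k, hC⟩ := h j
    have hC0 : 0 ≤ C := nonneg_of_mul_nonneg_left
      ((mul_nonneg (norm_nonneg _) (seqWeight_nonneg _ _)).trans (hC 0)) (seqWeight_pos k (σ 0))
    exact ⟨C.toNNReal • seminorm k p, (continuous_seminorm k p).const_smul C.toNNReal,
      fun x n => (key x p j C k hC n).trans_eq (by
        rw [_root_.smul_apply, NNReal.smul_def, Real.coe_toNNReal C hC0, smul_eq_mul])⟩⟩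

variable (𝕜 E) in
/-- `x ↦ (√((n_i + 1) / 2) x_{n + e_i})_n`. -/
def lower (i : Fin d) : RapidSeq 𝕜 d E →L[𝕜] RapidSeq 𝕜 d E :=
  weightedShift (fun n => ((√(((n i : ℝ) + 1) / 2) : ℝ) : 𝕜)) (fun n => n + Pi.single i 1)
    fun j => ⟨1, 1 + j, fun n => by
      rw [RCLike.norm_ofReal, abs_of_nonneg (Real.sqrt_nonneg _), one_mul]
      refine le_trans ?_ (seqWeight_le_add_single (1 + j) n i)
      rw [seqWeight_add]
      exact mul_le_mul_of_nonneg_right (sqrt_le_seqWeight_one n i) (seqWeight_nonneg _ _)⟩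

variable (𝕜 E) in
/-- `x ↦ (√(n_i / 2) x_{n - e_i})_n`. -/
def raise (i : Fin d) : RapidSeq 𝕜 d E →L[𝕜] RapidSeq 𝕜 d E :=
  weightedShift (fun n => ((√((n i : ℝ) / 2) : ℝ) : 𝕜)) (fun n => n - Pi.single i 1)
    fun j => ⟨2 ^ j, 1 + j, fun n => by
      rw [RCLike.norm_ofReal, abs_of_nonneg (Real.sqrt_nonneg _)]
      -- For n_i = 0 the truncated shift does not move n, but the coefficient is 0; otherwise n = m
      -- + e_i and the subtraction is genuine.
      rcases Nat.eq_zero_or_pos (n i) with h0 | hpos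
      · rw [h0]
        simpa using mul_nonneg (pow_nonneg zero_le_two j) (seqWeight_nonneg (1 + j) _)
      · obtain ⟨m, rfl⟩ : ∃ m, n = m + Pi.single i 1 := by
          refine ⟨n - Pi.single i 1, (tsub_add_cancel_of_le ?_).symm⟩
          intro k
          by_cases hk : k = i
          · subst hk; simpa using Nat.one_le_iff_ne_zero.2 hpos.ne'
          · simp [hk]
        rw [add_tsub_cancel_right, seqWeight_add]
        have h1 := sqrt_le_seqWeight_one m i
        have h2 := seqWeight_add_single_le j m i
        simp only [Pi.add_apply, Pi.single_eq_same, Nat.cast_add, Nat.cast_one]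
        calc √(((m i : ℝ) + 1) / 2) * seqWeight j (m + Pi.single i 1)
            ≤ seqWeight 1 m * (2 ^ j * seqWeight j m) :=
              mul_le_mul h1 h2 (seqWeight_nonneg _ _) (seqWeight_nonneg _ _)
          _ = _ := by ring⟩

open Classical in
variable (𝕜 E) in
/-- The restriction of a family to a set of indices. -/
def truncate (B : Set (Fin d → ℕ)) : RapidSeq 𝕜 d E →L[𝕜] RapidSeq 𝕜 d E :=
  weightedShift (fun n => if n ∈ B then (1 : 𝕜) else 0) id fun j => ⟨1, j, fun n => by
    refine mul_le_mul_of_nonneg_right ?_ (seqWeight_nonneg _ _)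
    split_ifs <;> simp⟩

theorem lower_apply (i : Fin d) (x : RapidSeq 𝕜 d E) (n : Fin d → ℕ) :
    lower 𝕜 E i x n = ((√(((n i : ℝ) + 1) / 2) : ℝ) : 𝕜) • x (n + Pi.single i 1) := rfl

theorem raise_apply (i : Fin d) (x : RapidSeq 𝕜 d E) (n : Fin d → ℕ) :
    raise 𝕜 E i x n = ((√((n i : ℝ) / 2) : ℝ) : 𝕜) • x (n - Pi.single i 1) := rfl

open Classical in
theorem truncate_apply (B : Set (Fin d → ℕ)) (x : RapidSeq 𝕜 d E) (n : Fin d → ℕ) :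
    truncate 𝕜 E B x n = if n ∈ B then x n else 0 := by
  have : truncate 𝕜 E B x n = (if n ∈ B then (1 : 𝕜) else 0) • x n := rfl
  rw [this]
  split_ifs <;> simp

/-- The family with the only nonzero entry `e` at `m`. -/
def single (m : Fin d → ℕ) (e : E) : RapidSeq 𝕜 d E :=
  ⟨Pi.single m e, fun p _ j => ⟨p e * seqWeight j m, by
    rintro _ ⟨n, rfl⟩
    by_cases h : n = m
    · subst h
      simp
    · simpa [h] using mul_nonneg (apply_nonneg p e) (seqWeight_nonneg j m)⟩⟩

theorem single_apply (m : Fin d → ℕ) (e : E) (n : Fin d → ℕ) :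
    single (𝕜 := 𝕜) m e n = (Pi.single m e : (Fin d → ℕ) → E) n := rfl

/-- Spending 2d further powers of the weight buys a summable factor independent of x. -/
theorem weight_mul_le (x : RapidSeq 𝕜 d E) (p : {p : Seminorm 𝕜 E // Continuous p}) (k : ℕ)
    (n : Fin d → ℕ) :
    seqWeight k n * p.1 (x n) ≤ seminorm (k + 2 * d) p x * (seqWeight (2 * d) n)⁻¹ := by
  rw [← div_eq_mul_inv, le_div_iff₀ (seqWeight_pos _ _)]
  refine le_trans (le_of_eq ?_) (le_seminorm x (k + 2 * d) p n)
  rw [seqWeight_add]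
  ring

theorem summable_weight (x : RapidSeq 𝕜 d E) (p : {p : Seminorm 𝕜 E // Continuous p}) (k : ℕ) :
    Summable fun n => seqWeight k n * p.1 (x n) :=
  ((summable_inv_seqWeight d).mul_left _).of_nonneg_of_le
    (fun _ => mul_nonneg (seqWeight_nonneg _ _) (apply_nonneg _ _)) (weight_mul_le x p k)

theorem tsum_weight_le (x : RapidSeq 𝕜 d E) (p : {p : Seminorm 𝕜 E // Continuous p}) (k : ℕ) :
    ∑' n, seqWeight k n * p.1 (x n) ≤
      seminorm (k + 2 * d) p x * ∑' n : Fin d → ℕ, (seqWeight (2 * d) n)⁻¹ := by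
  rw [← tsum_mul_left]
  exact (summable_weight x p k).tsum_le_tsum (weight_mul_le x p k)
    ((summable_inv_seqWeight d).mul_left _)

end RapidSeq

end RapidSeqOps

/-! ### Hermite series -/

section HermiteSeries

variable {𝕜 : Type*} [RCLike 𝕜] {d : ℕ} {E : Type*} [AddCommGroup E] [Module 𝕜 E]
    [UniformSpace E] [IsUniformAddGroup E] [ContinuousSMul 𝕜 E] [PolynormableSpace 𝕜 E]
    [T2Space E]

/-- The Hermite series `∑ h_n(t) x_n`. -/
def hermiteSeries (x : RapidSeq 𝕜 d E) (t : EuclideanSpace ℝ (Fin d)) : E :=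
  ∑' n, (hermiteFun n t : 𝕜) • x n

/-- Families of scalars of polynomial growth. -/
def PolyBounded (c : (Fin d → ℕ) → 𝕜) : Prop :=
  ∃ (B : ℝ) (k : ℕ), ∀ n, ‖c n‖ ≤ B * seqWeight k n

theorem PolyBounded.summable_seminorm {c : (Fin d → ℕ) → 𝕜} (hc : PolyBounded c)
    (x : RapidSeq 𝕜 d E) (p : Seminorm 𝕜 E) (hp : Continuous p) :
    Summable fun n => p (c n • x n) := by
  obtain ⟨B, k, hB⟩ := hc
  refine ((x.summable_weight ⟨p, hp⟩ k).mul_left B).of_nonneg_of_le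
    (fun n => apply_nonneg _ _) fun n => ?_
  rw [map_smul_eq_mul, ← mul_assoc]
  exact mul_le_mul_of_nonneg_right (hB n) (apply_nonneg _ _)

theorem PolyBounded.summable (hE : ∀ u : ℕ → E, CauchySeq u → ∃ x, Tendsto u atTop (𝓝 x))
    {c : (Fin d → ℕ) → 𝕜} (hc : PolyBounded c) (x : RapidSeq 𝕜 d E) :
    Summable fun n => c n • x n :=
  summable_of_seminorm hE (hc.summable_seminorm x)

theorem norm_hermiteFun_le (n : Fin d → ℕ) (t : EuclideanSpace ℝ (Fin d)) :
    ‖(hermiteFun n t : 𝕜)‖ ≤ 2 ^ d * seqWeight d n := by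
  rw [RCLike.norm_ofReal]
  exact abs_hermiteFun_le n t

theorem polyBounded_hermiteFun (t : EuclideanSpace ℝ (Fin d)) :
    PolyBounded fun n => (hermiteFun n t : 𝕜) :=
  ⟨2 ^ d, d, fun n => norm_hermiteFun_le n t⟩

theorem abs_sqrt_mul_hermiteFun_sub_le (n : Fin d → ℕ) (i : Fin d)
    (t : EuclideanSpace ℝ (Fin d)) :
    |√((n i : ℝ) / 2) * hermiteFun (n - Pi.single i 1) t| ≤ 2 ^ d * seqWeight (1 + d) n := by
  rw [abs_mul, abs_of_nonneg (Real.sqrt_nonneg _), seqWeight_add]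
  have h1 : √((n i : ℝ) / 2) ≤ seqWeight 1 n :=
    (Real.sqrt_le_sqrt (by linarith)).trans (sqrt_le_seqWeight_one n i)
  have h2 : seqWeight d (n - Pi.single i 1) ≤ seqWeight d n := by
    simp only [seqWeight_eq, idxNormSq]
    gcongr
    simp
  calc √((n i : ℝ) / 2) * |hermiteFun (n - Pi.single i 1) t|
      ≤ seqWeight 1 n * (2 ^ d * seqWeight d n) :=
        mul_le_mul h1 ((abs_hermiteFun_le _ t).trans (by gcongr)) (abs_nonneg _)
          (seqWeight_nonneg _ _)
    _ = _ := by ring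

theorem abs_sqrt_mul_hermiteFun_add_le (n : Fin d → ℕ) (i : Fin d)
    (t : EuclideanSpace ℝ (Fin d)) :
    |√(((n i : ℝ) + 1) / 2) * hermiteFun (n + Pi.single i 1) t| ≤
      4 ^ d * seqWeight (1 + d) n := by
  rw [abs_mul, abs_of_nonneg (Real.sqrt_nonneg _), seqWeight_add]
  calc √(((n i : ℝ) + 1) / 2) * |hermiteFun (n + Pi.single i 1) t|
      ≤ seqWeight 1 n * (2 ^ d * (2 ^ d * seqWeight d n)) :=
        mul_le_mul (sqrt_le_seqWeight_one n i) ((abs_hermiteFun_le _ t).trans (by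
          gcongr
          exact seqWeight_add_single_le d n i)) (abs_nonneg _) (seqWeight_nonneg _ _)
    _ = _ := by rw [show (4 : ℝ) = 2 * 2 by norm_num, mul_pow]; ring

theorem polyBounded_lower (i : Fin d) (t : EuclideanSpace ℝ (Fin d)) :
    PolyBounded fun n => ((√((n i : ℝ) / 2) * hermiteFun (n - Pi.single i 1) t : ℝ) : 𝕜) :=
  ⟨2 ^ d, 1 + d, fun n => by
    rw [RCLike.norm_ofReal]; exact abs_sqrt_mul_hermiteFun_sub_le n i t⟩

theorem polyBounded_raise (i : Fin d) (t : EuclideanSpace ℝ (Fin d)) :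
    PolyBounded fun n => ((√(((n i : ℝ) + 1) / 2) * hermiteFun (n + Pi.single i 1) t : ℝ) : 𝕜) :=
  ⟨4 ^ d, 1 + d, fun n => by
    rw [RCLike.norm_ofReal]; exact abs_sqrt_mul_hermiteFun_add_le n i t⟩

theorem injective_add_single (i : Fin d) :
    Function.Injective fun n : Fin d → ℕ => n + Pi.single i 1 := add_left_injective _

theorem mem_range_add_single {i : Fin d} {n : Fin d → ℕ} (h : n i ≠ 0) :
    n ∈ Set.range fun n : Fin d → ℕ => n + Pi.single i 1 := by
  refine ⟨n - Pi.single i 1, tsub_add_cancel_of_le fun k => ?_⟩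
  by_cases hk : k = i
  · subst hk; simpa using Nat.one_le_iff_ne_zero.2 h
  · simp [hk]

/-- Reindexing along n ↦ n + e_i moves the shift from the coefficients to the Hermite functions. The
indices missed have n_i = 0 and carry the factor √0. -/
theorem hermiteSeries_lower (i : Fin d) (x : RapidSeq 𝕜 d E) (t : EuclideanSpace ℝ (Fin d)) :
    hermiteSeries (RapidSeq.lower 𝕜 E i x) t =
      ∑' n, ((√((n i : ℝ) / 2) * hermiteFun (n - Pi.single i 1) t : ℝ) : 𝕜) • x n := by
  rw [← (injective_add_single i).tsum_eq]
  · refine tsum_congr fun n => ?_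
    rw [RapidSeq.lower_apply, smul_smul, add_tsub_cancel_right]
    simp
    rw [mul_comm]
  · intro n hn
    refine mem_range_add_single fun h0 => hn ?_
    simp [h0]

theorem hermiteSeries_raise (i : Fin d) (x : RapidSeq 𝕜 d E) (t : EuclideanSpace ℝ (Fin d)) :
    hermiteSeries (RapidSeq.raise 𝕜 E i x) t =
      ∑' n, ((√(((n i : ℝ) + 1) / 2) * hermiteFun (n + Pi.single i 1) t : ℝ) : 𝕜) • x n := by
  unfold hermiteSeries
  rw [← (injective_add_single i).tsum_eq]
  · refine tsum_congr fun n => ?_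
    rw [RapidSeq.raise_apply, smul_smul, add_tsub_cancel_right]
    simp
    rw [mul_comm]
  · intro n hn
    refine mem_range_add_single fun h0 => hn ?_
    simp [RapidSeq.raise_apply, h0]

theorem hermiteSeries_add (hE : ∀ u : ℕ → E, CauchySeq u → ∃ x, Tendsto u atTop (𝓝 x))
    (x y : RapidSeq 𝕜 d E) (t : EuclideanSpace ℝ (Fin d)) :
    hermiteSeries (x + y) t = hermiteSeries x t + hermiteSeries y t := by
  unfold hermiteSeries
  rw [← ((polyBounded_hermiteFun t).summable hE x).tsum_add
    ((polyBounded_hermiteFun t).summable hE y)]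
  simp only [RapidSeq.add_apply, smul_add]

theorem hermiteSeries_smul (hE : ∀ u : ℕ → E, CauchySeq u → ∃ x, Tendsto u atTop (𝓝 x))
    (c : 𝕜) (x : RapidSeq 𝕜 d E) (t : EuclideanSpace ℝ (Fin d)) :
    hermiteSeries (c • x) t = c • hermiteSeries x t := by
  unfold hermiteSeries
  rw [← ((polyBounded_hermiteFun t).summable hE x).tsum_const_smul c]
  simp only [RapidSeq.smul_apply, smul_comm c]

theorem hermiteSeries_sub (hE : ∀ u : ℕ → E, CauchySeq u → ∃ x, Tendsto u atTop (𝓝 x))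
    (x y : RapidSeq 𝕜 d E) (t : EuclideanSpace ℝ (Fin d)) :
    hermiteSeries (x - y) t = hermiteSeries x t - hermiteSeries y t := by
  rw [sub_eq_add_neg, hermiteSeries_add hE, ← neg_one_smul 𝕜 y, hermiteSeries_smul hE,
    neg_one_smul, ← sub_eq_add_neg]

theorem coord_smul_hermiteSeries
    (hE : ∀ u : ℕ → E, CauchySeq u → ∃ x, Tendsto u atTop (𝓝 x)) (i : Fin d)
    (x : RapidSeq 𝕜 d E) (t : EuclideanSpace ℝ (Fin d)) :
    ((t i : ℝ) : 𝕜) • hermiteSeries x t =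
      hermiteSeries (RapidSeq.lower 𝕜 E i x + RapidSeq.raise 𝕜 E i x) t := by
  rw [hermiteSeries_add hE, hermiteSeries_lower, hermiteSeries_raise,
    ← ((polyBounded_lower i t).summable hE x).tsum_add ((polyBounded_raise i t).summable hE x),
    hermiteSeries, ← ((polyBounded_hermiteFun t).summable hE x).tsum_const_smul]
  refine tsum_congr fun n => ?_
  rw [smul_smul, ← RCLike.ofReal_mul, coord_mul_hermiteFun, RCLike.ofReal_add, add_smul]

theorem continuous_hermiteSeries
    (hE : ∀ u : ℕ → E, CauchySeq u → ∃ x, Tendsto u atTop (𝓝 x)) (x : RapidSeq 𝕜 d E) :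
    Continuous (hermiteSeries x) := by
  refine continuous_iff_continuousAt.2 fun t => ?_
  refine tendsto_tsum_smul (b := fun n => 2 ^ d * seqWeight d n) hE (fun p hp => ?_) (fun n => ?_)
    (fun s n => norm_hermiteFun_le n s) (fun n => norm_hermiteFun_le n t)
  · simp only [mul_assoc]
    exact (x.summable_weight ⟨p, hp⟩ d).mul_left _
  · exact (RCLike.continuous_ofReal.comp (continuous_hermiteFun n)).continuousAt

theorem abs_lineDeriv_hermiteFun_le (n : Fin d → ℕ) (i : Fin d) (t : EuclideanSpace ℝ (Fin d)) :
    |√((n i : ℝ) / 2) * hermiteFun (n - Pi.single i 1) t -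
      √(((n i : ℝ) + 1) / 2) * hermiteFun (n + Pi.single i 1) t| ≤
      (2 ^ d + 4 ^ d) * seqWeight (1 + d) n := by
  rw [add_mul]
  exact (abs_sub _ _).trans
    (add_le_add (abs_sqrt_mul_hermiteFun_sub_le n i t) (abs_sqrt_mul_hermiteFun_add_le n i t))

/-- The mean value inequality dominates the difference quotients uniformly in h, with polynomial
growth in n, as termwise differentiation requires. -/
theorem abs_hermiteFun_sub_le (n : Fin d → ℕ) (i : Fin d) (t : EuclideanSpace ℝ (Fin d))
    (h : ℝ) : |hermiteFun n (t + h • EuclideanSpace.single i (1 : ℝ)) - hermiteFun n t| ≤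
      (2 ^ d + 4 ^ d) * seqWeight (1 + d) n * |h| := by
  have hd : ∀ s : ℝ, HasDerivAt
      (fun s : ℝ => hermiteFun n (t + s • EuclideanSpace.single i (1 : ℝ))) _ s := fun s => by
    have h1 := hasLineDerivAt_hermiteFun n i (t + s • EuclideanSpace.single i (1 : ℝ))
    have h2 := HasDerivAt.comp_sub_const s s (by rw [sub_self]; exact h1)
    refine h2.congr_of_eventuallyEq (Eventually.of_forall fun r => ?_)
    simp only [add_assoc, ← add_smul, add_sub_cancel]
  have := Convex.norm_image_sub_le_of_norm_hasDerivWithin_le (s := Set.univ) (x := (0 : ℝ))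
    (y := h) (fun s _ => (hd s).hasDerivWithinAt)
    (fun s _ => abs_lineDeriv_hermiteFun_le n i _) convex_univ (Set.mem_univ _) (Set.mem_univ _)
  simpa using this

theorem hasPartialDerivAt_hermiteSeries
    (hE : ∀ u : ℕ → E, CauchySeq u → ∃ x, Tendsto u atTop (𝓝 x)) (i : Fin d)
    (x : RapidSeq 𝕜 d E) (t : EuclideanSpace ℝ (Fin d)) :
    HasPartialDerivAt 𝕜 i (hermiteSeries x) t
      (hermiteSeries (RapidSeq.lower 𝕜 E i x - RapidSeq.raise 𝕜 E i x) t) := by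
  have e1 : ∀ h : ℝ, (h : 𝕜)⁻¹ • (hermiteSeries x (t + h • EuclideanSpace.single i (1 : ℝ)) -
      hermiteSeries x t) = ∑' n, ((h⁻¹ * (hermiteFun n (t + h • EuclideanSpace.single i (1 : ℝ)) -
        hermiteFun n t) : ℝ) : 𝕜) • x n := by
    intro h
    have s1 := (polyBounded_hermiteFun (𝕜 := 𝕜) (t + h • EuclideanSpace.single i (1 : ℝ))).summable
      hE x
    have s2 := (polyBounded_hermiteFun (𝕜 := 𝕜) t).summable hE x
    unfold hermiteSeries
    rw [← s1.tsum_sub s2, ← (s1.sub s2).tsum_const_smul]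
    refine tsum_congr fun n => ?_
    rw [← sub_smul, smul_smul, RCLike.ofReal_mul, RCLike.ofReal_sub, RCLike.ofReal_inv]
  have e2 : hermiteSeries (RapidSeq.lower 𝕜 E i x - RapidSeq.raise 𝕜 E i x) t =
      ∑' n, ((√((n i : ℝ) / 2) * hermiteFun (n - Pi.single i 1) t -
        √(((n i : ℝ) + 1) / 2) * hermiteFun (n + Pi.single i 1) t : ℝ) : 𝕜) • x n := by
    rw [hermiteSeries_sub hE, hermiteSeries_lower, hermiteSeries_raise,
      ← ((polyBounded_lower i t).summable hE x).tsum_sub ((polyBounded_raise i t).summable hE x)]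
    refine tsum_congr fun n => ?_
    rw [RCLike.ofReal_sub, sub_smul]
  unfold HasPartialDerivAt
  simp_rw [e1]
  rw [e2]
  refine tendsto_tsum_smul (b := fun n => (2 ^ d + 4 ^ d) * seqWeight (1 + d) n) hE
    (fun p hp => ?_) (fun n => ?_) (fun h n => ?_) (fun n => ?_)
  · simp only [mul_assoc]
    exact (x.summable_weight ⟨p, hp⟩ (1 + d)).mul_left _
  · refine (RCLike.continuous_ofReal.tendsto _).comp ?_
    have h1 := (hasLineDerivAt_hermiteFun n i t).tendsto_slope_zero
    simpa using h1
  · rw [RCLike.norm_ofReal, abs_mul, abs_inv]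
    -- The domination is demanded for every h, including h = 0, where the quotient is 0 by the
    -- convention for the inverse of 0.
    rcases eq_or_ne h 0 with rfl | h0
    · simpa using mul_nonneg (by positivity) (seqWeight_nonneg (1 + d) n)
    · rw [inv_mul_le_iff₀ (abs_pos.2 h0), mul_comm |h|]
      exact abs_hermiteFun_sub_le n i t h
  · rw [RCLike.norm_ofReal]
    exact abs_lineDeriv_hermiteFun_le n i t

variable (𝕜 E) in
/-- The operator on coefficients corresponding to `∂_i`. -/
def coeffDeriv (i : Fin d) : RapidSeq 𝕜 d E →L[𝕜] RapidSeq 𝕜 d E :=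
  RapidSeq.lower 𝕜 E i - RapidSeq.raise 𝕜 E i

variable (𝕜 E) in
/-- The operator on coefficients corresponding to the multiplication by `t_i`. -/
def coeffMul (i : Fin d) : RapidSeq 𝕜 d E →L[𝕜] RapidSeq 𝕜 d E :=
  RapidSeq.lower 𝕜 E i + RapidSeq.raise 𝕜 E i

theorem partialDeriv_hermiteSeries
    (hE : ∀ u : ℕ → E, CauchySeq u → ∃ x, Tendsto u atTop (𝓝 x)) (i : Fin d)
    (x : RapidSeq 𝕜 d E) :
    partialDeriv 𝕜 i (hermiteSeries x) = hermiteSeries (coeffDeriv 𝕜 E i x) :=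
  funext fun t => (hasPartialDerivAt_hermiteSeries hE i x t).partialDeriv_eq

theorem isCinf_hermiteSeries
    (hE : ∀ u : ℕ → E, CauchySeq u → ∃ x, Tendsto u atTop (𝓝 x)) (x : RapidSeq 𝕜 d E) :
    IsCinf 𝕜 (hermiteSeries x) := by
  intro k
  induction k generalizing x with
  | zero => exact continuous_hermiteSeries hE x
  | succ k ih =>
    refine ⟨fun i => ⟨fun t => ⟨_, hasPartialDerivAt_hermiteSeries hE i x t⟩, ?_⟩, fun i => ?_⟩
    · rw [partialDeriv_hermiteSeries hE]
      exact continuous_hermiteSeries hE _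
    · rw [partialDeriv_hermiteSeries hE]
      exact ih _

/-- Each ∂_i is a continuous operator on coefficients, so ∂^β is a composition of such operators.
Continuity is all that is used of it later. -/
theorem iterPartialDeriv_hermiteSeries
    (hE : ∀ u : ℕ → E, CauchySeq u → ∃ x, Tendsto u atTop (𝓝 x)) (β : Fin d → ℕ) :
    ∃ T : RapidSeq 𝕜 d E →L[𝕜] RapidSeq 𝕜 d E, ∀ x,
      iterPartialDeriv 𝕜 β (hermiteSeries x) = hermiteSeries (T x) := by
  have h1 : ∀ (i : Fin d) (m : ℕ) (x : RapidSeq 𝕜 d E),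
      (partialDeriv 𝕜 i)^[m] (hermiteSeries x) = hermiteSeries ((coeffDeriv 𝕜 E i ^ m) x) := by
    intro i m
    induction m with
    | zero => intro x; rfl
    | succ m ih =>
      intro x
      rw [Function.iterate_succ_apply, partialDeriv_hermiteSeries hE, ih, pow_succ]
      rfl
  unfold iterPartialDeriv
  induction List.finRange d with
  | nil => exact ⟨ContinuousLinearMap.id 𝕜 _, fun x => rfl⟩
  | cons i l ih =>
    obtain ⟨T, hT⟩ := ih
    refine ⟨(coeffDeriv 𝕜 E i ^ β i).comp T, fun x => ?_⟩
    rw [List.foldr_cons, hT, h1]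
    rfl

/-- The unweighted bound follows by summing the estimates for h_n. The weight is then moved onto the
coefficients: (1 + |t|²)^l times the series of x is the series of T^l x, where T corresponds to 1 +
∑ t_i². -/
theorem exists_seminorm_hermiteSeries_le
    (hE : ∀ u : ℕ → E, CauchySeq u → ∃ x, Tendsto u atTop (𝓝 x))
    (p : {p : Seminorm 𝕜 E // Continuous p}) (l : ℕ) :
    ∃ q : Seminorm 𝕜 (RapidSeq 𝕜 d E), Continuous q ∧
      ∀ x t, p.1 (hermiteSeries x t) * schwartzWeight l t ≤ q x := by
  have h0 : ∃ q : Seminorm 𝕜 (RapidSeq 𝕜 d E), Continuous q ∧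
      ∀ x t, p.1 (hermiteSeries x t) ≤ q x := by
    let C : ℝ := 2 ^ d * ∑' n : Fin d → ℕ, (seqWeight (2 * d) n)⁻¹
    have hC : 0 ≤ C := mul_nonneg (by positivity)
      (tsum_nonneg fun n => inv_nonneg.2 (seqWeight_nonneg _ _))
    refine ⟨C.toNNReal • RapidSeq.seminorm (d + 2 * d) p,
      (RapidSeq.continuous_seminorm _ p).const_smul C.toNNReal, fun x t => ?_⟩
    rw [_root_.smul_apply, NNReal.smul_def, Real.coe_toNNReal C hC, smul_eq_mul]
    have hs := (polyBounded_hermiteFun (𝕜 := 𝕜) t).summable_seminorm x p.1 p.2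
    calc p.1 (hermiteSeries x t) ≤ ∑' n, p.1 ((hermiteFun n t : 𝕜) • x n) :=
          ((polyBounded_hermiteFun t).summable hE x).hasSum.seminorm_le p.2 hs
      _ ≤ ∑' n, 2 ^ d * (seqWeight d n * p.1 (x n)) := by
          refine hs.tsum_le_tsum (fun n => ?_) ((x.summable_weight p d).mul_left _)
          rw [map_smul_eq_mul, ← mul_assoc]
          exact mul_le_mul_of_nonneg_right (norm_hermiteFun_le n t) (apply_nonneg _ _)
      _ = 2 ^ d * ∑' n, seqWeight d n * p.1 (x n) := tsum_mul_left
      _ ≤ 2 ^ d * (RapidSeq.seminorm (d + 2 * d) p x *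
            ∑' n : Fin d → ℕ, (seqWeight (2 * d) n)⁻¹) := by
          gcongr
          exact x.tsum_weight_le p d
      _ = C * RapidSeq.seminorm (d + 2 * d) p x := by simp only [C]; ring
  -- The doubled exponent makes the weight a polynomial in the coordinates.
  have h1 : ∃ q : Seminorm 𝕜 (RapidSeq 𝕜 d E), Continuous q ∧
      ∀ x t, p.1 (hermiteSeries x t) * schwartzWeight (2 * l) t ≤ q x := by
    let T : RapidSeq 𝕜 d E →L[𝕜] RapidSeq 𝕜 d E :=
      ContinuousLinearMap.id 𝕜 _ + ∑ i, (coeffMul 𝕜 E i).comp (coeffMul 𝕜 E i)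
    have hT : ∀ x t, hermiteSeries (T x) t = ((1 + ‖t‖ ^ 2 : ℝ) : 𝕜) • hermiteSeries x t := by
      intro x t
      have hs : ∀ s : Finset (Fin d), hermiteSeries
          (∑ i ∈ s, coeffMul 𝕜 E i (coeffMul 𝕜 E i x)) t =
          ((∑ i ∈ s, t i ^ 2 : ℝ) : 𝕜) • hermiteSeries x t := by
        intro s
        induction s using Finset.cons_induction with
        | empty => simp [hermiteSeries]
        | cons i s hi ih =>
          have h2 := coord_smul_hermiteSeries hE i (coeffMul 𝕜 E i x) t
          have h3 := coord_smul_hermiteSeries hE i x t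
          have h4 : hermiteSeries (coeffMul 𝕜 E i (coeffMul 𝕜 E i x)) t =
              ((t i : ℝ) : 𝕜) • hermiteSeries (coeffMul 𝕜 E i x) t := h2.symm
          have h5 : hermiteSeries (coeffMul 𝕜 E i x) t = ((t i : ℝ) : 𝕜) • hermiteSeries x t :=
            h3.symm
          rw [Finset.sum_cons, Finset.sum_cons, hermiteSeries_add hE, ih, h4, h5, smul_smul,
            ← add_smul, sq, RCLike.ofReal_add, RCLike.ofReal_mul]
      have e : T x = x + ∑ i, coeffMul 𝕜 E i (coeffMul 𝕜 E i x) := by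
        simp [T]
      rw [e, hermiteSeries_add hE, hs, RCLike.ofReal_add, add_smul, RCLike.ofReal_one, one_smul,
        EuclideanSpace.real_norm_sq_eq]
    have hTl : ∀ (l : ℕ) x t, hermiteSeries ((T ^ l) x) t =
        ((schwartzWeight (2 * l) t : ℝ) : 𝕜) • hermiteSeries x t := by
      intro l
      induction l with
      | zero => intro x t; simp [schwartzWeight_eq]
      | succ l ih =>
        intro x t
        have e : (T ^ (l + 1)) x = (T ^ l) (T x) := by rw [pow_succ]; rfl
        rw [e, ih, hT, smul_smul, ← RCLike.ofReal_mul, ← schwartzWeight_two, ← schwartzWeight_add]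
        rfl
    obtain ⟨q, hq, hle⟩ := h0
    refine ⟨q.comp (T ^ l : RapidSeq 𝕜 d E →L[𝕜] RapidSeq 𝕜 d E).toLinearMap,
      hq.comp (T ^ l : RapidSeq 𝕜 d E →L[𝕜] RapidSeq 𝕜 d E).continuous, fun x t => ?_⟩
    have h2 := hle ((T ^ l) x) t
    rw [hTl, map_smul_eq_mul, RCLike.norm_ofReal, abs_of_nonneg (schwartzWeight_nonneg _ _),
      mul_comm] at h2
    exact h2
  obtain ⟨q, hq, hle⟩ := h1
  exact ⟨q, hq, fun x t => le_trans (mul_le_mul_of_nonneg_left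
    (schwartzWeight_mono (by omega) t) (apply_nonneg _ _)) (hle x t)⟩

instance finite_multiIndex_le (l : ℕ) : Finite {β : Fin d → ℕ // ∑ i, β i ≤ l} := by
  refine Set.Finite.to_subtype (s := {β : Fin d → ℕ | ∑ i, β i ≤ l})
    ((Fintype.piFinset fun _ : Fin d => Finset.range (l + 1)).finite_toSet.subset ?_)
  intro β hβ
  simp only [Finset.mem_coe, Fintype.mem_piFinset, Finset.mem_range]
  intro i
  exact Nat.lt_succ_of_le ((Finset.single_le_sum (fun _ _ => Nat.zero_le _)
    (Finset.mem_univ i)).trans hβ)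

theorem exists_seminorm_iterPartialDeriv_hermiteSeries_le
    (hE : ∀ u : ℕ → E, CauchySeq u → ∃ x, Tendsto u atTop (𝓝 x))
    (p : {p : Seminorm 𝕜 E // Continuous p}) (l : ℕ) :
    ∃ q : Seminorm 𝕜 (RapidSeq 𝕜 d E), Continuous q ∧
      ∀ x (j : SchwartzIndex d l),
        p.1 (iterPartialDeriv 𝕜 j.2 (hermiteSeries x) j.1) * schwartzWeight l j.1 ≤ q x := by
  classical
  have := Fintype.ofFinite {β : Fin d → ℕ // ∑ i, β i ≤ l}
  obtain ⟨q, hq, hle⟩ := exists_seminorm_hermiteSeries_le (d := d) hE p l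
  choose T hT using fun β : Fin d → ℕ => iterPartialDeriv_hermiteSeries (𝕜 := 𝕜) hE β
  let Q : {β : Fin d → ℕ // ∑ i, β i ≤ l} → Seminorm 𝕜 (RapidSeq 𝕜 d E) :=
    fun β => q.comp (T β).toLinearMap
  refine ⟨Finset.univ.sup Q, Seminorm.continuous_finsetSup
    fun β _ => hq.comp (T β).continuous, fun x j => ?_⟩
  rw [hT]
  exact (hle _ _).trans (Seminorm.le_finset_sup_apply (p := Q) (Finset.mem_univ j.2))

end HermiteSeries

/-! ### Functionals applied to vector-valued Schwartz functions -/

section Weak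

variable {𝕜 : Type*} [RCLike 𝕜] {d : ℕ} {E : Type*} [AddCommGroup E] [Module 𝕜 E]
  [TopologicalSpace E]

theorem HasPartialDerivAt.hasLineDerivAt_comp {i : Fin d} {f : EuclideanSpace ℝ (Fin d) → E}
    {x : EuclideanSpace ℝ (Fin d)} {v : E} (h : HasPartialDerivAt 𝕜 i f x v) (φ : E →L[𝕜] 𝕜) :
    HasLineDerivAt ℝ (fun x => φ (f x)) (φ v) x (EuclideanSpace.single i (1 : ℝ)) := by
  rw [HasLineDerivAt, hasDerivAt_iff_tendsto_slope_zero]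
  refine ((φ.continuous.tendsto _).comp h).congr fun t => ?_
  simp only [Function.comp_apply, zero_add, zero_smul, add_zero, map_smul, map_sub]
  rw [RCLike.real_smul_eq_coe_mul, RCLike.ofReal_inv, smul_eq_mul]

/-- The seminorm `|φ|`. -/
def dualSeminorm (φ : E →L[𝕜] 𝕜) : {p : Seminorm 𝕜 E // Continuous p} :=
  ⟨(normSeminorm 𝕜 𝕜).comp φ.toLinearMap, φ.continuous.norm⟩

theorem iterPartialDeriv_single (i : Fin d) (b : ℕ) (f : EuclideanSpace ℝ (Fin d) → E) :
    iterPartialDeriv 𝕜 (Pi.single i b) f = (partialDeriv 𝕜 i)^[b] f := by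
  have key : ∀ l : List (Fin d), l.Nodup →
      l.foldr (fun k g => (partialDeriv 𝕜 k)^[(Pi.single i b : Fin d → ℕ) k] g) f =
        if i ∈ l then (partialDeriv 𝕜 i)^[b] f else f := by
    intro l hl
    induction l with
    | nil => simp
    | cons k l ih =>
      rw [List.nodup_cons] at hl
      rw [List.foldr_cons, ih hl.2]
      by_cases hk : k = i
      · subst hk
        simp [hl.1]
      · have : i ≠ k := fun h => hk h.symm
        simp [hk, this]
  rw [iterPartialDeriv, key _ (List.nodup_finRange d), if_pos (List.mem_finRange i)]

variable [IsTopologicalAddGroup E] [ContinuousSMul 𝕜 E] [T2Space E]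

namespace SchwartzFun

@[ext]
theorem ext {f g : SchwartzFun 𝕜 d E} (h : ∀ x, f x = g x) : f = g := DFunLike.ext _ _ h

/-- The seminorm `sup_{x, |β| ≤ l} p (∂^β f x) (1 + |x|²)^{l/2}`. -/
abbrev seminorm (l : ℕ) (p : {p : Seminorm 𝕜 E // Continuous p}) :
    Seminorm 𝕜 (SchwartzFun 𝕜 d E) := schwartzSeminorms 𝕜 d E (l, p)

theorem continuous_seminorm (l : ℕ) (p : {p : Seminorm 𝕜 E // Continuous p}) :
    Continuous (seminorm (d := d) l p) :=
  (schwartzFun_withSeminorms 𝕜 d E).continuous_seminorm (l, p)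

theorem le_seminorm (f : SchwartzFun 𝕜 d E) (l : ℕ) (p : {p : Seminorm 𝕜 E // Continuous p})
    (j : SchwartzIndex d l) :
    p.1 (iterPartialDeriv 𝕜 j.2 f j.1) * schwartzWeight l j.1 ≤ seminorm l p f :=
  le_ciSup (f.bddAbove p.1 p.2 l) j

theorem seminorm_le (f : SchwartzFun 𝕜 d E) (l : ℕ) (p : {p : Seminorm 𝕜 E // Continuous p})
    {C : ℝ} (h : ∀ j : SchwartzIndex d l,
      p.1 (iterPartialDeriv 𝕜 j.2 f j.1) * schwartzWeight l j.1 ≤ C) : seminorm l p f ≤ C :=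
  ciSup_le h

theorem seminorm_mono (f : SchwartzFun 𝕜 d E) (p : {p : Seminorm 𝕜 E // Continuous p}) :
    Monotone fun l => seminorm l p f := fun l m hlm =>
  seminorm_le f l p fun j => le_trans
    (mul_le_mul_of_nonneg_left (schwartzWeight_mono hlm _) (apply_nonneg _ _))
    (le_seminorm f m p (j.1, ⟨j.2.1, j.2.2.trans hlm⟩))

theorem continuous_of_bound {V : Type*} [AddCommGroup V] [Module 𝕜 V] [TopologicalSpace V]
    [IsTopologicalAddGroup V] (L : V →ₗ[𝕜] SchwartzFun 𝕜 d E)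
    (h : ∀ (p : {p : Seminorm 𝕜 E // Continuous p}) (l : ℕ), ∃ q : Seminorm 𝕜 V, Continuous q ∧
      ∀ v (j : SchwartzIndex d l),
        p.1 (iterPartialDeriv 𝕜 j.2 (L v) j.1) * schwartzWeight l j.1 ≤ q v) : Continuous L := by
  refine (schwartzFun_withSeminorms 𝕜 d E).continuous_of_continuous_comp L ?_
  rintro ⟨l, p⟩
  obtain ⟨q, hq, hle⟩ := h p l
  exact Seminorm.continuous_of_le hq fun v => seminorm_le _ _ _ (hle v)

theorem iterate_le_seminorm (f : SchwartzFun 𝕜 d E) (p : {p : Seminorm 𝕜 E // Continuous p})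
    (i : Fin d) {b l : ℕ} (hb : b ≤ l) (x : EuclideanSpace ℝ (Fin d)) :
    p.1 ((partialDeriv 𝕜 i)^[b] f x) * schwartzWeight l x ≤ seminorm l p f := by
  have h := le_seminorm f l p (x, ⟨Pi.single i b, by simpa using hb⟩)
  rwa [iterPartialDeriv_single] at h

theorem le_seminorm_zero (f : SchwartzFun 𝕜 d E) (p : {p : Seminorm 𝕜 E // Continuous p})
    (l : ℕ) (x : EuclideanSpace ℝ (Fin d)) :
    p.1 (f x) * schwartzWeight l x ≤ seminorm l p f := by
  have h := le_seminorm f l p (x, ⟨0, by simp⟩)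
  rwa [iterPartialDeriv_zero] at h

theorem isCinf_iterate (f : SchwartzFun 𝕜 d E) (i : Fin d) (b : ℕ) :
    IsCinf 𝕜 ((partialDeriv 𝕜 i)^[b] f) :=
  (iterate_partialDeriv_props i b).1 f f.isCinf

theorem hasLineDerivAt_iterate (f : SchwartzFun 𝕜 d E) (φ : E →L[𝕜] 𝕜) (i : Fin d) (b : ℕ)
    (x : EuclideanSpace ℝ (Fin d)) :
    HasLineDerivAt ℝ (fun x => φ ((partialDeriv 𝕜 i)^[b] f x))
      (φ ((partialDeriv 𝕜 i)^[b + 1] f x)) x (EuclideanSpace.single i (1 : ℝ)) := by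
  rw [Function.iterate_succ_apply']
  exact ((f.isCinf_iterate i b).isC1.hasPartialDerivAt i x).hasLineDerivAt_comp φ

theorem rapidDecay_comp (f : SchwartzFun 𝕜 d E) (φ : E →L[𝕜] 𝕜) :
    RapidDecay fun x => φ (f x) :=
  ⟨φ.continuous.comp f.isCinf.continuous, fun k =>
    ⟨seminorm k (dualSeminorm φ) f, f.le_seminorm_zero (dualSeminorm φ) k⟩⟩

end SchwartzFun

end Weak

/-! ### Lipschitz estimates from bounded partial derivatives -/

section Lipschitz

variable {d : ℕ} {W : Type*} [NormedAddCommGroup W] [NormedSpace ℝ W]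

theorem norm_sub_le_of_hasLineDerivAt {g : EuclideanSpace ℝ (Fin d) → W} {K : ℝ} {i : Fin d}
    {g' : EuclideanSpace ℝ (Fin d) → W}
    (hg : ∀ x, HasLineDerivAt ℝ g (g' x) x (EuclideanSpace.single i (1 : ℝ)))
    (hK : ∀ x, ‖g' x‖ ≤ K) (x : EuclideanSpace ℝ (Fin d)) (h : ℝ) :
    ‖g (x + h • EuclideanSpace.single i (1 : ℝ)) - g x‖ ≤ K * |h| := by
  have hd : ∀ s : ℝ, HasDerivAt
      (fun s : ℝ => g (x + s • EuclideanSpace.single i (1 : ℝ)))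
      (g' (x + s • EuclideanSpace.single i (1 : ℝ))) s := fun s => by
    have h1 := hg (x + s • EuclideanSpace.single i (1 : ℝ))
    have h2 := HasDerivAt.comp_sub_const s s (by rw [sub_self]; exact h1)
    refine h2.congr_of_eventuallyEq (Eventually.of_forall fun r => ?_)
    simp only [add_assoc, ← add_smul, add_sub_cancel]
  have := Convex.norm_image_sub_le_of_norm_hasDerivWithin_le (s := Set.univ) (x := (0 : ℝ))
    (y := h) (fun s _ => (hd s).hasDerivWithinAt)
    (fun s _ => hK _) convex_univ (Set.mem_univ _) (Set.mem_univ _)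
  simpa using this

/-- Go from x to y parallel to the axes, one coordinate at a time; only bounded partial derivatives
are needed. -/
theorem norm_sub_le_of_forall_hasLineDerivAt {g : EuclideanSpace ℝ (Fin d) → W} {K : ℝ}
    {g' : Fin d → EuclideanSpace ℝ (Fin d) → W}
    (hg : ∀ i x, HasLineDerivAt ℝ g (g' i x) x (EuclideanSpace.single i (1 : ℝ)))
    (hK : ∀ i x, ‖g' i x‖ ≤ K) (x y : EuclideanSpace ℝ (Fin d)) :
    ‖g y - g x‖ ≤ d * K * ‖y - x‖ := by
  have key : ∀ s : Finset (Fin d),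
      ‖g (x + ∑ i ∈ s, (y i - x i) • EuclideanSpace.single i (1 : ℝ)) - g x‖ ≤
        s.card * (K * ‖y - x‖) := by
    intro s
    induction s using Finset.cons_induction with
    | empty => simp
    | cons i s hi ih =>
      have hK0 : 0 ≤ K := (norm_nonneg _).trans (hK i 0)
      have h1 := norm_sub_le_of_hasLineDerivAt (hg i) (hK i)
        (x + ∑ i ∈ s, (y i - x i) • EuclideanSpace.single i (1 : ℝ)) (y i - x i)
      have h2 : |y i - x i| ≤ ‖y - x‖ := abs_coord_le (y - x) i
      rw [Finset.sum_cons, add_comm ((y i - x i) • _), ← add_assoc, Finset.card_cons]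
      push_cast
      have h3 := norm_sub_le_norm_sub_add_norm_sub
        (g (x + ∑ i ∈ s, (y i - x i) • EuclideanSpace.single i (1 : ℝ) +
          (y i - x i) • EuclideanSpace.single i (1 : ℝ)))
        (g (x + ∑ i ∈ s, (y i - x i) • EuclideanSpace.single i (1 : ℝ))) (g x)
      have h4 := mul_le_mul_of_nonneg_left h2 hK0
      linarith
  have h := key Finset.univ
  have e : x + ∑ i, (y i - x i) • EuclideanSpace.single i (1 : ℝ) = y := by
    ext k
    simp [Finset.sum_apply, Pi.single_apply]
  rwa [e, Finset.card_univ, Fintype.card_fin, ← mul_assoc] at h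

end Lipschitz

/-! ### Pettis integrability -/

section PettisExistence

variable {𝕜 : Type*} [RCLike 𝕜] {d : ℕ}

theorem hermiteSeries_single (n : Fin d → ℕ) {E : Type*} [AddCommGroup E] [Module 𝕜 E]
    [UniformSpace E] [IsUniformAddGroup E] [ContinuousSMul 𝕜 E] [PolynormableSpace 𝕜 E]
    [T2Space E] (e : E) (t : EuclideanSpace ℝ (Fin d)) :
    hermiteSeries (𝕜 := 𝕜) (RapidSeq.single n e) t = (hermiteFun n t : 𝕜) • e := by
  unfold hermiteSeries
  rw [tsum_eq_single n]
  · simp [RapidSeq.single_apply]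
  · intro m hm
    simp [RapidSeq.single_apply, hm]

/-- h_n is the scalar Hermite series of a single unit entry, so its decay is a case of the weighted
estimate for series. -/
theorem rapidDecay_hermiteFun (n : Fin d → ℕ) :
    RapidDecay (hermiteFun n : EuclideanSpace ℝ (Fin d) → ℝ) := by
  refine ⟨continuous_hermiteFun n, fun k => ?_⟩
  obtain ⟨q, -, hq⟩ := exists_seminorm_hermiteSeries_le (𝕜 := ℝ) (E := ℝ) (d := d)
    (fun u hu => cauchySeq_tendsto_of_complete hu) (absSeminorm ℝ) k
  refine ⟨q (RapidSeq.single n 1), fun x => ?_⟩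
  have h := hq (RapidSeq.single n 1) x
  rw [hermiteSeries_single] at h
  simpa [absSeminorm] using h

/-- Simple functions converging pointwise to the identity. -/
def approxId (d k : ℕ) : SimpleFunc (EuclideanSpace ℝ (Fin d)) (EuclideanSpace ℝ (Fin d)) :=
  SimpleFunc.approxOn id measurable_id Set.univ 0 (Set.mem_univ 0) k

theorem tendsto_approxId (x : EuclideanSpace ℝ (Fin d)) :
    Tendsto (fun k => approxId d k x) atTop (𝓝 x) :=
  SimpleFunc.tendsto_approxOn measurable_id (Set.mem_univ 0) (by simp)

theorem norm_approxId_sub_le (k : ℕ) (x : EuclideanSpace ℝ (Fin d)) :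
    ‖approxId d k x - x‖ ≤ 3 * ‖x‖ := by
  have h := SimpleFunc.norm_approxOn_zero_le (f := fun x : EuclideanSpace ℝ (Fin d) => x)
    measurable_id (s := Set.univ) (Set.mem_univ 0) x k
  have h2 := norm_sub_le (approxId d k x) x
  have h3 : ‖approxId d k x‖ ≤ ‖x‖ + ‖x‖ := h
  linarith

/-- The error of the approximation by simple functions, weighted with `|h_n|`. -/
def approxError (n : Fin d → ℕ) (k : ℕ) : ℝ :=
  ∫ x, ‖approxId d k x - x‖ * |hermiteFun n x|

theorem measurable_approxId_sub (k : ℕ) :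
    Measurable fun x => ‖approxId d k x - x‖ :=
  ((approxId d k).measurable.sub measurable_id).norm

theorem integrable_norm_mul_hermiteFun (n : Fin d → ℕ) :
    Integrable fun x : EuclideanSpace ℝ (Fin d) => 3 * ‖x‖ * |hermiteFun n x| := by
  have h := ((rapidDecay_hermiteFun n).smul (𝕜 := ℝ) (g := fun x => ‖x‖) (by fun_prop) 1
    (B := 1) fun x => by
      rw [norm_norm, one_mul]; exact norm_le_schwartzWeight x).integrable.norm.const_mul 3
  refine h.congr (Eventually.of_forall fun x => ?_)
  simp only [norm_smul, Real.norm_eq_abs, abs_norm]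
  ring

theorem integrable_approxError (n : Fin d → ℕ) (k : ℕ) :
    Integrable fun x => ‖approxId d k x - x‖ * |hermiteFun n x| := by
  refine (integrable_norm_mul_hermiteFun n).mono'
    ((measurable_approxId_sub k).mul (continuous_hermiteFun n).abs.measurable).aestronglyMeasurable
    (Eventually.of_forall fun x => ?_)
  rw [Real.norm_eq_abs, abs_of_nonneg (by positivity)]
  exact mul_le_mul_of_nonneg_right (norm_approxId_sub_le k x) (abs_nonneg _)

theorem tendsto_approxError (n : Fin d → ℕ) : Tendsto (approxError n) atTop (𝓝 0) := by
  have h := tendsto_integral_of_dominated_convergence (μ := volume)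
    (F := fun k x => ‖approxId d k x - x‖ * |hermiteFun n x|) (f := fun _ => 0)
    (fun x => 3 * ‖x‖ * |hermiteFun n x|)
    (fun k => (integrable_approxError n k).aestronglyMeasurable)
    (integrable_norm_mul_hermiteFun n) (fun k => Eventually.of_forall fun x => ?_)
    (Eventually.of_forall fun x => ?_)
  · rw [integral_zero] at h
    exact h
  · rw [Real.norm_eq_abs, abs_of_nonneg (by positivity)]
    exact mul_le_mul_of_nonneg_right (norm_approxId_sub_le k x) (abs_nonneg _)
  · have h1 := ((tendsto_approxId x).sub_const x).norm.mul_const |hermiteFun n x|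
    simpa using h1

variable {E : Type*} [AddCommGroup E] [Module 𝕜 E]
    [UniformSpace E] [IsUniformAddGroup E] [ContinuousSMul 𝕜 E] [PolynormableSpace 𝕜 E]
    [T2Space E]

/-- The integral of `h_n` against `f ∘ σ_k`, where `σ_k` is the `k`-th simple approximation of the
identity. -/
def approxCoeff (f : SchwartzFun 𝕜 d E) (n : Fin d → ℕ) (k : ℕ) : E :=
  ∑ y ∈ (approxId d k).range, ((∫ x in approxId d k ⁻¹' {y}, hermiteFun n x : ℝ) : 𝕜) • f y

theorem apply_approxCoeff (f : SchwartzFun 𝕜 d E) (n : Fin d → ℕ) (k : ℕ) (φ : E →L[𝕜] 𝕜) :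
    Integrable (fun x => (hermiteFun n x : 𝕜) * φ (f (approxId d k x))) ∧
    φ (approxCoeff f n k) = ∫ x, (hermiteFun n x : 𝕜) * φ (f (approxId d k x)) := by
  have hi : Integrable fun x : EuclideanSpace ℝ (Fin d) => (hermiteFun n x : 𝕜) :=
    (rapidDecay_hermiteFun n).integrable.ofReal
  have e : ∀ x, (hermiteFun n x : 𝕜) * φ (f (approxId d k x)) =
      ∑ y ∈ (approxId d k).range, (approxId d k ⁻¹' {y}).indicator
        (fun x => (hermiteFun n x : 𝕜) * φ (f y)) x := by
    intro x
    rw [Finset.sum_eq_single (approxId d k x)]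
    · rw [Set.indicator_of_mem (by simp)]
    · intro y _ hy
      exact Set.indicator_of_notMem (fun h => hy h.symm) _
    · intro h
      exact absurd (SimpleFunc.mem_range_self _ x) h
  have hI : ∀ y, Integrable ((approxId d k ⁻¹' {y}).indicator
      (fun x => (hermiteFun n x : 𝕜) * φ (f y))) := fun y =>
    (hi.mul_const _).indicator ((approxId d k).measurableSet_fiber y)
  simp_rw [e]
  refine ⟨integrable_finsetSum _ fun y _ => hI y, ?_⟩
  rw [integral_finsetSum _ fun y _ => hI y, approxCoeff, map_sum]
  refine Finset.sum_congr rfl fun y _ => ?_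
  rw [map_smul, integral_indicator ((approxId d k).measurableSet_fiber y), integral_mul_const,
    integral_ofReal, smul_eq_mul]

/-- φ ∘ f is Lipschitz with a constant depending on φ only through p. The error bound is therefore
uniform over all functionals dominated by p. -/
theorem norm_apply_approxCoeff_sub_le (f : SchwartzFun 𝕜 d E) (n : Fin d → ℕ) (k : ℕ)
    (p : {p : Seminorm 𝕜 E // Continuous p}) (φ : E →L[𝕜] 𝕜) (hφ : ∀ y, ‖φ y‖ ≤ p.1 y) :
    ‖φ (approxCoeff f n k) - ∫ x, (hermiteFun n x : 𝕜) * φ (f x)‖ ≤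
      d * SchwartzFun.seminorm 1 p f * approxError n k := by
  have hlip := norm_sub_le_of_forall_hasLineDerivAt
    (g := fun x => φ (f x)) (K := SchwartzFun.seminorm 1 p f)
    (fun i x => f.hasLineDerivAt_iterate φ i 0 x) (fun i x => (hφ _).trans
      ((le_mul_of_one_le_right (apply_nonneg _ _) (one_le_schwartzWeight 1 x)).trans
        (f.iterate_le_seminorm p i le_rfl x)))
  obtain ⟨hi, he⟩ := apply_approxCoeff f n k φ
  have hi2 : Integrable fun x => (hermiteFun n x : 𝕜) * φ (f x) := by
    simpa only [smul_eq_mul] using ((f.rapidDecay_comp φ).hermiteFun_smul (𝕜 := 𝕜) n).integrable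
  rw [he, ← integral_sub hi hi2, approxError, ← integral_const_mul]
  refine norm_integral_le_of_norm_le ((integrable_approxError n k).const_mul _)
    (Eventually.of_forall fun x => ?_)
  rw [← mul_sub, norm_mul, RCLike.norm_ofReal]
  calc |hermiteFun n x| * ‖φ (f (approxId d k x)) - φ (f x)‖
      ≤ |hermiteFun n x| * (d * SchwartzFun.seminorm 1 p f * ‖approxId d k x - x‖) := by
        gcongr
        exact hlip x _
    _ = _ := by ring

/-- Any two approximations are compared through the scalar integral of φ ∘ f. Uniformity in φ makes
them a Cauchy sequence in E, and the limit has the required values under every functional. -/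
theorem pettisIntegrable_hermiteFun_smul
    (hE : ∀ u : ℕ → E, CauchySeq u → ∃ x, Tendsto u atTop (𝓝 x))
    (f : SchwartzFun 𝕜 d E) (n : Fin d → ℕ) :
    PettisIntegrable 𝕜 volume (fun x => (hermiteFun n x : 𝕜) • f x) := by
  obtain ⟨e, he⟩ := hE (approxCoeff f n) (cauchySeq_of_seminorm_le (𝕜 := 𝕜) fun p hp => by
    refine ⟨fun k => d * SchwartzFun.seminorm 1 ⟨p, hp⟩ f * approxError n k, ?_, fun k m => ?_⟩
    · simpa using (tendsto_approxError n).const_mul (d * SchwartzFun.seminorm 1 ⟨p, hp⟩ f)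
    · refine seminorm_le_of_dual_le hp _ fun φ hφ => ?_
      have h1 := norm_apply_approxCoeff_sub_le f n k ⟨p, hp⟩ φ hφ
      have h2 := norm_apply_approxCoeff_sub_le f n m ⟨p, hp⟩ φ hφ
      rw [map_sub, ← sub_sub_sub_cancel_right _ _ (∫ x, (hermiteFun n x : 𝕜) * φ (f x))]
      exact (norm_sub_le _ _).trans (add_le_add h1 h2))
  refine ⟨e, fun φ => ⟨?_, ?_⟩⟩
  · simp only [map_smul]
    exact ((f.rapidDecay_comp φ).hermiteFun_smul n).integrable
  · simp only [map_smul, smul_eq_mul]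
    refine tendsto_nhds_unique ((φ.continuous.tendsto _).comp he) ?_
    rw [tendsto_iff_norm_sub_tendsto_zero]
    refine squeeze_zero (fun _ => norm_nonneg _) (fun k =>
      norm_apply_approxCoeff_sub_le f n k (dualSeminorm φ) φ fun y => le_rfl) ?_
    simpa using (tendsto_approxError n).const_mul (d * SchwartzFun.seminorm 1 (dualSeminorm φ) f)

theorem HasPettisIntegral.unique {X : Type*} [MeasurableSpace X] {μ : Measure X} {g : X → E}
    {e e' : E} (h : HasPettisIntegral 𝕜 μ g e) (h' : HasPettisIntegral 𝕜 μ g e') : e = e' :=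
  eq_of_forall_dual_eq (𝕜 := 𝕜) fun φ => (h φ).2.trans (h' φ).2.symm

theorem hasPettisIntegral_hermiteCoeff
    (hE : ∀ u : ℕ → E, CauchySeq u → ∃ x, Tendsto u atTop (𝓝 x))
    (f : SchwartzFun 𝕜 d E) (n : Fin d → ℕ) :
    HasPettisIntegral 𝕜 volume (fun x => (hermiteFun n x : 𝕜) • f x) (hermiteCoeff f n) := by
  have h := pettisIntegrable_hermiteFun_smul hE f n
  rw [hermiteCoeff, pettisIntegral, dif_pos h]
  exact h.choose_spec

theorem apply_hermiteCoeff
    (hE : ∀ u : ℕ → E, CauchySeq u → ∃ x, Tendsto u atTop (𝓝 x))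
    (f : SchwartzFun 𝕜 d E) (n : Fin d → ℕ) (φ : E →L[𝕜] 𝕜) :
    φ (hermiteCoeff f n) = ∫ x, (hermiteFun n x : 𝕜) • φ (f x) := by
  rw [(hasPettisIntegral_hermiteCoeff hE f n φ).2]
  simp only [map_smul]

end PettisExistence

/-! ### Decay of the Hermite coefficients -/

section Decay

variable {d : ℕ} {W : Type*} [NormedAddCommGroup W] [NormedSpace ℝ W]

theorem RapidDecay.hermiteFun_real_smul {φ : EuclideanSpace ℝ (Fin d) → W} (h : RapidDecay φ)
    (n : Fin d → ℕ) : RapidDecay fun x => hermiteFun n x • φ x :=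
  h.hermiteFun_smul (𝕜 := ℝ) n

theorem RapidDecay.pow_smul {φ : EuclideanSpace ℝ (Fin d) → W} (h : RapidDecay φ)
    (i : Fin d) (a : ℕ) : RapidDecay fun x => (x i) ^ a • φ x :=
  h.smul (𝕜 := ℝ) (by fun_prop) a (B := 1) fun x => by
    rw [norm_pow, one_mul, schwartzWeight_eq]
    have h1 := (abs_coord_le x i).trans (norm_le_schwartzWeight x)
    rw [schwartzWeight_eq, pow_one] at h1
    exact pow_le_pow_left₀ (norm_nonneg _) h1 a

theorem integral_coord_smul_hermiteFun {ψ : EuclideanSpace ℝ (Fin d) → W} (hψ : RapidDecay ψ)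
    (i : Fin d) (n : Fin d → ℕ) :
    ∫ x, hermiteFun n x • (x i • ψ x) =
      √((n i : ℝ) / 2) • (∫ x, hermiteFun (n - Pi.single i 1) x • ψ x) +
        √(((n i : ℝ) + 1) / 2) • (∫ x, hermiteFun (n + Pi.single i 1) x • ψ x) := by
  rw [← integral_smul, ← integral_smul, ← integral_add]
  · congr 1
    ext x
    rw [smul_smul, mul_comm, coord_mul_hermiteFun, add_smul, mul_smul, mul_smul]
  · exact (hψ.hermiteFun_real_smul _).integrable.smul _
  · exact (hψ.hermiteFun_real_smul _).integrable.smul _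

/-- Integration by parts puts the derivative on h_n, where the ladder formula applies; hence the
signs opposite to those for h_n'. -/
theorem integral_lineDeriv_smul_hermiteFun {ψ ψ' : EuclideanSpace ℝ (Fin d) → W}
    (hψ : RapidDecay ψ) (hψ' : RapidDecay ψ') (i : Fin d)
    (hd : ∀ x, HasLineDerivAt ℝ ψ (ψ' x) x (EuclideanSpace.single i (1 : ℝ))) (n : Fin d → ℕ) :
    ∫ x, hermiteFun n x • ψ' x =
      √(((n i : ℝ) + 1) / 2) • (∫ x, hermiteFun (n + Pi.single i 1) x • ψ x) -
        √((n i : ℝ) / 2) • (∫ x, hermiteFun (n - Pi.single i 1) x • ψ x) := by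
  have i1 := (hψ.hermiteFun_real_smul (n - Pi.single i 1)).integrable.smul √((n i : ℝ) / 2)
  have i2 := (hψ.hermiteFun_real_smul (n + Pi.single i 1)).integrable.smul √(((n i : ℝ) + 1) / 2)
  have e : ∀ x, (√((n i : ℝ) / 2) * hermiteFun (n - Pi.single i 1) x -
      √(((n i : ℝ) + 1) / 2) * hermiteFun (n + Pi.single i 1) x) • ψ x =
      √((n i : ℝ) / 2) • (hermiteFun (n - Pi.single i 1) x • ψ x) -
      √(((n i : ℝ) + 1) / 2) • (hermiteFun (n + Pi.single i 1) x • ψ x) := fun x => by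
    rw [sub_smul, mul_smul, mul_smul]
  have h := integral_bilinear_hasLineDerivAt_right_eq_neg_left_of_integrable (μ := volume)
    (f := hermiteFun n) (g := ψ) (g' := ψ') (B := ContinuousLinearMap.lsmul ℝ ℝ)
    (v := EuclideanSpace.single i (1 : ℝ))
    (f' := fun x => √((n i : ℝ) / 2) * hermiteFun (n - Pi.single i 1) x -
      √(((n i : ℝ) + 1) / 2) * hermiteFun (n + Pi.single i 1) x)
    (by
      simp only [ContinuousLinearMap.lsmul_apply, e]
      exact i1.sub i2)
    (hψ'.hermiteFun_real_smul n).integrable (hψ.hermiteFun_real_smul n).integrable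
    (fun x _ => hasLineDerivAt_hermiteFun n i x) (fun x _ => hd x)
  simp only [ContinuousLinearMap.lsmul_apply, e] at h
  rw [h, integral_sub, integral_smul, integral_smul, neg_sub]
  · exact i1
  · exact i2

/-- A sequence of successive derivatives in direction `e_i`, with bounds. -/
structure DirectionalBounds (i : Fin d) (g : ℕ → EuclideanSpace ℝ (Fin d) → W) (N : ℕ → ℝ) :
    Prop where
  continuous : ∀ b, Continuous (g b)
  deriv : ∀ b x, HasLineDerivAt ℝ (g b) (g (b + 1) x) x (EuclideanSpace.single i (1 : ℝ))
  bound : ∀ b l, b ≤ l → ∀ x, ‖g b x‖ * schwartzWeight l x ≤ N l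
  mono : Monotone N

/-- The integral of `h_n` against `x_i^a g_b`. -/
def monomialCoeff (i : Fin d) (g : ℕ → EuclideanSpace ℝ (Fin d) → W) (a b : ℕ)
    (n : Fin d → ℕ) : W :=
  ∫ x, hermiteFun n x • (x i ^ a • g b x)

namespace DirectionalBounds

variable {i : Fin d} {g : ℕ → EuclideanSpace ℝ (Fin d) → W} {N : ℕ → ℝ}

theorem rapidDecay (h : DirectionalBounds i g N) (b : ℕ) : RapidDecay (g b) :=
  ⟨h.continuous b, fun k => ⟨N (max b k), fun x => le_trans
    (mul_le_mul_of_nonneg_left (schwartzWeight_mono (le_max_right _ _) x) (norm_nonneg _))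
    (h.bound b _ (le_max_left _ _) x)⟩⟩

theorem hasLineDerivAt_pow_smul (h : DirectionalBounds i g N) (a b : ℕ)
    (x : EuclideanSpace ℝ (Fin d)) :
    HasLineDerivAt ℝ (fun x => x i ^ a • g b x)
      ((a : ℝ) • (x i ^ (a - 1) • g b x) + x i ^ a • g (b + 1) x) x
      (EuclideanSpace.single i (1 : ℝ)) := by
  have h1 : HasDerivAt (fun t : ℝ => ((x + t • EuclideanSpace.single i (1 : ℝ)) i) ^ a)
      (a * x i ^ (a - 1)) 0 := by
    have h2 : HasDerivAt (fun t : ℝ => (x i + t) ^ a) (a * x i ^ (a - 1)) 0 := by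
      simpa using ((hasDerivAt_id (0 : ℝ)).const_add (x i)).fun_pow a
    simpa using h2
  have h3 := HasDerivAt.fun_smul h1 (h.deriv b x)
  refine h3.congr_deriv ?_
  simp only [zero_smul, add_zero]
  rw [add_comm, smul_smul]

theorem integral_deriv_smul (h : DirectionalBounds i g N) (a b : ℕ) (n : Fin d → ℕ) :
    ∫ x, hermiteFun n x • ((a : ℝ) • (x i ^ (a - 1) • g b x) + x i ^ a • g (b + 1) x) =
      (a : ℝ) • monomialCoeff i g (a - 1) b n + monomialCoeff i g a (b + 1) n := by
  simp only [monomialCoeff, smul_add]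
  rw [integral_add, ← integral_smul]
  · simp only [smul_comm (a : ℝ)]
  · simp only [smul_comm _ (a : ℝ)]
    exact (((h.rapidDecay b).pow_smul i _).hermiteFun_real_smul n).integrable.smul (a : ℝ)
  · exact (((h.rapidDecay (b + 1)).pow_smul i _).hermiteFun_real_smul n).integrable

theorem rapidDecay_deriv (h : DirectionalBounds i g N) (a b : ℕ) :
    RapidDecay fun x : EuclideanSpace ℝ (Fin d) =>
      (a : ℝ) • (x i ^ (a - 1) • g b x) + x i ^ a • g (b + 1) x := by
  have h1 := ((h.rapidDecay b).pow_smul i (a - 1)).smul (𝕜 := ℝ) (g := fun _ => (a : ℝ))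
    continuous_const 0 (B := a) fun x => by
      simpa using one_le_schwartzWeight 0 x |> le_mul_of_one_le_right (Nat.cast_nonneg a)
  have h2 := (h.rapidDecay (b + 1)).pow_smul i a
  refine ⟨h1.1.add h2.1, fun k => ?_⟩
  obtain ⟨C1, hC1⟩ := h1.2 k
  obtain ⟨C2, hC2⟩ := h2.2 k
  refine ⟨C1 + C2, fun x => ?_⟩
  refine le_trans (mul_le_mul_of_nonneg_right (norm_add_le _ _) (schwartzWeight_nonneg _ _)) ?_
  rw [add_mul]
  exact add_le_add (hC1 x) (hC2 x)

/-- In the n-th coefficient of (x_i + ∂_i)ψ, ψ = x_i^a g_b, the contributions of n - e_i cancel. At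
a = 0 the truncated exponent a - 1 carries the factor 0. -/
theorem raise_eq (h : DirectionalBounds i g N) (a b : ℕ) (n : Fin d → ℕ) :
    (2 * √(((n i : ℝ) + 1) / 2)) • monomialCoeff i g a b (n + Pi.single i 1) =
      monomialCoeff i g (a + 1) b n +
        ((a : ℝ) • monomialCoeff i g (a - 1) b n + monomialCoeff i g a (b + 1) n) := by
  have h1 := integral_coord_smul_hermiteFun ((h.rapidDecay b).pow_smul i a) i n
  have h2 := integral_lineDeriv_smul_hermiteFun ((h.rapidDecay b).pow_smul i a)
    (h.rapidDecay_deriv a b) i (h.hasLineDerivAt_pow_smul a b) n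
  rw [h.integral_deriv_smul] at h2
  have e : monomialCoeff i g (a + 1) b n = ∫ x, hermiteFun n x • (x i • (x i ^ a • g b x)) := by
    simp only [monomialCoeff, pow_succ', mul_smul]
  rw [e, h1, h2]
  unfold monomialCoeff
  module

/-- The companion formula for x_i - ∂_i, where the contributions of n + e_i cancel instead. -/
theorem lower_eq (h : DirectionalBounds i g N) (a b : ℕ) (n : Fin d → ℕ) :
    (2 * √((n i : ℝ) / 2)) • monomialCoeff i g a b (n - Pi.single i 1) =
      monomialCoeff i g (a + 1) b n -
        ((a : ℝ) • monomialCoeff i g (a - 1) b n + monomialCoeff i g a (b + 1) n) := by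
  have h1 := integral_coord_smul_hermiteFun ((h.rapidDecay b).pow_smul i a) i n
  have h2 := integral_lineDeriv_smul_hermiteFun ((h.rapidDecay b).pow_smul i a)
    (h.rapidDecay_deriv a b) i (h.hasLineDerivAt_pow_smul a b) n
  rw [h.integral_deriv_smul] at h2
  have e : monomialCoeff i g (a + 1) b n = ∫ x, hermiteFun n x • (x i • (x i ^ a • g b x)) := by
    simp only [monomialCoeff, pow_succ', mul_smul]
  rw [e, h1, h2]
  unfold monomialCoeff
  module

/-- `monomialCoeff` of `(x_i - ∂_i) (x_i^a g_b)`. -/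
def _root_.monomialCoeffLower (i : Fin d) (g : ℕ → EuclideanSpace ℝ (Fin d) → W) (a b : ℕ)
    (n : Fin d → ℕ) : W :=
  monomialCoeff i g (a + 1) b n -
    ((a : ℝ) • monomialCoeff i g (a - 1) b n + monomialCoeff i g a (b + 1) n)

/-- The right side is the n-th coefficient of (x_i - ∂_i)(x_i + ∂_i) applied to x_i^a g_b. This
operator is the harmonic oscillator minus 1, whose eigenvalue at h_n is 2 n_i. -/
theorem two_mul_smul_eq (h : DirectionalBounds i g N) (a b : ℕ) (n : Fin d → ℕ) :
    (2 * (n i : ℝ)) • monomialCoeff i g a b n = monomialCoeffLower i g (a + 1) b n +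
      ((a : ℝ) • monomialCoeffLower i g (a - 1) b n + monomialCoeffLower i g a (b + 1) n) := by
  have hl : ∀ a b, monomialCoeffLower i g a b n =
      (2 * √((n i : ℝ) / 2)) • monomialCoeff i g a b (n - Pi.single i 1) := fun a b =>
    (h.lower_eq a b n).symm
  rw [hl, hl, hl]
  rcases Nat.eq_zero_or_pos (n i) with h0 | hpos
  · simp [h0]
  · obtain ⟨m, rfl⟩ := mem_range_add_single hpos.ne'
    have hr := h.raise_eq a b m
    simp only [add_tsub_cancel_right, Pi.add_apply, Pi.single_eq_same, Nat.cast_add, Nat.cast_one]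
    have hs : (2 : ℝ) * ((m i : ℝ) + 1) =
        (2 * √(((m i : ℝ) + 1) / 2)) * (2 * √(((m i : ℝ) + 1) / 2)) := by
      have := Real.mul_self_sqrt (show (0 : ℝ) ≤ ((m i : ℝ) + 1) / 2 by positivity)
      linear_combination (-4) * this
    rw [hs, mul_smul, hr]
    module

end DirectionalBounds

/-- Each factor 2 n_i is traded for one application of the oscillator, which changes a and b; hence
the induction over all a and b. C and l do not depend on g, so the estimate will yield continuity
and be uniform in φ. -/
theorem norm_monomialCoeff_le (d : ℕ) (r a b : ℕ) : ∃ (C : ℝ) (l : ℕ), 0 ≤ C ∧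
    ∀ (i : Fin d) (g : ℕ → EuclideanSpace ℝ (Fin d) → W) (N : ℕ → ℝ), DirectionalBounds i g N →
      ∀ n, (2 * (n i : ℝ)) ^ r * ‖monomialCoeff i g a b n‖ ≤ C * N l * seqWeight d n := by
  induction r generalizing a b with
  | zero =>
    let I : ℝ := ∫ x : EuclideanSpace ℝ (Fin d), (schwartzWeight (d + 1) x)⁻¹
    have hI : 0 ≤ I := integral_nonneg fun x => inv_nonneg.2 (schwartzWeight_nonneg _ _)
    -- The powers of the weight are spent as follows: a for x_i^a, d + 1 for integrability, and b so
    -- that the b-th derivative is covered by the seminorm.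
    refine ⟨2 ^ d * I, a + b + (d + 1), by positivity, fun i g N h n => ?_⟩
    rw [pow_zero, one_mul]
    set l := a + b + (d + 1)
    have hb : ∀ x, ‖hermiteFun n x • (x i ^ a • g b x)‖ ≤
        2 ^ d * seqWeight d n * N l * (schwartzWeight (d + 1) x)⁻¹ := by
      intro x
      rw [norm_smul, norm_smul, ← div_eq_mul_inv, le_div_iff₀ (schwartzWeight_pos _ _), norm_pow]
      have h1 : ‖x i‖ ^ a ≤ schwartzWeight (a + b) x := by
        have h1 := (abs_coord_le x i).trans (norm_le_schwartzWeight x)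
        rw [schwartzWeight_eq, pow_one] at h1
        refine le_trans ?_ (schwartzWeight_mono (Nat.le_add_right a b) x)
        rw [schwartzWeight_eq]
        exact pow_le_pow_left₀ (norm_nonneg _) h1 a
      have h2 := h.bound b l (by omega) x
      have h3 := schwartzWeight_nonneg (d + 1) x
      have h4 := schwartzWeight_nonneg (a + b) x
      have h5 := seqWeight_nonneg d n
      calc ‖hermiteFun n x‖ * (‖x i‖ ^ a * ‖g b x‖) * schwartzWeight (d + 1) x
          ≤ 2 ^ d * seqWeight d n * (schwartzWeight (a + b) x * ‖g b x‖) *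
              schwartzWeight (d + 1) x := by
            gcongr
            exact abs_hermiteFun_le n x
        _ = 2 ^ d * seqWeight d n * (‖g b x‖ * schwartzWeight l x) := by
            simp only [l, schwartzWeight_add]; ring
        _ ≤ 2 ^ d * seqWeight d n * N l := by gcongr
    calc ‖monomialCoeff i g a b n‖
        ≤ ∫ x, 2 ^ d * seqWeight d n * N l * (schwartzWeight (d + 1) x)⁻¹ :=
          norm_integral_le_of_norm_le ((integrable_inv_schwartzWeight d).const_mul _)
            (Eventually.of_forall hb)
      _ = 2 ^ d * I * N l * seqWeight d n := by rw [integral_const_mul]; ring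
  | succ r ih =>
    -- The factor x_i - ∂_i alone, estimated term by term from the induction hypothesis; the factor
    -- x_i + ∂_i follows in the same way.
    have hlow : ∀ a b, ∃ (C : ℝ) (l : ℕ), 0 ≤ C ∧ ∀ (i : Fin d)
        (g : ℕ → EuclideanSpace ℝ (Fin d) → W) (N : ℕ → ℝ), DirectionalBounds i g N → ∀ n,
        (2 * (n i : ℝ)) ^ r * ‖monomialCoeffLower i g a b n‖ ≤ C * N l * seqWeight d n := by
      intro a b
      obtain ⟨C1, l1, h1, H1⟩ := ih (a + 1) b
      obtain ⟨C2, l2, h2, H2⟩ := ih (a - 1) b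
      obtain ⟨C3, l3, h3, H3⟩ := ih a (b + 1)
      refine ⟨C1 + (a * C2 + C3), max l1 (max l2 l3), by positivity, fun i g N h n => ?_⟩
      have hw := seqWeight_nonneg d n
      set l := max l1 (max l2 l3)
      have g1 : N l1 ≤ N l := h.mono (by omega)
      have g2 : N l2 ≤ N l := h.mono (by omega)
      have g3 : N l3 ≤ N l := h.mono (by omega)
      have k1 : C1 * N l1 * seqWeight d n ≤ C1 * N l * seqWeight d n := by gcongr
      have k2 : a * (C2 * N l2 * seqWeight d n) ≤ a * (C2 * N l * seqWeight d n) := by gcongr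
      have k3 : C3 * N l3 * seqWeight d n ≤ C3 * N l * seqWeight d n := by gcongr
      have hn : ‖monomialCoeffLower i g a b n‖ ≤ ‖monomialCoeff i g (a + 1) b n‖ +
          (a * ‖monomialCoeff i g (a - 1) b n‖ + ‖monomialCoeff i g a (b + 1) n‖) := by
        refine (norm_sub_le _ _).trans (add_le_add le_rfl ((norm_add_le _ _).trans ?_))
        rw [norm_smul, Real.norm_natCast]
      have e1 := H1 i g N h n
      have e2 := mul_le_mul_of_nonneg_left (H2 i g N h n) (Nat.cast_nonneg (α := ℝ) a)
      have e3 := H3 i g N h n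
      have := mul_le_mul_of_nonneg_left hn (show 0 ≤ (2 * (n i : ℝ)) ^ r by positivity)
      linarith
    obtain ⟨C1, l1, h1, H1⟩ := hlow (a + 1) b
    obtain ⟨C2, l2, h2, H2⟩ := hlow (a - 1) b
    obtain ⟨C3, l3, h3, H3⟩ := hlow a (b + 1)
    refine ⟨C1 + (a * C2 + C3), max l1 (max l2 l3), by positivity, fun i g N h n => ?_⟩
    have hw := seqWeight_nonneg d n
    set l := max l1 (max l2 l3)
    have g1 : N l1 ≤ N l := h.mono (by omega)
    have g2 : N l2 ≤ N l := h.mono (by omega)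
    have g3 : N l3 ≤ N l := h.mono (by omega)
    have k1 : C1 * N l1 * seqWeight d n ≤ C1 * N l * seqWeight d n := by gcongr
    have k2 : a * (C2 * N l2 * seqWeight d n) ≤ a * (C2 * N l * seqWeight d n) := by gcongr
    have k3 : C3 * N l3 * seqWeight d n ≤ C3 * N l * seqWeight d n := by gcongr
    have hn : (2 * (n i : ℝ)) * ‖monomialCoeff i g a b n‖ ≤ ‖monomialCoeffLower i g (a + 1) b n‖ +
        (a * ‖monomialCoeffLower i g (a - 1) b n‖ + ‖monomialCoeffLower i g a (b + 1) n‖) := by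
      have e := congrArg norm (h.two_mul_smul_eq a b n)
      rw [norm_smul, Real.norm_eq_abs, abs_of_nonneg (by positivity)] at e
      rw [e]
      refine (norm_add_le _ _).trans (add_le_add le_rfl ((norm_add_le _ _).trans ?_))
      rw [norm_smul, Real.norm_natCast]
    have e1 := H1 i g N h n
    have e2 := mul_le_mul_of_nonneg_left (H2 i g N h n) (Nat.cast_nonneg (α := ℝ) a)
    have e3 := H3 i g N h n
    have := mul_le_mul_of_nonneg_left hn (show 0 ≤ (2 * (n i : ℝ)) ^ r by positivity)
    rw [pow_succ]
    linarith

end Decay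

/-! ### The Hermite expansion isomorphism -/

section HermiteIso

variable {𝕜 : Type*} [RCLike 𝕜] {d : ℕ} {E : Type*} [AddCommGroup E] [Module 𝕜 E]
    [UniformSpace E] [IsUniformAddGroup E] [ContinuousSMul 𝕜 E] [PolynormableSpace 𝕜 E]
    [T2Space E]

theorem SchwartzFun.directionalBounds (f : SchwartzFun 𝕜 d E)
    (p : {p : Seminorm 𝕜 E // Continuous p}) (φ : E →L[𝕜] 𝕜) (hφ : ∀ y, ‖φ y‖ ≤ p.1 y)
    (i : Fin d) : DirectionalBounds i (fun b x => φ ((partialDeriv 𝕜 i)^[b] f x))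
      (fun l => SchwartzFun.seminorm l p f) where
  continuous b := φ.continuous.comp (f.isCinf_iterate i b).continuous
  deriv b x := f.hasLineDerivAt_iterate φ i b x
  bound _ _ hb x := (mul_le_mul_of_nonneg_right (hφ _) (schwartzWeight_nonneg _ _)).trans
    (f.iterate_le_seminorm p i hb x)
  mono := f.seminorm_mono p

theorem exists_hermiteCoeff_le
    (hE : ∀ u : ℕ → E, CauchySeq u → ∃ x, Tendsto u atTop (𝓝 x)) (d j : ℕ) :
    ∃ (C : ℝ) (l : ℕ), 0 ≤ C ∧ ∀ (f : SchwartzFun 𝕜 d E)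
      (p : {p : Seminorm 𝕜 E // Continuous p}) (n : Fin d → ℕ),
        p.1 (hermiteCoeff f n) * seqWeight j n ≤ C * SchwartzFun.seminorm l p f := by
  -- The coefficients will be bounded by the quotient of the weights of orders d and 2r, which has
  -- to beat order j: j + d ≤ 2r.
  let r := j + d
  obtain ⟨C, l, hC, H⟩ := norm_monomialCoeff_le (W := 𝕜) d (2 * r) 0 0
  let I : ℝ := ∫ x : EuclideanSpace ℝ (Fin d), (schwartzWeight (d + 1) x)⁻¹
  have hI : 0 ≤ I := integral_nonneg fun x => inv_nonneg.2 (schwartzWeight_nonneg _ _)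
  refine ⟨(d + 1) ^ r * (2 ^ d * I + d * C), max (d + 1) l, by positivity, fun f p n => ?_⟩
  set L := max (d + 1) l
  set N := SchwartzFun.seminorm L p f
  have hN : 0 ≤ N := apply_nonneg _ _
  have key : p.1 (hermiteCoeff f n) ≤
      (d + 1) ^ r * (2 ^ d * I + d * C) * N * (seqWeight d n / seqWeight (2 * r) n) := by
    refine seminorm_le_of_dual_le p.2 _ fun φ hφ => ?_
    rw [← mul_div_assoc, le_div_iff₀ (seqWeight_pos _ _), apply_hermiteCoeff hE]
    set c : 𝕜 := ∫ x, (hermiteFun n x : 𝕜) • φ (f x)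
    have hw := seqWeight_nonneg d n
    -- This plain bound serves the summand 1 in 1 + ∑ n_i^(2r); the oscillator estimates serve the
    -- others.
    have h0 : ‖c‖ ≤ 2 ^ d * I * N * seqWeight d n := by
      have hb : ∀ x, ‖(hermiteFun n x : 𝕜) • φ (f x)‖ ≤
          2 ^ d * seqWeight d n * N * (schwartzWeight (d + 1) x)⁻¹ := fun x => by
        rw [norm_smul, mul_assoc _ N]
        refine mul_le_mul (norm_hermiteFun_le n x) ?_ (norm_nonneg _)
          (mul_nonneg (by positivity) hw)
        rw [← div_eq_mul_inv, le_div_iff₀ (schwartzWeight_pos _ _)]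
        refine (mul_le_mul_of_nonneg_right (hφ _) (schwartzWeight_nonneg _ _)).trans ?_
        exact (f.le_seminorm_zero p (d + 1) x).trans (f.seminorm_mono p (le_max_left _ _))
      calc ‖c‖ ≤ ∫ x, 2 ^ d * seqWeight d n * N * (schwartzWeight (d + 1) x)⁻¹ :=
            norm_integral_le_of_norm_le ((integrable_inv_schwartzWeight d).const_mul _)
              (Eventually.of_forall hb)
        _ = 2 ^ d * I * N * seqWeight d n := by rw [integral_const_mul]; ring
    have hi : ∀ i, (n i : ℝ) ^ (2 * r) * ‖c‖ ≤ C * N * seqWeight d n := by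
      intro i
      have h1 := H i _ _ (f.directionalBounds p φ hφ i) n
      have e : monomialCoeff i (fun b x => φ ((partialDeriv 𝕜 i)^[b] f x)) 0 0 n = c := by
        simp only [monomialCoeff, pow_zero, one_smul, Function.iterate_zero_apply, c,
          smul_eq_mul, RCLike.real_smul_eq_coe_mul]
      rw [e] at h1
      calc (n i : ℝ) ^ (2 * r) * ‖c‖ ≤ (2 * (n i : ℝ)) ^ (2 * r) * ‖c‖ := by
            gcongr
            linarith [(n i).cast_nonneg (α := ℝ)]
        _ ≤ C * SchwartzFun.seminorm l p f * seqWeight d n := h1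
        _ ≤ C * N * seqWeight d n := by
            gcongr
            exact f.seminorm_mono p (le_max_right _ _)
    calc ‖c‖ * seqWeight (2 * r) n
        ≤ ‖c‖ * ((d + 1) ^ r * (1 + ∑ i, (n i : ℝ) ^ (2 * r))) :=
          mul_le_mul_of_nonneg_left (seqWeight_le_sum r n) (norm_nonneg _)
      _ = (d + 1) ^ r * (‖c‖ + ∑ i, (n i : ℝ) ^ (2 * r) * ‖c‖) := by
          rw [← Finset.sum_mul]; ring
      _ ≤ (d + 1) ^ r * (2 ^ d * I * N * seqWeight d n + ∑ _i : Fin d, C * N * seqWeight d n) := by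
          refine mul_le_mul_of_nonneg_left ?_ (by positivity)
          exact add_le_add h0 (Finset.sum_le_sum fun i _ => hi i)
      _ = _ := by
          simp only [Finset.sum_const, Finset.card_univ, Fintype.card_fin, nsmul_eq_mul]
          ring
  have hjw := seqWeight_nonneg j n
  have hfrac : seqWeight d n / seqWeight (2 * r) n * seqWeight j n ≤ 1 := by
    rw [div_mul_eq_mul_div, div_le_one (seqWeight_pos _ _), ← seqWeight_add]
    exact seqWeight_mono (by omega) n
  calc p.1 (hermiteCoeff f n) * seqWeight j n
      ≤ (d + 1) ^ r * (2 ^ d * I + d * C) * N * (seqWeight d n / seqWeight (2 * r) n) *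
          seqWeight j n := by gcongr
    _ = (d + 1) ^ r * (2 ^ d * I + d * C) * N * (seqWeight d n / seqWeight (2 * r) n *
          seqWeight j n) := by ring
    _ ≤ (d + 1) ^ r * (2 ^ d * I + d * C) * N * 1 := by gcongr
    _ = _ := mul_one _

/-- After a functional is applied, the series is dominated by a constant times the integrable |h_m|.
Sum and integral may be exchanged, and orthonormality leaves the m-th term. -/
theorem hasPettisIntegral_hermiteSeries
    (hE : ∀ u : ℕ → E, CauchySeq u → ∃ x, Tendsto u atTop (𝓝 x)) (x : RapidSeq 𝕜 d E)
    (m : Fin d → ℕ) :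
    HasPettisIntegral 𝕜 volume (fun t => (hermiteFun m t : 𝕜) • hermiteSeries x t) (x m) := by
  intro φ
  let p := dualSeminorm φ
  have hs := (x.summable_weight p d).mul_left (2 ^ d)
  let B : ℝ := ∑' n, 2 ^ d * (seqWeight d n * p.1 (x n))
  let F : (Fin d → ℕ) → EuclideanSpace ℝ (Fin d) → 𝕜 := fun n t =>
    (hermiteFun m t : 𝕜) * ((hermiteFun n t : 𝕜) * φ (x n))
  have hF : ∀ n t, ‖F n t‖ ≤ |hermiteFun m t| * (2 ^ d * (seqWeight d n * p.1 (x n))) := by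
    intro n t
    simp only [F]
    rw [norm_mul, norm_mul, RCLike.norm_ofReal, ← mul_assoc (2 ^ d)]
    exact mul_le_mul_of_nonneg_left (mul_le_mul_of_nonneg_right (norm_hermiteFun_le n t)
      (norm_nonneg _)) (abs_nonneg _)
  have hφ : ∀ t, HasSum (fun n => F n t) (φ ((hermiteFun m t : 𝕜) • hermiteSeries x t)) := by
    intro t
    rw [map_smul]
    have h1 := φ.hasSum ((polyBounded_hermiteFun t).summable hE x).hasSum
    have h2 := h1.mul_left (hermiteFun m t : 𝕜)
    simp only [map_smul, smul_eq_mul] at h2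
    exact h2
  have hFc : ∀ n, Continuous (F n) := fun n => by
    have h1 := continuous_hermiteFun m
    have h2 := continuous_hermiteFun n
    simp only [F]
    fun_prop
  have hm : Integrable fun t : EuclideanSpace ℝ (Fin d) => |hermiteFun m t| :=
    (rapidDecay_hermiteFun m).integrable.norm
  have hdom := hasSum_integral_of_dominated_convergence (μ := volume) (F := F)
    (fun n t => |hermiteFun m t| * (2 ^ d * (seqWeight d n * p.1 (x n))))
    (fun n => (hFc n).aestronglyMeasurable) (fun n => Eventually.of_forall fun t => hF n t)
    (Eventually.of_forall fun t => hs.mul_left _) (by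
      simp only [tsum_mul_left (a := |hermiteFun m _|)]
      exact hm.mul_const B) (Eventually.of_forall hφ)
  constructor
  · refine (hm.mul_const B).mono' ?_ (Eventually.of_forall fun t => ?_)
    · have h1 := continuous_hermiteFun m
      have h2 := continuous_hermiteSeries hE x
      refine Continuous.aestronglyMeasurable (φ.continuous.comp (Continuous.smul ?_ h2))
      fun_prop
    · rw [← (hφ t).tsum_eq]
      refine tsum_of_norm_bounded (hs.mul_left |hermiteFun m t|).hasSum (fun n => hF n t) |>.trans ?_
      rw [tsum_mul_left]
  · have hFi : ∀ n, ∫ t, F n t = if n = m then φ (x n) else 0 := by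
      intro n
      have e : ∀ t, F n t = ((hermiteFun m t * hermiteFun n t : ℝ) : 𝕜) * φ (x n) := fun t => by
        simp only [F]
        push_cast
        ring
      simp_rw [e]
      rw [integral_mul_const, integral_ofReal, integral_hermiteFun_mul]
      by_cases h : n = m
      · simp [h]
      · simp [h, Ne.symm h]
    simp only [hFi] at hdom
    exact (hasSum_ite_eq m (φ (x m))).unique (by
      convert! hdom using 1
      ext n
      by_cases h : n = m <;> simp [h])

/-- The Hermite series of a rapidly decreasing family as a Schwartz function. -/
def hermiteSynthesis (hE : ∀ u : ℕ → E, CauchySeq u → ∃ x, Tendsto u atTop (𝓝 x)) (d : ℕ) :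
    RapidSeq 𝕜 d E →L[𝕜] SchwartzFun 𝕜 d E :=
  let L : RapidSeq 𝕜 d E →ₗ[𝕜] SchwartzFun 𝕜 d E :=
    { toFun := fun x => ⟨hermiteSeries x, isCinf_hermiteSeries hE x, fun p hp l => by
        obtain ⟨q, -, hq⟩ := exists_seminorm_iterPartialDeriv_hermiteSeries_le (d := d) hE ⟨p, hp⟩ l
        refine ⟨q x, ?_⟩
        rintro _ ⟨j, rfl⟩
        exact hq x j⟩
      map_add' := fun x y => SchwartzFun.ext fun t => hermiteSeries_add hE x y t
      map_smul' := fun c x => SchwartzFun.ext fun t => hermiteSeries_smul hE c x t }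
  ⟨L, SchwartzFun.continuous_of_bound L fun p l =>
    exists_seminorm_iterPartialDeriv_hermiteSeries_le hE p l⟩

theorem hermiteSynthesis_apply (hE : ∀ u : ℕ → E, CauchySeq u → ∃ x, Tendsto u atTop (𝓝 x))
    (x : RapidSeq 𝕜 d E) (t : EuclideanSpace ℝ (Fin d)) :
    hermiteSynthesis hE d x t = hermiteSeries x t := rfl

theorem hermiteCoeff_hermiteSynthesis
    (hE : ∀ u : ℕ → E, CauchySeq u → ∃ x, Tendsto u atTop (𝓝 x)) (x : RapidSeq 𝕜 d E)
    (n : Fin d → ℕ) : hermiteCoeff (hermiteSynthesis hE d x) n = x n :=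
  (hasPettisIntegral_hermiteCoeff hE _ n).unique (hasPettisIntegral_hermiteSeries hE x n)

/-- The family of Hermite coefficients of a Schwartz function. -/
def hermiteAnalysis (hE : ∀ u : ℕ → E, CauchySeq u → ∃ x, Tendsto u atTop (𝓝 x)) (d : ℕ) :
    SchwartzFun 𝕜 d E →L[𝕜] RapidSeq 𝕜 d E :=
  let L : SchwartzFun 𝕜 d E →ₗ[𝕜] RapidSeq 𝕜 d E :=
    { toFun := fun f => ⟨hermiteCoeff f, fun p hp j => by
        obtain ⟨C, l, -, h⟩ := exists_hermiteCoeff_le (𝕜 := 𝕜) hE d j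
        refine ⟨C * SchwartzFun.seminorm l ⟨p, hp⟩ f, ?_⟩
        rintro _ ⟨n, rfl⟩
        exact h f ⟨p, hp⟩ n⟩
      map_add' := fun f g => RapidSeq.ext fun n => eq_of_forall_dual_eq (𝕜 := 𝕜) fun φ => by
        change φ (hermiteCoeff (f + g) n) = φ (hermiteCoeff f n + hermiteCoeff g n)
        rw [map_add, apply_hermiteCoeff hE, apply_hermiteCoeff hE, apply_hermiteCoeff hE,
          ← integral_add ((f.rapidDecay_comp φ).hermiteFun_smul n).integrable
            ((g.rapidDecay_comp φ).hermiteFun_smul n).integrable]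
        congr 1
        ext t
        rw [← smul_add, ← map_add]
        rfl
      map_smul' := fun c f => RapidSeq.ext fun n => eq_of_forall_dual_eq (𝕜 := 𝕜) fun φ => by
        change φ (hermiteCoeff (c • f) n) = φ (c • hermiteCoeff f n)
        rw [map_smul, apply_hermiteCoeff hE, apply_hermiteCoeff hE, ← integral_smul]
        congr 1
        ext t
        rw [smul_comm c, ← map_smul φ c]
        rfl }
  ⟨L, RapidSeq.continuous_of_bound L fun p j => by
    obtain ⟨C, l, hC, h⟩ := exists_hermiteCoeff_le (𝕜 := 𝕜) hE d j
    exact ⟨C.toNNReal • SchwartzFun.seminorm l p,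
      (SchwartzFun.continuous_seminorm l p).const_smul C.toNNReal, fun f n =>
      (h f p n).trans_eq (by
        rw [_root_.smul_apply, NNReal.smul_def, Real.coe_toNNReal C hC, smul_eq_mul])⟩⟩

theorem hermiteAnalysis_apply (hE : ∀ u : ℕ → E, CauchySeq u → ∃ x, Tendsto u atTop (𝓝 x))
    (f : SchwartzFun 𝕜 d E) (n : Fin d → ℕ) : hermiteAnalysis hE d f n = hermiteCoeff f n := rfl

/-- The difference of the two sides has zero coefficients since analysis inverts synthesis on one
side; completeness of the Hermite functions is applied to its image under every functional. -/
theorem hermiteSynthesis_hermiteAnalysis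
    (hE : ∀ u : ℕ → E, CauchySeq u → ∃ x, Tendsto u atTop (𝓝 x)) (f : SchwartzFun 𝕜 d E) :
    hermiteSynthesis hE d (hermiteAnalysis hE d f) = f := by
  refine SchwartzFun.ext fun t => eq_of_forall_dual_eq (𝕜 := 𝕜) fun φ => ?_
  set g := hermiteSynthesis hE d (hermiteAnalysis hE d f)
  have h := eq_zero_of_hermite_coeff_eq_zero (𝕜 := 𝕜) ((g - f).rapidDecay_comp φ) fun n => by
    rw [← apply_hermiteCoeff hE, ← hermiteAnalysis_apply hE, map_sub, RapidSeq.sub_apply,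
      hermiteAnalysis_apply, hermiteCoeff_hermiteSynthesis, sub_self, map_zero]
  have h2 : φ (g t - f t) = 0 := congrFun h t
  rwa [map_sub, sub_eq_zero] at h2

/-- The Hermite expansion as an isomorphism of topological vector spaces. -/
def hermiteEquiv (hE : ∀ u : ℕ → E, CauchySeq u → ∃ x, Tendsto u atTop (𝓝 x)) (d : ℕ) :
    SchwartzFun 𝕜 d E ≃L[𝕜] RapidSeq 𝕜 d E :=
  ContinuousLinearEquiv.equivOfInverse (hermiteAnalysis hE d) (hermiteSynthesis hE d)
    (hermiteSynthesis_hermiteAnalysis hE)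
    fun x => RapidSeq.ext fun n => hermiteCoeff_hermiteSynthesis hE x n

end HermiteIso

/-! ### Unit families, truncations and compact sets in `s(ℕ_0^d, E)` -/

section RapidSeqTopology

variable {𝕜 : Type*} [RCLike 𝕜] {d : ℕ} {E : Type*} [AddCommGroup E] [Module 𝕜 E]
  [TopologicalSpace E]

namespace RapidSeq

theorem sum_single_apply (x : RapidSeq 𝕜 d E) (A : Finset (Fin d → ℕ)) (n : Fin d → ℕ) :
    (∑ m ∈ A, single (𝕜 := 𝕜) m (x m)) n = if n ∈ A then x n else 0 := by
  rw [sum_apply]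
  simp only [single_apply, Pi.single_apply]
  rw [Finset.sum_ite_eq]

theorem truncate_singleton (n : Fin d → ℕ) (x : RapidSeq 𝕜 d E) :
    truncate 𝕜 E {n} x = single n (x n) := by
  ext m
  rw [truncate_apply, single_apply, Pi.single_apply]
  by_cases h : m = n <;> simp [h]

/-- The truncation error depends on x only through a stronger seminorm, so finite sections converge
uniformly on bounded sets, in particular on compact ones. -/
theorem seminorm_sub_sum_single_le (x : RapidSeq 𝕜 d E) (A : Finset (Fin d → ℕ)) (j : ℕ)
    (p : {p : Seminorm 𝕜 E // Continuous p}) {ε : ℝ} (hε : 0 ≤ ε)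
    (hA : ∀ n ∉ A, (seqWeight (2 * d) n)⁻¹ ≤ ε) :
    seminorm j p (x - ∑ m ∈ A, single (𝕜 := 𝕜) m (x m)) ≤ seminorm (j + 2 * d) p x * ε := by
  refine seminorm_le _ _ _ fun n => ?_
  rw [sub_apply, sum_single_apply]
  split_ifs with h
  · rw [sub_self, map_zero, zero_mul]
    exact mul_nonneg (apply_nonneg _ _) hε
  · rw [sub_zero, mul_comm]
    exact (weight_mul_le x p j n).trans (mul_le_mul_of_nonneg_left (hA n h) (apply_nonneg _ _))

theorem eventually_forall_notMem_le {ε : ℝ} (hε : 0 < ε) : ∀ᶠ A : Finset (Fin d → ℕ) in atTop,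
    ∀ n ∉ A, (seqWeight (2 * d) n)⁻¹ ≤ ε := by
  have h : {n : Fin d → ℕ | ¬ (seqWeight (2 * d) n)⁻¹ < ε}.Finite :=
    (tendsto_inv_seqWeight d).eventually_lt_const hε
  filter_upwards [eventually_ge_atTop h.toFinset] with A hA n hn
  by_contra hlt
  exact hn (hA (h.mem_toFinset.2 fun h2 => hlt h2.le))

theorem hasSum_single (x : RapidSeq 𝕜 d E) : HasSum (fun n => single (𝕜 := 𝕜) n (x n)) x := by
  rw [HasSum, SummationFilter.unconditional_filter,
    (rapidSeq_withSeminorms 𝕜 d E).tendsto_nhds]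
  rintro ⟨j, p⟩ ε hε
  set R := seminorm (j + 2 * d) p x
  have hR : 0 ≤ R := apply_nonneg _ _
  filter_upwards [eventually_forall_notMem_le (d := d) (ε := ε / (2 * (R + 1))) (by positivity)]
    with A hA
  rw [map_sub_rev]
  calc seminorm j p (x - ∑ m ∈ A, single (𝕜 := 𝕜) m (x m)) ≤ R * (ε / (2 * (R + 1))) :=
        seminorm_sub_sum_single_le x A j p (by positivity) hA
    _ < ε := by
        rw [← mul_div_assoc, div_lt_iff₀ (by positivity)]
        nlinarith

theorem seminorm_mono (x : RapidSeq 𝕜 d E) (p : {p : Seminorm 𝕜 E // Continuous p}) :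
    Monotone fun l => seminorm l p x := fun l m hlm =>
  seminorm_le x l p fun n => le_trans
    (mul_le_mul_of_nonneg_left (seqWeight_mono hlm _) (apply_nonneg _ _)) (le_seminorm x m p n)

/-- Lets the absolute value replace all continuous seminorms in the scalar sequence space. -/
theorem seminorm_scalar_eq (p : Seminorm 𝕜 𝕜) (z : 𝕜) : p z = p 1 * ‖z‖ := by
  conv_lhs => rw [← mul_one z, ← smul_eq_mul, map_smul_eq_mul, mul_comm]

theorem seminorm_scalar_le (z : RapidSeq 𝕜 d 𝕜) (j : ℕ)
    (p : {p : Seminorm 𝕜 𝕜 // Continuous p}) :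
    seminorm j p z ≤ p.1 1 * seminorm j (absSeminorm 𝕜) z :=
  seminorm_le z j p fun n => by
    rw [seminorm_scalar_eq, mul_assoc]
    exact mul_le_mul_of_nonneg_left (le_seminorm z j (absSeminorm 𝕜) n) (apply_nonneg _ _)

theorem seminorm_single_le (n : Fin d → ℕ) (j : ℕ) :
    seminorm j (absSeminorm 𝕜) (single (𝕜 := 𝕜) n (1 : 𝕜)) ≤ seqWeight j n :=
  seminorm_le _ _ _ fun m => by
    rw [single_apply]
    change ‖(Pi.single n (1 : 𝕜) : (Fin d → ℕ) → 𝕜) m‖ * _ ≤ _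
    by_cases h : m = n
    · subst h; simp
    · simpa [h] using seqWeight_nonneg j n

theorem smul_single (c : 𝕜) (n : Fin d → ℕ) (e : E) :
    c • single (𝕜 := 𝕜) n e = single n (c • e) := by
  ext m
  rw [smul_apply, single_apply, single_apply]
  by_cases h : m = n
  · subst h; simp
  · simp [h]

/-- A neighbourhood of `0` in `s(ℕ_0^d)` on which a set of functionals is bounded by `1` gives a
uniform estimate by one of the seminorms. -/
theorem exists_norm_le_seminorm {S : Set (RapidSeq 𝕜 d 𝕜 →ₗ[𝕜] 𝕜)} {U : Set (RapidSeq 𝕜 d 𝕜)}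
    (hU : U ∈ 𝓝 0) (h : ∀ y ∈ S, ∀ z ∈ U, ‖y z‖ ≤ 1) :
    ∃ (C : ℝ) (l : ℕ), 0 ≤ C ∧ ∀ y ∈ S, ∀ z, ‖y z‖ ≤ C * seminorm l (absSeminorm 𝕜) z := by
  obtain ⟨⟨s, r⟩, hr, hsub⟩ :=
    (rapidSeq_withSeminorms 𝕜 d 𝕜).hasBasis_zero_ball.mem_iff.1 hU
  simp only at hr hsub
  let l := s.sup fun a => a.1
  let M : ℝ := ∑ a ∈ s, a.2.1 1 + 1
  have hM0 : 0 ≤ ∑ a ∈ s, a.2.1 1 := Finset.sum_nonneg fun a _ => apply_nonneg _ _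
  have hM : 0 < M := by simp only [M]; linarith
  have hle : ∀ z, s.sup (rapidSeminorms 𝕜 d 𝕜) z ≤ M * seminorm l (absSeminorm 𝕜) z := by
    intro z
    refine Seminorm.finset_sup_apply_le (mul_nonneg hM.le (apply_nonneg _ _)) fun a ha => ?_
    refine (seminorm_scalar_le z a.1 a.2).trans (mul_le_mul ?_
      (seminorm_mono z _ (Finset.le_sup (f := fun a => a.1) ha)) (apply_nonneg _ _) hM.le)
    have := Finset.single_le_sum (f := fun a : ℕ × {p : Seminorm 𝕜 𝕜 // Continuous p} => a.2.1 1)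
      (fun a _ => apply_nonneg _ _) ha
    simp only [M]
    linarith
  -- Scaling z into U by its own seminorm could mean dividing by 0; a number t strictly above the
  -- claimed bound is positive.
  refine ⟨M / r, l, by positivity, fun y hy z => le_of_forall_gt_imp_ge_of_dense fun t ht => ?_⟩
  set N := seminorm l (absSeminorm 𝕜) z
  have hN : 0 ≤ N := apply_nonneg _ _
  have ht0 : 0 < t := lt_of_le_of_lt (by positivity) ht
  have hmem : (((t⁻¹ : ℝ) : 𝕜) • z) ∈ U := hsub (by
    rw [Seminorm.mem_ball_zero, map_smul_eq_mul, RCLike.norm_ofReal,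
      abs_of_pos (inv_pos.2 ht0), inv_mul_lt_iff₀ ht0]
    refine (hle z).trans_lt ?_
    rw [div_mul_eq_mul_div, div_lt_iff₀ hr] at ht
    exact ht)
  have h1 := h y hy _ hmem
  rwa [map_smul, norm_smul, RCLike.norm_ofReal, abs_of_pos (inv_pos.2 ht0),
    inv_mul_le_iff₀ ht0, mul_one] at h1

theorem exists_functional_le (y : RapidSeq 𝕜 d 𝕜 →L[𝕜] 𝕜) :
    ∃ (C : ℝ) (l : ℕ), 0 ≤ C ∧ ∀ z, ‖y z‖ ≤ C * seminorm l (absSeminorm 𝕜) z := by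
  have hU : {z : RapidSeq 𝕜 d 𝕜 | ‖y z‖ < 1} ∈ 𝓝 0 :=
    (isOpen_lt y.continuous.norm continuous_const).mem_nhds (by simp)
  obtain ⟨C, l, hC, h⟩ := exists_norm_le_seminorm (S := {y.toLinearMap}) hU fun y' hy' z hz => by
    rw [Set.mem_singleton_iff.1 hy']
    exact le_of_lt hz
  exact ⟨C, l, hC, fun z => h y.toLinearMap rfl z⟩

theorem polyBounded_apply_single (y : RapidSeq 𝕜 d 𝕜 →L[𝕜] 𝕜) :
    PolyBounded fun n => y (single n 1) := by
  obtain ⟨C, l, hC, h⟩ := exists_functional_le y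
  exact ⟨C, l, fun n => (h _).trans (mul_le_mul_of_nonneg_left (seminorm_single_le n l) hC)⟩

theorem hasSum_apply_single (y : RapidSeq 𝕜 d 𝕜 →L[𝕜] 𝕜) (z : RapidSeq 𝕜 d 𝕜) :
    HasSum (fun n => y (single n 1) * z n) (y z) := by
  have h := y.hasSum (hasSum_single z)
  have e : ∀ n, y (single n 1) * z n = y (single n (z n)) := fun n => by
    conv_rhs => rw [← mul_one (z n), ← smul_eq_mul, ← smul_single, map_smul, smul_eq_mul, mul_comm]
  simpa only [e] using h

/-- The box `{z | ‖z_n‖ ≤ p (x_n)}`. -/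
def box (x : RapidSeq 𝕜 d E) (p : Seminorm 𝕜 E) : Set (RapidSeq 𝕜 d 𝕜) :=
  {z | ∀ n, ‖z n‖ ≤ p (x n)}

/-- The element of the box with given bounded entries. -/
def ofBound (x : RapidSeq 𝕜 d E) (p : {p : Seminorm 𝕜 E // Continuous p})
    (z : (Fin d → ℕ) → 𝕜) (hz : ∀ n, ‖z n‖ ≤ p.1 (x n)) : RapidSeq 𝕜 d 𝕜 :=
  ⟨z, fun q _ j => ⟨q 1 * seminorm j p x, by
    rintro _ ⟨n, rfl⟩
    simp only
    rw [seminorm_scalar_eq, mul_assoc]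
    exact mul_le_mul_of_nonneg_left ((mul_le_mul_of_nonneg_right (hz n)
      (seqWeight_nonneg _ _)).trans (le_seminorm x j p n)) (apply_nonneg _ _)⟩⟩

/-- The box is the image of a product of closed discs, compact by Tychonoff. The parametrisation is
continuous into s because rapid decrease of p(x_n) makes the tails uniformly small. -/
theorem isCompact_box (x : RapidSeq 𝕜 d E) (p : {p : Seminorm 𝕜 E // Continuous p}) :
    IsCompact (box x p.1) := by
  let P : Set ((Fin d → ℕ) → 𝕜) := Set.pi Set.univ fun n => Metric.closedBall 0 (p.1 (x n))
  have hP : IsCompact P := isCompact_univ_pi fun n => isCompact_closedBall _ _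
  have := isCompact_iff_compactSpace.1 hP
  have hz : ∀ z : P, ∀ n, ‖z.1 n‖ ≤ p.1 (x n) := fun z n => by
    simpa using z.2 n (Set.mem_univ n)
  let Φ : P → RapidSeq 𝕜 d 𝕜 := fun z => ofBound x p z.1 (hz z)
  have hΦ : ∀ z n, Φ z n = z.1 n := fun _ _ => rfl
  have hrange : box x p.1 = Set.range Φ := by
    ext z
    constructor
    · intro h
      exact ⟨⟨z, fun n _ => by simpa using h n⟩, ext fun n => rfl⟩
    · rintro ⟨z, rfl⟩ n
      exact hz z n
  rw [hrange]
  refine isCompact_range (continuous_iff_continuousAt.2 fun z₀ => ?_)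
  rw [ContinuousAt, (rapidSeq_withSeminorms 𝕜 d 𝕜).tendsto_nhds]
  rintro ⟨j, q⟩ ε hε
  -- Only finitely many coordinates escape the uniform tail bound; coordinatewise convergence
  -- handles those.
  have hsmall : {n : Fin d → ℕ | ¬ q.1 1 * (2 * (seminorm (j + 2 * d) p x *
      (seqWeight (2 * d) n)⁻¹)) < ε / 2}.Finite := by
    have h1 := (((tendsto_inv_seqWeight d).const_mul (seminorm (j + 2 * d) p x)).const_mul
      2).const_mul (q.1 1)
    rw [mul_zero, mul_zero, mul_zero] at h1
    exact h1.eventually_lt_const (half_pos hε)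
  have hnear : ∀ᶠ z in 𝓝 z₀, ∀ n ∈ hsmall.toFinset,
      q.1 (z.1 n - z₀.1 n) * seqWeight j n < ε / 2 := by
    rw [Finset.eventually_all]
    intro n _
    have hc : Continuous fun z : P => q.1 (z.1 n - z₀.1 n) * seqWeight j n := by
      have := q.2
      have h1 : Continuous fun z : P => z.1 n - z₀.1 n :=
        ((continuous_apply n).comp continuous_subtype_val).sub continuous_const
      exact (this.comp h1).mul continuous_const
    have h2 := hc.tendsto z₀
    rw [sub_self, map_zero, zero_mul] at h2
    exact h2.eventually_lt_const (half_pos hε)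
  filter_upwards [hnear] with z hzn
  refine lt_of_le_of_lt (seminorm_le _ j q (C := ε / 2) fun n => ?_) (half_lt_self hε)
  rw [sub_apply, hΦ, hΦ]
  by_cases hn : n ∈ hsmall.toFinset
  · exact (hzn n hn).le
  · have h3 : q.1 1 * (2 * (seminorm (j + 2 * d) p x * (seqWeight (2 * d) n)⁻¹)) < ε / 2 := by
      simpa using hn
    refine le_trans ?_ h3.le
    rw [seminorm_scalar_eq, mul_assoc]
    refine mul_le_mul_of_nonneg_left ?_ (apply_nonneg _ _)
    have h4 := weight_mul_le x p j n
    have h5 : ‖z.1 n - z₀.1 n‖ ≤ 2 * p.1 (x n) := by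
      refine (norm_sub_le _ _).trans ?_
      linarith [hz z n, hz z₀ n]
    calc ‖z.1 n - z₀.1 n‖ * seqWeight j n ≤ 2 * p.1 (x n) * seqWeight j n :=
          mul_le_mul_of_nonneg_right h5 (seqWeight_nonneg _ _)
      _ = 2 * (seqWeight j n * p.1 (x n)) := by ring
      _ ≤ _ := by linarith

open scoped ComplexOrder in
theorem box_mem_absConvexCompacts (x : RapidSeq 𝕜 d E)
    (p : {p : Seminorm 𝕜 E // Continuous p}) :
    box x p.1 ∈ absConvexCompacts 𝕜 (RapidSeq 𝕜 d 𝕜) := by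
  refine ⟨isCompact_box x p, ?_, ?_⟩
  · rintro c hc _ ⟨z, hz, rfl⟩ n
    change ‖c • z n‖ ≤ _
    rw [norm_smul]
    exact (mul_le_of_le_one_left (norm_nonneg _) hc).trans (hz n)
  · intro z hz w hw a b ha hb hab n
    change ‖a • z n + b • w n‖ ≤ _
    -- In the order on 𝕜, a and b are nonnegative reals, so they equal their norms.
    have hab' : ‖a‖ + ‖b‖ = 1 := by
      have h1 : ((‖a‖ + ‖b‖ : ℝ) : 𝕜) = 1 := by
        rw [RCLike.ofReal_add, RCLike.norm_of_nonneg' ha, RCLike.norm_of_nonneg' hb, hab]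
      exact_mod_cast h1
    calc ‖a • z n + b • w n‖ ≤ ‖a‖ * ‖z n‖ + ‖b‖ * ‖w n‖ := by
          rw [← norm_smul, ← norm_smul]; exact norm_add_le _ _
      _ ≤ ‖a‖ * p.1 (x n) + ‖b‖ * p.1 (x n) :=
          add_le_add (mul_le_mul_of_nonneg_left (hz n) (norm_nonneg _))
            (mul_le_mul_of_nonneg_left (hw n) (norm_nonneg _))
      _ = p.1 (x n) := by rw [← add_mul, hab', one_mul]

end RapidSeq

end RapidSeqTopology

/-! ### Elements of the ε-product -/

section EpsProductEstimates

variable {𝕜 : Type*} [RCLike 𝕜] {F : Type*} [AddCommGroup F] [Module 𝕜 F] [TopologicalSpace F]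
  [IsTopologicalAddGroup F] [ContinuousSMul 𝕜 F]

/-- An element of `DualKappa`, regarded as a continuous functional. -/
def ofDualKappa (y : DualKappa 𝕜 F) : F →L[𝕜] 𝕜 :=
  (ContinuousLinearMap.toUniformConvergenceCLM (RingHom.id 𝕜) 𝕜 (absConvexCompacts 𝕜 F)).symm y

theorem ofDualKappa_apply (y : DualKappa 𝕜 F) (z : F) : ofDualKappa y z = y z := rfl

-- A nonempty balanced set contains 0, so K + L contains both K and L; empty sets are treated apart.
open scoped ComplexOrder in
theorem directedOn_absConvexCompacts : DirectedOn (· ⊆ ·) (absConvexCompacts 𝕜 F) := by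
  rintro K ⟨hK, hKb, hKc⟩ L ⟨hL, hLb, hLc⟩
  rcases K.eq_empty_or_nonempty with rfl | hK0
  · exact ⟨L, ⟨hL, hLb, hLc⟩, Set.empty_subset L, subset_rfl⟩
  rcases L.eq_empty_or_nonempty with rfl | hL0
  · exact ⟨K, ⟨hK, hKb, hKc⟩, subset_rfl, Set.empty_subset K⟩
  open scoped Pointwise in
  exact ⟨K + L, ⟨hK.add hL, hKb.add hLb, hKc.add hLc⟩,
    fun x hx => ⟨x, hx, 0, hLb.zero_mem hL0, add_zero x⟩,
    fun x hx => ⟨0, hKb.zero_mem hK0, x, hx, zero_add x⟩⟩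

open scoped ComplexOrder in
theorem absConvexCompacts_nonempty : (absConvexCompacts 𝕜 F).Nonempty :=
  ⟨∅, isCompact_empty, balanced_empty, convex_empty⟩

theorem mem_equicontinuousSets_of_le {q : Seminorm 𝕜 F} (hq : Continuous q)
    {B : Set (DualKappa 𝕜 F)} (h : ∀ y ∈ B, ∀ z, ‖y z‖ ≤ q z) : B ∈ equicontinuousSets 𝕜 F := by
  intro z₀
  rw [Metric.equicontinuousAt_iff_right]
  intro ε hε
  have hc : Continuous fun z => q (z₀ - z) := hq.comp (continuous_const.sub continuous_id)
  have h0 := hc.tendsto z₀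
  rw [sub_self, map_zero] at h0
  filter_upwards [h0.eventually_lt_const hε] with z hz y
  rw [dist_eq_norm, ← map_sub]
  exact (h y.1 y.2 _).trans_lt hz

variable {E : Type*} [AddCommGroup E] [Module 𝕜 E] [TopologicalSpace E]
  [IsTopologicalAddGroup E] [ContinuousSMul 𝕜 E]

/-- Continuity for the κ-topology in quantitative form: p(u y) is controlled by the supremum of |y|
over one compact set. A bound r > 0 stands in for that supremum. -/
theorem EpsProd.exists_seminorm_le (u : EpsProd 𝕜 F E) {p : Seminorm 𝕜 E} (hp : Continuous p) :
    ∃ K ∈ absConvexCompacts 𝕜 F, ∃ C : ℝ, 0 ≤ C ∧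
      ∀ (y : DualKappa 𝕜 F) (r : ℝ), 0 < r → (∀ z ∈ K, ‖y z‖ ≤ r) → p (u y) ≤ C * r := by
  have hU : {y : DualKappa 𝕜 F | p (u y) < 1} ∈ 𝓝 0 :=
    (isOpen_lt (hp.comp (map_continuous u)) continuous_const).mem_nhds (by simp)
  obtain ⟨⟨K, V⟩, ⟨hK, hV⟩, hsub⟩ := (UniformConvergenceCLM.hasBasis_nhds_zero (RingHom.id 𝕜) 𝕜
    (absConvexCompacts 𝕜 F) absConvexCompacts_nonempty directedOn_absConvexCompacts).mem_iff.1 hU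
  obtain ⟨δ, hδ, hball⟩ := Metric.mem_nhds_iff.1 hV
  refine ⟨K, hK, 2 / δ, by positivity, fun y r hr hy => ?_⟩
  have hc : 0 < δ / 2 / r := by positivity
  have hmem := @hsub (((δ / 2 / r : ℝ) : 𝕜) • y) fun z hz => hball (by
    rw [mem_ball_zero_iff]
    change ‖((δ / 2 / r : ℝ) : 𝕜) • y z‖ < δ
    rw [norm_smul, RCLike.norm_ofReal, abs_of_pos hc]
    calc δ / 2 / r * ‖y z‖ ≤ δ / 2 / r * r := mul_le_mul_of_nonneg_left (hy z hz) hc.le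
      _ = δ / 2 := by field_simp
      _ < δ := half_lt_self hδ)
  have h1 : p (u (((δ / 2 / r : ℝ) : 𝕜) • y)) < 1 := hmem
  rw [map_smul, map_smul_eq_mul, RCLike.norm_ofReal, abs_of_pos hc, ← lt_div_iff₀' hc] at h1
  refine h1.le.trans_eq ?_
  field_simp

end EpsProductEstimates

/-! ### The ε-product of the scalar sequence space with E -/

section EpsProductRapidSeq

variable {𝕜 : Type*} [RCLike 𝕜] {d : ℕ} {E : Type*} [AddCommGroup E] [Module 𝕜 E]

namespace RapidSeq

theorem exists_le_of_mem_equicontinuousSets {B : Set (DualKappa 𝕜 (RapidSeq 𝕜 d 𝕜))}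
    (hB : B ∈ equicontinuousSets 𝕜 (RapidSeq 𝕜 d 𝕜)) :
    ∃ (C : ℝ) (l : ℕ), 0 ≤ C ∧ ∀ y ∈ B, ∀ z, ‖y z‖ ≤ C * seminorm l (absSeminorm 𝕜) z := by
  have hU := Metric.equicontinuousAt_iff_right.1 (hB 0) 1 one_pos
  obtain ⟨C, l, hC, h⟩ := exists_norm_le_seminorm
    (S := (fun y => (ofDualKappa y).toLinearMap) '' B) hU (by
      rintro _ ⟨y, hy, rfl⟩ z hz
      have h1 := hz ⟨y, hy⟩
      rw [map_zero, dist_zero_left] at h1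
      exact h1.le)
  exact ⟨C, l, hC, fun y hy z => h _ ⟨y, hy, rfl⟩ z⟩

/-- A single seminorm dominates all these weighted evaluations. Uniform convergence on this set is
what controls the j-th weighted supremum of (u(δ_n)). -/
theorem weighted_delta_mem_equicontinuousSets (j : ℕ) :
    Set.range (fun n : Fin d → ℕ => ((seqWeight j n : ℝ) : 𝕜) • toDualKappa (rapidDelta 𝕜 n)) ∈
      equicontinuousSets 𝕜 (RapidSeq 𝕜 d 𝕜) := by
  refine mem_equicontinuousSets_of_le (continuous_seminorm j (absSeminorm 𝕜)) ?_
  rintro _ ⟨n, rfl⟩ z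
  change ‖((seqWeight j n : ℝ) : 𝕜) • z n‖ ≤ _
  rw [norm_smul, RCLike.norm_ofReal, abs_of_nonneg (seqWeight_nonneg j n), mul_comm]
  exact le_seminorm z j (absSeminorm 𝕜) n

theorem polyBounded_dualKappa (y : DualKappa 𝕜 (RapidSeq 𝕜 d 𝕜)) :
    PolyBounded fun n => y (single n 1) :=
  polyBounded_apply_single (ofDualKappa y)

section Coefficients

variable [TopologicalSpace E] [IsTopologicalAddGroup E] [ContinuousSMul 𝕜 E]

/-- The family `(u (δ_n))_n` for `u ∈ s(ℕ_0^d) ε E`. -/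
def ofEpsProd : EpsProd 𝕜 (RapidSeq 𝕜 d 𝕜) E →L[𝕜] RapidSeq 𝕜 d E :=
  let L : EpsProd 𝕜 (RapidSeq 𝕜 d 𝕜) E →ₗ[𝕜] RapidSeq 𝕜 d E :=
    { toFun := fun u => ⟨fun n => u (toDualKappa (rapidDelta 𝕜 n)), fun p hp j => by
        obtain ⟨K, hK, C, hC, h⟩ := EpsProd.exists_seminorm_le u hp
        obtain ⟨R, hR⟩ := hK.1.bddAbove_image
          (continuous_seminorm (𝕜 := 𝕜) (d := d) j (absSeminorm 𝕜)).continuousOn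
        refine ⟨C * (|R| + 1), ?_⟩
        rintro _ ⟨n, rfl⟩
        have hw : 0 < seqWeight j n := seqWeight_pos j n
        have h1 := h (toDualKappa (rapidDelta 𝕜 n)) ((|R| + 1) / seqWeight j n) (by positivity)
          fun z hz => by
            rw [le_div_iff₀ hw]
            calc ‖z n‖ * seqWeight j n ≤ seminorm j (absSeminorm 𝕜) z :=
                  le_seminorm z j (absSeminorm 𝕜) n
              _ ≤ R := hR ⟨z, hz, rfl⟩
              _ ≤ |R| + 1 := by linarith [le_abs_self R]
        rwa [← mul_div_assoc, le_div_iff₀ hw] at h1⟩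
      map_add' := fun _ _ => rfl
      map_smul' := fun _ _ => rfl }
  ⟨L, by
    refine (rapidSeq_withSeminorms 𝕜 d E).continuous_of_continuous_comp L ?_
    rintro ⟨j, p⟩
    refine Seminorm.continuous_of_forall' fun r hr => ?_
    have hp := p.2
    have hV : {e : E | p.1 e < r} ∈ 𝓝 0 :=
      (isOpen_lt hp continuous_const).mem_nhds (by simpa using hr)
    filter_upwards [UniformConvergenceCLM.eventually_nhds_zero_mapsTo (RingHom.id 𝕜)
      (weighted_delta_mem_equicontinuousSets (𝕜 := 𝕜) (d := d) j) hV] with u hu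
    rw [Seminorm.mem_closedBall_zero, Seminorm.comp_apply]
    refine seminorm_le _ j p fun n => ?_
    have h1 : p.1 (u (((seqWeight j n : ℝ) : 𝕜) • toDualKappa (rapidDelta 𝕜 n))) < r := hu ⟨n, rfl⟩
    rw [map_smul, map_smul_eq_mul, RCLike.norm_ofReal, abs_of_nonneg (seqWeight_nonneg j n),
      mul_comm] at h1
    exact h1.le⟩

theorem ofEpsProd_apply (u : EpsProd 𝕜 (RapidSeq 𝕜 d 𝕜) E) (n : Fin d → ℕ) :
    ofEpsProd u n = u (toDualKappa (rapidDelta 𝕜 n)) := rfl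

/-- In the κ-topology y = ∑ y(e_n) δ_n: y minus a finite partial sum is y composed with a truncation
error, which is uniformly small on compact sets. Continuity of u does the rest. -/
theorem hasSum_epsProd [PolynormableSpace 𝕜 E] (u : EpsProd 𝕜 (RapidSeq 𝕜 d 𝕜) E)
    (y : DualKappa 𝕜 (RapidSeq 𝕜 d 𝕜)) :
    HasSum (fun n => y (single n 1) • u (toDualKappa (rapidDelta 𝕜 n))) (u y) := by
  rw [HasSum, SummationFilter.unconditional_filter, tendsto_iff_seminorm (𝕜 := 𝕜)]
  intro p hp
  obtain ⟨K, hK, C, hC, h⟩ := EpsProd.exists_seminorm_le u hp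
  obtain ⟨D, l, hD, hy⟩ := exists_functional_le (ofDualKappa y)
  obtain ⟨R, hR⟩ := hK.1.bddAbove_image
    (continuous_seminorm (𝕜 := 𝕜) (d := d) (l + 2 * d) (absSeminorm 𝕜)).continuousOn
  rw [Metric.tendsto_nhds]
  intro η hη
  have hM : 0 < D * |R| + 1 := by positivity
  set ε : ℝ := η / (2 * ((C + 1) * (D * |R| + 1)))
  have hε : 0 < ε := by positivity
  filter_upwards [eventually_forall_notMem_le (d := d) hε] with A hA
  rw [Real.dist_0_eq_abs, abs_of_nonneg (apply_nonneg _ _), map_sub_rev]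
  have hu : u y - ∑ n ∈ A, y (single n 1) • u (toDualKappa (rapidDelta 𝕜 n)) =
      u (y - ∑ n ∈ A, y (single n 1) • toDualKappa (rapidDelta 𝕜 n)) := by
    rw [map_sub, map_sum]
    simp only [map_smul]
  rw [hu]
  refine (h _ ((D * |R| + 1) * ε) (by positivity) fun z hz => ?_).trans_lt ?_
  · have e : (y - ∑ n ∈ A, y (single n 1) • toDualKappa (rapidDelta 𝕜 n)) z =
        ofDualKappa y (z - ∑ n ∈ A, single (𝕜 := 𝕜) n (z n)) := by
      have e1 : ∀ n, single (𝕜 := 𝕜) n (z n) = z n • single n (1 : 𝕜) := fun n => by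
        rw [smul_single, smul_eq_mul, mul_one]
      rw [map_sub, map_sum, _root_.sub_apply, _root_.sum_apply]
      simp only [e1, map_smul, ofDualKappa_apply]
      congr 1
      exact Finset.sum_congr rfl fun n _ => mul_comm _ _
    rw [e]
    calc ‖ofDualKappa y (z - ∑ n ∈ A, single (𝕜 := 𝕜) n (z n))‖
        ≤ D * seminorm l (absSeminorm 𝕜) (z - ∑ n ∈ A, single (𝕜 := 𝕜) n (z n)) := hy _
      _ ≤ D * (seminorm (l + 2 * d) (absSeminorm 𝕜) z * ε) :=
          mul_le_mul_of_nonneg_left (seminorm_sub_sum_single_le z A l _ hε.le hA) hD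
      _ ≤ D * (|R| * ε) := by
          have : seminorm (l + 2 * d) (absSeminorm 𝕜) z ≤ |R| :=
            (hR ⟨z, hz, rfl⟩).trans (le_abs_self R)
          gcongr
      _ ≤ (D * |R| + 1) * ε := by linarith
  · calc C * ((D * |R| + 1) * ε) ≤ (C + 1) * ((D * |R| + 1) * ε) := by gcongr; linarith
      _ = η / 2 := by
          simp only [ε]
          field_simp
      _ < η := half_lt_self hη

end Coefficients

section Operators

variable [UniformSpace E] [IsUniformAddGroup E] [ContinuousSMul 𝕜 E] [PolynormableSpace 𝕜 E]
  [T2Space E]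

theorem seminorm_tsum_smul_le (hE : ∀ u : ℕ → E, CauchySeq u → ∃ x, Tendsto u atTop (𝓝 x))
    {c : (Fin d → ℕ) → 𝕜} (hc : PolyBounded c) (x : RapidSeq 𝕜 d E) {p : Seminorm 𝕜 E}
    (hp : Continuous p) : p (∑' n, c n • x n) ≤ ∑' n, ‖c n‖ * p (x n) := by
  have h := (hc.summable hE x).hasSum.seminorm_le hp (hc.summable_seminorm x p hp)
  simpa only [map_smul_eq_mul] using h

/-- Take z_n of modulus p(x_n) with the phase conjugate to that of y(e_n), so that no cancellation
occurs. Where y(e_n) = 0, the convention for division by 0 gives z_n = 0. -/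
theorem exists_mem_box_norm_eq (y : RapidSeq 𝕜 d 𝕜 →L[𝕜] 𝕜) (x : RapidSeq 𝕜 d E)
    (p : {p : Seminorm 𝕜 E // Continuous p}) :
    ∃ z ∈ box x p.1, ‖y z‖ = ∑' n, ‖y (single n 1)‖ * p.1 (x n) := by
  let c : (Fin d → ℕ) → 𝕜 := fun n => y (single n 1)
  let w : (Fin d → ℕ) → 𝕜 := fun n => (starRingEnd 𝕜) (c n) / (‖c n‖ : 𝕜) * (p.1 (x n) : ℝ)
  have hw : ∀ n, ‖w n‖ ≤ p.1 (x n) := fun n => by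
    simp only [w]
    rw [norm_mul, norm_div, RCLike.norm_conj, RCLike.norm_ofReal, RCLike.norm_ofReal, abs_norm,
      abs_of_nonneg (apply_nonneg p.1 (x n))]
    exact mul_le_of_le_one_left (apply_nonneg _ _) (div_self_le_one _)
  have hcw : ∀ n, c n * w n = ((‖c n‖ * p.1 (x n) : ℝ) : 𝕜) := fun n => by
    simp only [w]
    by_cases h : c n = 0
    · simp [h]
    · have h' : (‖c n‖ : 𝕜) ≠ 0 := by simpa using h
      rw [← mul_assoc, mul_div_assoc', RCLike.mul_conj, RCLike.ofReal_mul, pow_two,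
        mul_div_assoc, div_self h', mul_one]
  have hs := (polyBounded_apply_single y).summable_seminorm x p.1 p.2
  simp only [map_smul_eq_mul] at hs
  refine ⟨ofBound x p w hw, hw, ?_⟩
  have h1 : HasSum (fun n => c n * w n) (y (ofBound x p w hw)) :=
    hasSum_apply_single y (ofBound x p w hw)
  simp only [hcw] at h1
  rw [h1.unique ((RCLike.hasSum_ofReal 𝕜).2 hs.hasSum), RCLike.norm_ofReal, abs_of_nonneg]
  exact tsum_nonneg fun n => mul_nonneg (norm_nonneg _) (apply_nonneg _ _)

/-- The operator `y ↦ ∑ y (e_n) x_n` in `s(ℕ_0^d) ε E` defined by `x ∈ s(ℕ_0^d, E)`. -/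
def epsProdOf (hE : ∀ u : ℕ → E, CauchySeq u → ∃ x, Tendsto u atTop (𝓝 x))
    (x : RapidSeq 𝕜 d E) : EpsProd 𝕜 (RapidSeq 𝕜 d 𝕜) E :=
  let L : DualKappa 𝕜 (RapidSeq 𝕜 d 𝕜) →ₗ[𝕜] E :=
    { toFun := fun y => ∑' n, y (single n 1) • x n
      map_add' := fun y y' => by
        rw [← ((polyBounded_dualKappa y).summable hE x).tsum_add
          ((polyBounded_dualKappa y').summable hE x)]
        exact tsum_congr fun n => add_smul _ _ _
      map_smul' := fun c y => by
        rw [RingHom.id_apply, ← ((polyBounded_dualKappa y).summable hE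
          x).tsum_const_smul c]
        exact tsum_congr fun n => smul_assoc c (y (single n 1)) (x n) }
  ContinuousLinearMap.toUniformConvergenceCLM (RingHom.id 𝕜) E
    (equicontinuousSets 𝕜 (RapidSeq 𝕜 d 𝕜)) ⟨L, by
    refine (PolynormableSpace.withSeminorms 𝕜 E).continuous_of_continuous_comp L fun p => ?_
    refine Seminorm.continuous_of_forall' fun r hr => ?_
    -- If y is small on the compact box of x and p, then so is ∑ |y(e_n)| p(x_n), this sum being
    -- |y(z)| for some z in the box.
    filter_upwards [UniformConvergenceCLM.eventually_nhds_zero_mapsTo (RingHom.id 𝕜)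
      (box_mem_absConvexCompacts x p) (Metric.closedBall_mem_nhds (0 : 𝕜) hr)] with y hy
    rw [Seminorm.mem_closedBall_zero, Seminorm.comp_apply]
    obtain ⟨z, hz, hyz⟩ := exists_mem_box_norm_eq (ofDualKappa y) x p
    have h1 := hy hz
    rw [mem_closedBall_zero_iff] at h1
    exact (seminorm_tsum_smul_le hE (polyBounded_dualKappa y) x p.2).trans
      (hyz.symm.le.trans h1)⟩

/-- The inverse of `u ↦ (u (δ_n))_n`. -/
def toEpsProd (hE : ∀ u : ℕ → E, CauchySeq u → ∃ x, Tendsto u atTop (𝓝 x)) :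
    RapidSeq 𝕜 d E →L[𝕜] EpsProd 𝕜 (RapidSeq 𝕜 d 𝕜) E :=
  let L : RapidSeq 𝕜 d E →ₗ[𝕜] EpsProd 𝕜 (RapidSeq 𝕜 d 𝕜) E :=
    { toFun := epsProdOf hE
      map_add' := fun x x' => DFunLike.ext _ _ fun y => by
        have hy := polyBounded_dualKappa y
        change ∑' n, y (single n 1) • (x n + x' n) = ∑' n, y (single n 1) • x n +
          ∑' n, y (single n 1) • x' n
        rw [← (hy.summable hE x).tsum_add (hy.summable hE x')]
        exact tsum_congr fun n => smul_add _ _ _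
      map_smul' := fun c x => DFunLike.ext _ _ fun y => by
        have hy := polyBounded_dualKappa y
        change ∑' n, y (single n 1) • c • x n = c • ∑' n, y (single n 1) • x n
        rw [← (hy.summable hE x).tsum_const_smul c]
        exact tsum_congr fun n => smul_comm _ _ _ }
  ⟨L, by
    refine continuous_of_continuousAt_zero L ?_
    rw [ContinuousAt, map_zero, UniformConvergenceCLM.nhds_zero_eq_of_basis _ _ _
      (PolynormableSpace.withSeminorms 𝕜 E).hasBasis_zero_ball]
    simp only [tendsto_iInf, tendsto_principal]
    rintro B hB ⟨s, r⟩ hr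
    let q : {p : Seminorm 𝕜 E // Continuous p} :=
      ⟨s.sup fun p => p.1, Seminorm.continuous_finsetSup fun p _ => p.2⟩
    obtain ⟨C, l, hC, h⟩ := exists_le_of_mem_equicontinuousSets hB
    let I : ℝ := ∑' n : Fin d → ℕ, (seqWeight (2 * d) n)⁻¹
    have hc : Continuous fun x : RapidSeq 𝕜 d E => C * (seminorm (l + 2 * d) q x * I) :=
      ((continuous_seminorm (l + 2 * d) q).mul continuous_const).const_mul C
    have h0 := hc.tendsto 0
    rw [map_zero, zero_mul, mul_zero] at h0
    filter_upwards [h0.eventually_lt_const hr] with x hx y hy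
    rw [Seminorm.mem_ball_zero]
    have hyb := polyBounded_dualKappa y
    have hsum := hyb.summable_seminorm x q.1 q.2
    simp only [map_smul_eq_mul] at hsum
    calc q.1 (∑' n, y (single n 1) • x n) ≤ ∑' n, ‖y (single n 1)‖ * q.1 (x n) :=
          seminorm_tsum_smul_le hE hyb x q.2
      _ ≤ ∑' n, C * (seqWeight l n * q.1 (x n)) :=
          hsum.tsum_le_tsum (fun n => by
            rw [← mul_assoc]
            exact mul_le_mul_of_nonneg_right ((h y hy _).trans
              (mul_le_mul_of_nonneg_left (seminorm_single_le n l) hC)) (apply_nonneg _ _))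
            ((summable_weight x q l).mul_left C)
      _ = C * ∑' n, seqWeight l n * q.1 (x n) := tsum_mul_left
      _ ≤ C * (seminorm (l + 2 * d) q x * I) :=
          mul_le_mul_of_nonneg_left (tsum_weight_le x q l) hC
      _ < r := hx⟩

theorem toEpsProd_apply (hE : ∀ u : ℕ → E, CauchySeq u → ∃ x, Tendsto u atTop (𝓝 x))
    (x : RapidSeq 𝕜 d E) (y : DualKappa 𝕜 (RapidSeq 𝕜 d 𝕜)) :
    toEpsProd hE x y = ∑' n, y (single n 1) • x n := rfl

/-- The isomorphism `s(ℕ_0^d) ε E ≃ s(ℕ_0^d, E)`, `u ↦ (u (δ_n))_n`. -/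
def epsProdEquiv (hE : ∀ u : ℕ → E, CauchySeq u → ∃ x, Tendsto u atTop (𝓝 x)) (d : ℕ) :
    EpsProd 𝕜 (RapidSeq 𝕜 d 𝕜) E ≃L[𝕜] RapidSeq 𝕜 d E :=
  ContinuousLinearEquiv.equivOfInverse ofEpsProd (toEpsProd hE)
    (fun u => DFunLike.ext _ _ fun y => (hasSum_epsProd u y).tsum_eq)
    fun x => ext fun m => by
      rw [ofEpsProd_apply, toEpsProd_apply, tsum_eq_single m]
      · change (single (𝕜 := 𝕜) m (1 : 𝕜) m) • x m = x m
        rw [single_apply, Pi.single_eq_same, one_smul]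
      · intro n hn
        change (single (𝕜 := 𝕜) n (1 : 𝕜) m) • x n = 0
        rw [single_apply, Pi.single_eq_of_ne hn.symm, zero_smul]

theorem epsProdEquiv_apply (hE : ∀ u : ℕ → E, CauchySeq u → ∃ x, Tendsto u atTop (𝓝 x))
    (u : EpsProd 𝕜 (RapidSeq 𝕜 d 𝕜) E) (n : Fin d → ℕ) :
    epsProdEquiv hE d u n = u (toDualKappa (rapidDelta 𝕜 n)) := rfl

end Operators

end RapidSeq

end EpsProductRapidSeq

/-! ### The expansion and the Schauder decomposition -/

section Expansion

variable {𝕜 : Type*} [RCLike 𝕜] {d : ℕ}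

/-- Isomorphic spaces have isomorphic ε-products. -/
def epsMapEquiv {F F' E : Type*} [AddCommGroup F] [Module 𝕜 F] [TopologicalSpace F]
    [AddCommGroup F'] [Module 𝕜 F'] [TopologicalSpace F'] [AddCommGroup E] [Module 𝕜 E]
    [TopologicalSpace E] [IsTopologicalAddGroup E] [ContinuousSMul 𝕜 E] (T : F ≃L[𝕜] F') :
    EpsProd 𝕜 F E ≃L[𝕜] EpsProd 𝕜 F' E :=
  ContinuousLinearEquiv.equivOfInverse
    (epsMap (T : F →L[𝕜] F') (ContinuousLinearMap.id 𝕜 E))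
    (epsMap (T.symm : F' →L[𝕜] F) (ContinuousLinearMap.id 𝕜 E))
    (fun u => DFunLike.ext _ _ fun y => by
      rw [epsMap_apply, epsMap_apply]
      refine congrArg u (DFunLike.ext _ _ fun z => ?_)
      rw [dualTranspose_apply, dualTranspose_apply]
      exact congrArg y (T.symm_apply_apply z))
    (fun u => DFunLike.ext _ _ fun y => by
      rw [epsMap_apply, epsMap_apply]
      refine congrArg u (DFunLike.ext _ _ fun z => ?_)
      rw [dualTranspose_apply, dualTranspose_apply]
      exact congrArg y (T.apply_symm_apply z))

variable {E : Type*} [AddCommGroup E] [Module 𝕜 E]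
  [UniformSpace E] [IsUniformAddGroup E] [ContinuousSMul 𝕜 E] [PolynormableSpace 𝕜 E] [T2Space E]

/-- The isomorphism `S(ℝ^d) ε E ≃ S(ℝ^d, E)`, obtained from that for the sequence spaces. -/
def schwartzEpsProdEquiv (hE : ∀ u : ℕ → E, CauchySeq u → ∃ x, Tendsto u atTop (𝓝 x))
    (hK : ∀ u : ℕ → 𝕜, CauchySeq u → ∃ x, Tendsto u atTop (𝓝 x)) (d : ℕ) :
    EpsProd 𝕜 (SchwartzFun 𝕜 d 𝕜) E ≃L[𝕜] SchwartzFun 𝕜 d E :=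
  ((epsMapEquiv (hermiteEquiv hK d)).trans (RapidSeq.epsProdEquiv hE d)).trans
    (hermiteEquiv hE d).symm

/-- The functional δ_t after scalar synthesis takes the value h_n(t) at e_n. The Hermite series at t
is thus the expansion of the transported operator at this functional, and the transposes of
synthesis and analysis cancel. -/
theorem schwartzEpsProdEquiv_apply (hE : ∀ u : ℕ → E, CauchySeq u → ∃ x, Tendsto u atTop (𝓝 x))
    (hK : ∀ u : ℕ → 𝕜, CauchySeq u → ∃ x, Tendsto u atTop (𝓝 x))
    (u : EpsProd 𝕜 (SchwartzFun 𝕜 d 𝕜) E) (t : EuclideanSpace ℝ (Fin d)) :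
    schwartzEpsProdEquiv hE hK d u t = u (toDualKappa (schwartzDelta 𝕜 t)) := by
  let v := epsMapEquiv (E := E) (hermiteEquiv hK d) u
  let y : DualKappa 𝕜 (RapidSeq 𝕜 d 𝕜) :=
    dualTranspose (hermiteSynthesis hK d) (toDualKappa (schwartzDelta 𝕜 t))
  have hy : ∀ n, y (RapidSeq.single n 1) = (hermiteFun n t : 𝕜) := fun n =>
    (hermiteSeries_single n (1 : 𝕜) t).trans (mul_one _)
  have h := (RapidSeq.hasSum_epsProd v y).tsum_eq
  simp only [hy] at h
  refine h.trans (congrArg u (DFunLike.ext _ _ fun g => ?_))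
  exact congrArg (fun g => g t) (hermiteSynthesis_hermiteAnalysis hK g)

theorem hermiteEquiv_eq_epsProd (hE : ∀ u : ℕ → E, CauchySeq u → ∃ x, Tendsto u atTop (𝓝 x))
    (hK : ∀ u : ℕ → 𝕜, CauchySeq u → ∃ x, Tendsto u atTop (𝓝 x)) (f : SchwartzFun 𝕜 d E) :
    hermiteEquiv hE d f = RapidSeq.epsProdEquiv hE d
      (epsMap (hermiteEquiv (𝕜 := 𝕜) hK d : SchwartzFun 𝕜 d 𝕜 →L[𝕜] RapidSeq 𝕜 d 𝕜)
        (ContinuousLinearMap.id 𝕜 E) ((schwartzEpsProdEquiv hE hK d).symm f)) := by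
  obtain ⟨u, rfl⟩ := (schwartzEpsProdEquiv hE hK d).surjective f
  rw [ContinuousLinearEquiv.symm_apply_apply]
  exact (hermiteEquiv hE d).apply_symm_apply _

/-- The projection of the Hermite expansion onto the multi-indices in `B`. -/
def hermiteProj (hE : ∀ u : ℕ → E, CauchySeq u → ∃ x, Tendsto u atTop (𝓝 x))
    (B : Set (Fin d → ℕ)) : SchwartzFun 𝕜 d E →L[𝕜] SchwartzFun 𝕜 d E :=
  ((hermiteSynthesis hE d).comp (RapidSeq.truncate 𝕜 E B)).comp (hermiteAnalysis hE d)

theorem hermiteProj_apply (hE : ∀ u : ℕ → E, CauchySeq u → ∃ x, Tendsto u atTop (𝓝 x))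
    (B : Set (Fin d → ℕ)) (f : SchwartzFun 𝕜 d E) : hermiteProj hE B f =
      hermiteSynthesis hE d (RapidSeq.truncate 𝕜 E B (hermiteAnalysis hE d f)) := rfl

theorem hermiteProj_singleton (hE : ∀ u : ℕ → E, CauchySeq u → ∃ x, Tendsto u atTop (𝓝 x))
    (n : Fin d → ℕ) (f : SchwartzFun 𝕜 d E) (t : EuclideanSpace ℝ (Fin d)) :
    hermiteProj hE {n} f t = (hermiteFun n t : 𝕜) • hermiteCoeff f n := by
  rw [hermiteProj_apply, RapidSeq.truncate_singleton, hermiteSynthesis_apply,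
    hermiteSeries_single, hermiteAnalysis_apply]

theorem sum_hermiteProj (hE : ∀ u : ℕ → E, CauchySeq u → ∃ x, Tendsto u atTop (𝓝 x))
    (A : Finset (Fin d → ℕ)) :
    ∑ n ∈ A, hermiteProj (𝕜 := 𝕜) hE {n} = hermiteProj hE (A : Set (Fin d → ℕ)) := by
  ext1 f
  rw [_root_.sum_apply]
  simp only [hermiteProj_apply]
  rw [← map_sum]
  congr 1
  ext n
  simp only [RapidSeq.truncate_singleton]
  rw [RapidSeq.sum_single_apply, RapidSeq.truncate_apply]
  simp only [Finset.mem_coe]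

/-- Analysis cancels the synthesis in the middle, leaving two successive truncations of a family. -/
theorem hermiteProj_comp (hE : ∀ u : ℕ → E, CauchySeq u → ∃ x, Tendsto u atTop (𝓝 x))
    (A B : Set (Fin d → ℕ)) :
    (hermiteProj (𝕜 := 𝕜) hE A).comp (hermiteProj hE B) = hermiteProj hE (A ∩ B) := by
  ext1 f
  rw [ContinuousLinearMap.comp_apply, hermiteProj_apply hE A, hermiteProj_apply hE B,
    hermiteProj_apply]
  congr 1
  ext n
  rw [RapidSeq.truncate_apply, RapidSeq.truncate_apply, hermiteAnalysis_apply,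
    hermiteCoeff_hermiteSynthesis, RapidSeq.truncate_apply]
  by_cases hA : n ∈ A <;> by_cases hB : n ∈ B <;> simp [hA, hB]

theorem hasSum_hermiteProj (hE : ∀ u : ℕ → E, CauchySeq u → ∃ x, Tendsto u atTop (𝓝 x))
    (f : SchwartzFun 𝕜 d E) : HasSum (fun n => hermiteProj hE {n} f) f := by
  have h := (hermiteSynthesis hE d).hasSum (RapidSeq.hasSum_single (hermiteAnalysis hE d f))
  rw [hermiteSynthesis_hermiteAnalysis] at h
  refine h.congr_fun fun n => ?_
  rw [hermiteProj_apply, RapidSeq.truncate_singleton]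

theorem idxBall_mono (d : ℕ) : Monotone (idxBall d) := fun _ _ hjk _ hn =>
  mem_idxBall.2 ((mem_idxBall.1 hn).trans (Nat.cast_le.2 hjk))

theorem tendsto_idxBall (d : ℕ) : Tendsto (idxBall d) atTop atTop :=
  tendsto_atTop_finset_of_monotone (idxBall_mono d) fun n => by
    obtain ⟨k, hk⟩ := exists_nat_ge √(∑ i, (n i : ℝ) ^ 2)
    exact ⟨k, mem_idxBall.2 hk⟩

theorem hermiteProj_ne [Nontrivial E]
    (hE : ∀ u : ℕ → E, CauchySeq u → ∃ x, Tendsto u atTop (𝓝 x)) {A B : Set (Fin d → ℕ)}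
    {n : Fin d → ℕ} (hA : n ∉ A) (hB : n ∈ B) :
    hermiteProj (𝕜 := 𝕜) hE A ≠ hermiteProj hE B := by
  intro h
  obtain ⟨e, he⟩ := exists_ne (0 : E)
  have h1 := congrArg (fun P => hermiteCoeff
    (P (hermiteSynthesis hE d (RapidSeq.single (𝕜 := 𝕜) n e))) n) h
  simp only [hermiteProj_apply, hermiteCoeff_hermiteSynthesis, RapidSeq.truncate_apply,
    hermiteAnalysis_apply, hA, hB, if_false, if_true, RapidSeq.single_apply,
    Pi.single_eq_same] at h1
  exact he h1.symm

theorem exists_mem_idxBall_notMem {d : ℕ} (hd : 1 ≤ d) {j k : ℕ} (hjk : j < k) :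
    ∃ n, n ∉ idxBall d j ∧ n ∈ idxBall d k := by
  -- The witness is k times the first unit vector, of Euclidean norm exactly k; its existence needs
  -- d ≥ 1.
  have hs : √(∑ i, ((Pi.single (⟨0, hd⟩ : Fin d) k : Fin d → ℕ) i : ℝ) ^ 2) = k := by
    rw [Finset.sum_eq_single (⟨0, hd⟩ : Fin d)]
    · rw [Pi.single_eq_same, Real.sqrt_sq (Nat.cast_nonneg k)]
    · intro i _ hi
      simp [hi]
    · simp
  refine ⟨Pi.single ⟨0, hd⟩ k, fun h => ?_, mem_idxBall.2 hs.le⟩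
  have h1 := mem_idxBall.1 h
  rw [hs, Nat.cast_le] at h1
  omega

theorem isSchauderDecomposition_hermiteProj [Nontrivial E]
    (hE : ∀ u : ℕ → E, CauchySeq u → ∃ x, Tendsto u atTop (𝓝 x)) (hd : 1 ≤ d) :
    IsSchauderDecomposition fun k => ∑ n ∈ idxBall d k, hermiteProj (𝕜 := 𝕜) hE {n} := by
  have hcomp : ∀ k j, (∑ n ∈ idxBall d k, hermiteProj (𝕜 := 𝕜) hE {n}).comp
      (∑ n ∈ idxBall d j, hermiteProj hE {n}) =
        ∑ n ∈ idxBall d (min j k), hermiteProj hE {n} := by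
    intro k j
    rw [sum_hermiteProj, sum_hermiteProj, sum_hermiteProj, hermiteProj_comp, ← Finset.coe_inter]
    congr 2
    rw [Finset.inter_comm]
    rcases le_total j k with h | h
    · rw [min_eq_left h, Finset.inter_eq_left.2 (idxBall_mono d h)]
    · rw [min_eq_right h, Finset.inter_eq_right.2 (idxBall_mono d h)]
  have hlt : ∀ {j k}, j < k → ∑ n ∈ idxBall d j, hermiteProj (𝕜 := 𝕜) hE {n} ≠
      ∑ n ∈ idxBall d k, hermiteProj hE {n} := by
    intro j k hjk
    obtain ⟨n, hn, hn'⟩ := exists_mem_idxBall_notMem hd hjk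
    rw [sum_hermiteProj, sum_hermiteProj]
    exact hermiteProj_ne hE (by simpa using hn) (by simpa using hn')
  refine ⟨fun k => by simpa using hcomp k k, hcomp, fun k j hkj => ?_, fun f => ?_⟩
  · rcases lt_or_gt_of_ne hkj with h | h
    · exact hlt h
    · exact (hlt h).symm
  · simp only [_root_.sum_apply]
    -- The balls exhaust ℕ_0^d, so convergence of P_k f is a special case of unconditional
    -- convergence.
    exact (hasSum_hermiteProj hE f).comp (tendsto_idxBall d)

end Expansion

end

theorem theorem4p9 {𝕜 : Type*} [RCLike 𝕜] {E : Type*} [AddCommGroup E] [Module 𝕜 E]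
    [UniformSpace E] [IsUniformAddGroup E] [ContinuousSMul 𝕜 E] [PolynormableSpace 𝕜 E]
    [T2Space E] [Nontrivial E]
    (hE : ∀ u : ℕ → E, CauchySeq u → ∃ x, Tendsto u atTop (𝓝 x))
    (d : ℕ) (hd : 1 ≤ d) :
    -- the Fourier coefficients are well-defined
    (∀ (f : SchwartzFun 𝕜 d E) (n : Fin d → ℕ),
      PettisIntegrable 𝕜 volume (fun x => (hermiteFun n x : 𝕜) • f x)) ∧
    (∀ (g : SchwartzFun 𝕜 d 𝕜) (n : Fin d → ℕ),
      PettisIntegrable 𝕜 volume (fun x => (hermiteFun n x : 𝕜) • g x)) ∧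
    -- the coefficient maps and the maps `u ↦ (x ↦ u δ_x)` are isomorphisms
    ∃ (FE : SchwartzFun 𝕜 d E ≃L[𝕜] RapidSeq 𝕜 d E)
      (FK : SchwartzFun 𝕜 d 𝕜 ≃L[𝕜] RapidSeq 𝕜 d 𝕜)
      (SS : EpsProd 𝕜 (SchwartzFun 𝕜 d 𝕜) E ≃L[𝕜] SchwartzFun 𝕜 d E)
      (Ss : EpsProd 𝕜 (RapidSeq 𝕜 d 𝕜) E ≃L[𝕜] RapidSeq 𝕜 d E),
      (∀ f n, FE f n = hermiteCoeff f n) ∧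
      (∀ g n, FK g n = hermiteCoeff g n) ∧
      (∀ u x, SS u x = u (toDualKappa (schwartzDelta 𝕜 x))) ∧
      (∀ u n, Ss u n = u (toDualKappa (rapidDelta 𝕜 n))) ∧
      (∀ f, FE f = Ss (epsMap (FK : SchwartzFun 𝕜 d 𝕜 →L[𝕜] RapidSeq 𝕜 d 𝕜)
        (ContinuousLinearMap.id 𝕜 E) (SS.symm f))) ∧
      -- Schauder decomposition and series representation
      ∃ Q : (Fin d → ℕ) → SchwartzFun 𝕜 d E →L[𝕜] SchwartzFun 𝕜 d E,
        (∀ n f x, Q n f x = (hermiteFun n x : 𝕜) • hermiteCoeff f n) ∧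
        IsSchauderDecomposition (fun k => ∑ n ∈ idxBall d k, Q n) ∧
        ∀ f, HasSum (fun n => Q n f) f := by
  have hK : ∀ u : ℕ → 𝕜, CauchySeq u → ∃ x, Tendsto u atTop (𝓝 x) := fun _ hu =>
    cauchySeq_tendsto_of_complete hu
  exact ⟨pettisIntegrable_hermiteFun_smul hE, pettisIntegrable_hermiteFun_smul hK,
    hermiteEquiv hE d, hermiteEquiv hK d, schwartzEpsProdEquiv hE hK d,
    RapidSeq.epsProdEquiv hE d, fun _ _ => rfl, fun _ _ => rfl, schwartzEpsProdEquiv_apply hE hK,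
    RapidSeq.epsProdEquiv_apply hE, hermiteEquiv_eq_epsProd hE hK,
    fun n => hermiteProj hE {n}, hermiteProj_singleton hE,
    isSchauderDecomposition_hermiteProj hE hd, hasSum_hermiteProj hE⟩
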